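/- Let $d$ be the dimension, $Q=[-\frac12,\frac12]^d$ and $I_N=[-\frac N2,\frac N2]^d$ for odd $N\in\mathbb N$. Let $A_{per},C_{per}:\mathbb R^d\to\mathbb R^{d\times d}$ be measurable $\mathbb Z^d$-periodic tensor fields, and let $M>0$ and $0<\alpha\le\beta$ be such that for all $\xi\in\mathbb R^d$, for almost all $x\in\mathbb R^d$ and for all $s\in[-M,M]$, $$\alpha|\xi|^2\le (A_{per}+sC_{per})(x)\xi\cdot\xi,\qquad |(A_{per}+sC_{per})(x)\xi|\le\beta|\xi| .$$ Let $(B_\eta)_{\eta>0}$ be real random variables with $\|B_\eta\|_{L^\infty}\le M-\epsilon$ for all $\eta>0$ and some $\epsilon>0$ independent of $\eta$, and $\|B_\eta\|_{L^2}\to0$ as $\eta\to0^+$. Assume that there are distributions $d\bar P_1,d\bar P_2\in\mathcal E'(]-M,M[)$ (distributions with compact support in $]-M,M[$) such that for every $\varphi\in C^\infty(]-M,M[)$, $$\mathbb E(\varphi(B_\eta))=\varphi(0)+\eta\langle d\bar P_1,\varphi\rangle+\eta^2\langle d\bar P_2,\varphi\rangle+o(\eta^2)\qquad(\eta\to0^+).$$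 For $s\in[-M,M]$ let $A_1^{s,0}=A_{per}+s\mathbf 1_QC_{per}$, and let $w_i^{1,s,0,N}$ be the $(N\mathbb Z)^d$-periodic solution in $H^1_{loc}$ of $-\operatorname{div}(A_1^{s,0}(\nabla w_i^{1,s,0,N}+e_i))=0$ in $I_N$. Let $w_i^0$ and $\tilde w_j^0$ be the $\mathbb Z^d$-periodic solutions in $H^1_{loc}$ of $-\operatorname{div}(A_{per}(\nabla w_i^0+e_i))=0$ and $-\operatorname{div}(A_{per}^T(\nabla\tilde w_j^0+e_j))=0$ in $Q$, and let $q_i^{1,s,0,\infty}\in L^2_{loc}(\mathbb R^d)$ be a solution, with $\nabla q_i^{1,s,0,\infty}\in L^2(\mathbb R^d)$, of $$-\operatorname{div}(A_1^{s,0}\nabla q_i^{1,s,0,\infty})=\operatorname{div}(s\mathbf 1_QC_{per}(\nabla w_i^0+e_i))\quad\text{in }\mathbb R^d .$$ These functions exist and their gradients are unique. Moreover the functions of $s$ to which $d\bar P_1$ is applied below are $C^\infty$ on $]-M,M[$. Define the tensor $A_1^{*,N}$ by $$A_1^{*,N}e_i=\Big\langle d\bar P_1(s),\int_{I_N}A_1^{s,0}(\nabla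 w_i^{1,s,0,N}+e_i)\Big\rangle,\qquad 1\le i\le d .$$ Then $A_1^{*,N}$ converges in $\mathbb R^{d\times d}$, as $N\to\infty$ ($N$ odd), to the finite limit $\bar A_1^*$ given, for all $1\le i,j\le d$, by $$\bar A_1^*e_i\cdot e_j=\Big\langle s\,d\bar P_1(s),\int_QC_{per}(\nabla w_i^0+e_i)\cdot(e_j+\nabla\tilde w_j^0)\Big\rangle+\Big\langle d\bar P_1(s),\int_Q s\,C_{per}\nabla q_i^{1,s,0,\infty}\cdot(e_j+\nabla\tilde w_j^0)\Big\rangle .$$ -/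

import Mathlib

open MeasureTheory Filter Topology Set
open scoped ContDiff Distributions

noncomputable section

/-! ### Distributions with compact support in an open set of the line -/

/-- The compact set `K ⊆ U` carries the distribution `T` on `U`: `T` vanishes on all test functions
whose support does not meet `K`. -/
def IsCarrier {U : TopologicalSpace.Opens ℝ} (T : 𝓓'(U, ℝ)) (K : Set ℝ) : Prop :=
  IsCompact K ∧ K ⊆ U ∧ ∀ ψ : 𝓓(U, ℝ), tsupport ψ ⊆ Kᶜ → T ψ = 0

/-- The space `ℰ'(U)` of distributions on `U` with compact support in `U`. -/
structure CompactDistribution (U : TopologicalSpace.Opens ℝ) where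
  /-- The underlying distribution. -/
  toDistribution : 𝓓'(U, ℝ)
  hasCompactCarrier : ∃ K : Set ℝ, IsCarrier toDistribution K

open Classical in
/-- The action `⟨T, φ⟩` of `T ∈ ℰ'(U)` on `φ ∈ C^∞(U)`: the value of `T` at any test function that
coincides with `φ` in a neighbourhood of a compact set carrying `T` (for instance `χ φ`, with `χ` a
cut-off function equal to `1` there). The next lemmas show that such a test function exists, and
that the value does not depend on it. -/
def CompactDistribution.pairing {U : TopologicalSpace.Opens ℝ} (T : CompactDistribution U)
    (φ : ℝ → ℝ) : ℝ :=
  if h : ∃ ψ : 𝓓(U, ℝ), ∃ K : Set ℝ, IsCarrier T.toDistribution K ∧ ψ =ᶠ[𝓝ˢ K] φ then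
    T.toDistribution h.choose
  else 0

/-- A smooth function on `U` coincides with a test function near every compact subset of `U`. -/
theorem exists_testFunction_eq_near {U : TopologicalSpace.Opens ℝ} {φ : ℝ → ℝ}
    (hφ : ContDiffOn ℝ ∞ φ U) {K : Set ℝ} (hK : IsCompact K) (hKU : K ⊆ U) :
    ∃ ψ : 𝓓(U, ℝ), ψ =ᶠ[𝓝ˢ K] φ := by
  obtain ⟨L, hL, hKL, hLU⟩ := exists_compact_between hK U.isOpen hKU
  obtain ⟨χ, hχ0, hχ1, -⟩ := exists_contMDiffMap_zero_one_nhds_of_isClosed (n := (⊤ : ℕ∞))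
    (modelWithCornersSelf ℝ ℝ) (s := (interior L)ᶜ) (t := K) isOpen_interior.isClosed_compl
    hK.isClosed (disjoint_compl_left_iff_subset.2 hKL)
  have hsupp : tsupport (fun x => χ x * φ x) ⊆ L := by
    refine closure_minimal (fun x hx => ?_) hL.isClosed
    by_contra hxL
    have : χ x = 0 := hχ0.self_of_nhdsSet x (fun h => hxL (interior_subset h))
    exact hx (by simp [this])
  have hsm : ContDiff ℝ ∞ (fun x => χ x * φ x) := by
    rw [contDiff_iff_contDiffAt]
    intro x
    by_cases hx : x ∈ U
    · exact (χ.contMDiff.contDiff.contDiffAt).mul (hφ.contDiffAt (U.isOpen.mem_nhds hx))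
    · have : (fun x => χ x * φ x) =ᶠ[𝓝 x] fun _ => 0 := by
        have := (isClosed_tsupport (fun x => χ x * φ x)).isOpen_compl.mem_nhds
          (show x ∈ _ from fun h => hx (hLU (hsupp h)))
        filter_upwards [this] with y hy
        exact image_eq_zero_of_notMem_tsupport (f := fun x => χ x * φ x) hy
      exact contDiffAt_const.congr_of_eventuallyEq this
  refine ⟨⟨_, hsm, hL.of_isClosed_subset (isClosed_tsupport _) hsupp, hsupp.trans hLU⟩, ?_⟩
  filter_upwards [hχ1] with x hx
  change χ x * φ x = φ x
  rw [hx, one_mul]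

/-- The value of the pairing is the value at any admissible test function. -/
theorem CompactDistribution.pairing_eq {U : TopologicalSpace.Opens ℝ} (T : CompactDistribution U)
    {φ : ℝ → ℝ} {K : Set ℝ} (hK : IsCarrier T.toDistribution K) {ψ : 𝓓(U, ℝ)}
    (hψ : ψ =ᶠ[𝓝ˢ K] φ) : T.pairing φ = T.toDistribution ψ := by
  have h : ∃ ψ : 𝓓(U, ℝ), ∃ K : Set ℝ, IsCarrier T.toDistribution K ∧ ψ =ᶠ[𝓝ˢ K] φ :=
    ⟨ψ, K, hK, hψ⟩
  rw [pairing, dif_pos h]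
  obtain ⟨K', hK', hψ'⟩ := h.choose_spec
  generalize h.choose = ψ' at hψ'
  rw [← sub_eq_zero, ← map_sub]
  set δ := ψ' - ψ with hδ
  have hδ0 : ∀ x ∈ K ∩ K', x ∉ tsupport δ := by
    intro x hx
    rw [notMem_tsupport_iff_eventuallyEq]
    have h1 := hψ.filter_mono (nhds_le_nhdsSet hx.1)
    have h2 := hψ'.filter_mono (nhds_le_nhdsSet hx.2)
    filter_upwards [h1, h2] with y hy1 hy2
    simp [hδ, hy1, hy2]
  obtain ⟨χ, hχ0, hχ1, -⟩ := exists_contMDiffMap_zero_one_nhds_of_isClosed (n := (⊤ : ℕ∞))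
    (modelWithCornersSelf ℝ ℝ) (s := tsupport δ ∩ K) (t := tsupport δ ∩ K')
    ((isClosed_tsupport _).inter hK.1.isClosed) ((isClosed_tsupport _).inter hK'.1.isClosed)
    (Set.disjoint_left.2 fun x h1 h2 => hδ0 x ⟨h1.2, h2.2⟩ h1.1)
  have hc : ContDiff ℝ ∞ χ := χ.contMDiff.contDiff
  let δ₁ : 𝓓(U, ℝ) := ⟨fun x => χ x * δ x, hc.mul δ.contDiff, δ.hasCompactSupport.mul_left,
    (tsupport_mul_subset_right).trans δ.tsupport_subset⟩
  let δ₂ : 𝓓(U, ℝ) := ⟨fun x => (1 - χ x) * δ x, (contDiff_const.sub hc).mul δ.contDiff,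
    δ.hasCompactSupport.mul_left, (tsupport_mul_subset_right).trans δ.tsupport_subset⟩
  have hsum : δ = δ₁ + δ₂ := by
    ext x
    change δ x = χ x * δ x + (1 - χ x) * δ x
    ring
  have h1 : T.toDistribution δ₁ = 0 := by
    refine hK.2.2 _ fun x hx hxK => ?_
    refine (notMem_tsupport_iff_eventuallyEq.2 ?_) hx
    have := hχ0.filter_mono (nhds_le_nhdsSet
      (show x ∈ tsupport δ ∩ K from ⟨tsupport_mul_subset_right hx, hxK⟩))
    filter_upwards [this] with y hy
    change χ y * δ y = 0
    simp [hy]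
  have h2 : T.toDistribution δ₂ = 0 := by
    refine hK'.2.2 _ fun x hx hxK => ?_
    refine (notMem_tsupport_iff_eventuallyEq.2 ?_) hx
    have := hχ1.filter_mono (nhds_le_nhdsSet
      (show x ∈ tsupport δ ∩ K' from ⟨tsupport_mul_subset_right hx, hxK⟩))
    filter_upwards [this] with y hy
    change (1 - χ y) * δ y = 0
    simp [hy]
  rw [hsum, map_add, h1, h2, add_zero]

/-- The open interval `]-M, M[`. -/
def amplitudes (M : ℝ) : TopologicalSpace.Opens ℝ := ⟨Ioo (-M) M, isOpen_Ioo⟩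

/-! ### Sobolev functions on `ℝ^d` -/

/-- `ℝ^d` with its Euclidean norm. -/
abbrev Space (d : ℕ) : Type := EuclideanSpace ℝ (Fin d)

/-- The canonical basis vector `e_i`. -/
abbrev unitVec {d : ℕ} (i : Fin d) : Space d := EuclideanSpace.single i 1

/-- `G` is the gradient of `u` in the sense of distributions on `ℝ^d`. -/
def HasWeakGradient {d : ℕ} (u : Space d → ℝ) (G : Space d → Space d) : Prop :=
  LocallyIntegrable u ∧ LocallyIntegrable G ∧
    ∀ φ : Space d → ℝ, ContDiff ℝ ∞ φ → HasCompactSupport φ → ∀ i : Fin d,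
      ∫ x, u x * fderiv ℝ φ x (unitVec i) = -∫ x, G x i * φ x

open Classical in
/-- The weak gradient `∇u`, which is unique up to a null set (and `0` if there is none). -/
def weakGradient {d : ℕ} (u : Space d → ℝ) : Space d → Space d :=
  if h : ∃ G, HasWeakGradient u G then h.choose else 0

/-- Two weak gradients of the same function coincide almost everywhere. -/
theorem HasWeakGradient.ae_eq {d : ℕ} {u : Space d → ℝ} {G H : Space d → Space d}
    (hG : HasWeakGradient u G) (hH : HasWeakGradient u H) : G =ᵐ[volume] H := by
  have key : ∀ i : Fin d, ∀ᵐ x, G x i = H x i := by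
    intro i
    have loc : ∀ {F : Space d → Space d}, LocallyIntegrable F →
        LocallyIntegrable (fun x => F x i) := by
      intro F hF x
      obtain ⟨s, hs, hi⟩ := hF x
      exact ⟨s, hs, (EuclideanSpace.proj (𝕜 := ℝ) i).integrable_comp hi⟩
    refine ae_eq_of_integral_contDiff_smul_eq (loc hG.2.1) (loc hH.2.1) fun g hg hgs => ?_
    have h1 := hG.2.2 g hg hgs i
    have h2 := hH.2.2 g hg hgs i
    simp only [smul_eq_mul, mul_comm (g _)]
    linarith
  filter_upwards [ae_all_iff.2 key] with x hx
  ext i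
  exact hx i

/-- `f` belongs to `L²_loc(ℝ^d)`. -/
def MemL2Loc {d : ℕ} {F : Type*} [NormedAddCommGroup F] (f : Space d → F) : Prop :=
  ∀ K : Set (Space d), IsCompact K → MemLp f 2 (volume.restrict K)

/-- `u` belongs to `H¹_loc(ℝ^d)`. -/
def MemH1Loc {d : ℕ} (u : Space d → ℝ) : Prop :=
  MemL2Loc u ∧ ∃ G, HasWeakGradient u G ∧ MemL2Loc G

/-! ### Periodic problems and the problem with one defect in the whole space -/

/-- The cube `[-N/2, N/2]^d`; the unit cell `Q` is `cube 1` and the supercell `I_N` is `cube N`. -/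
def cube {d : ℕ} (N : ℕ) : Set (Space d) := {x | ∀ i, x i ∈ Icc (-(N / 2 : ℝ)) (N / 2)}

/-- `f` is `(Nℤ)^d`-periodic (almost everywhere). -/
def IsPeriodicField {d : ℕ} {α : Type*} (N : ℕ) (f : Space d → α) : Prop :=
  ∀ k : Fin d → ℤ, ∀ᵐ x, f (x + WithLp.toLp 2 fun i => (N : ℝ) * k i) = f x

/-- The action of a matrix on a vector of `ℝ^d`. -/
abbrev act {d : ℕ} (A : Matrix (Fin d) (Fin d) ℝ) (ξ : Space d) : Space d :=
  Matrix.toEuclideanLin A ξ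

/-- `w` is an `i`-th cell solution for the periodic homogenization of `A` on `I_N`: it solves
`-div (A (∇w + e_i)) = 0` in `I_N` with `(Nℤ)^d`-periodic boundary conditions, in the variational
sense, the test functions being the `(Nℤ)^d`-periodic functions of `H¹_loc`. -/
def IsPeriodicCorrector {d : ℕ} (N : ℕ) (A : Space d → Matrix (Fin d) (Fin d) ℝ) (i : Fin d)
    (w : Space d → ℝ) : Prop :=
  MemH1Loc w ∧ IsPeriodicField N w ∧
    ∀ v : Space d → ℝ, MemH1Loc v → IsPeriodicField N v →
      ∫ x in cube N, inner ℝ (act (A x) (weakGradient w x + unitVec i)) (weakGradient v x) = 0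

/-- The tensor field `A_1^{s,0} = A + s 1_Q C`, with a defect of amplitude `s` in the cell `Q`. -/
def defectField {d : ℕ} (A C : Space d → Matrix (Fin d) (Fin d) ℝ) (s : ℝ) :
    Space d → Matrix (Fin d) (Fin d) ℝ :=
  fun x => A x + s • (cube 1).indicator C x

/-- `q` is an `i`-th single-defect corrector in the whole space, `w₀` being the `i`-th periodic cell
solution: `q ∈ L²_loc`, `∇q ∈ L²(ℝ^d)`, and
`-div (A_1^{s,0} ∇q) = div (s 1_Q C (∇w₀ + e_i))` in the sense of distributions on `ℝ^d`. -/
def IsDefectCorrector {d : ℕ} (A C : Space d → Matrix (Fin d) (Fin d) ℝ) (s : ℝ) (i : Fin d)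
    (w₀ q : Space d → ℝ) : Prop :=
  MemH1Loc q ∧ MemLp (weakGradient q) 2 volume ∧
    ∀ φ : Space d → ℝ, ContDiff ℝ ∞ φ → HasCompactSupport φ →
      ∫ x, inner ℝ (act (defectField A C s x) (weakGradient q x)) (gradient φ x) =
        -∫ x in cube 1, s * inner ℝ (act (C x) (weakGradient w₀ x + unitVec i)) (gradient φ x)

/-! ### The first-order tensors -/

/-- `(∫_{I_N} A_1^{s,0} (∇w + e_i)) · e_j`. -/
def supercellFlux {d : ℕ} (A C : Space d → Matrix (Fin d) (Fin d) ℝ) (N : ℕ) (s : ℝ)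
    (w : Space d → ℝ) (i j : Fin d) : ℝ :=
  ∫ x in cube N, inner ℝ (act (defectField A C s x) (weakGradient w x + unitVec i)) (unitVec j)

/-- The tensor `A_1^{*,N}`, defined by `A_1^{*,N} e_i = ⟨T(s), ∫_{I_N} A_1^{s,0} (∇w_{s,i} + e_i)⟩`
for all `i`, where `w s i` is the `i`-th cell solution of `A_1^{s,0}` on `I_N`. -/
def firstOrderTensor {d : ℕ} {M : ℝ} (T : CompactDistribution (amplitudes M))
    (A C : Space d → Matrix (Fin d) (Fin d) ℝ) (N : ℕ) (w : ℝ → Fin d → Space d → ℝ) :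
    Matrix (Fin d) (Fin d) ℝ :=
  Matrix.of fun j i => T.pairing fun s => supercellFlux A C N s (w s i) i j

/-- `∫_Q C F · (e_j + ∇v)`. -/
def cellForm {d : ℕ} (C : Space d → Matrix (Fin d) (Fin d) ℝ) (F : Space d → Space d)
    (v : Space d → ℝ) (j : Fin d) : ℝ :=
  ∫ x in cube 1, inner ℝ (act (C x) (F x)) (unitVec j + weakGradient v x)

end

/-! Write `T_s` for multiplication by `A + s 1_Q C` on square integrable fields and `b = 1_Q C (∇w₀
+ e_i)`. A cell solution for `A` on `Q` is also one on every odd supercell, so on `I_N` the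
corrector with a defect has gradient `∇w₀ + s p_N(s)`, where `p_N(s)` solves the coercive problem
with operator `T_s` and source `b` among periodic gradients (`gradField_defect`). Testing the flux
against `e_j + ∇w̃_j` instead of `e_j` changes nothing, and the adjoint equation then reduces the
contribution of `A` to a number independent of `s` (`supercellFlux_eq`). The `j`-th component of the
flux is therefore `κ_N + s ∫_Q C (∇w₀ + e_i) · (e_j + ∇w̃_j) + s² ∫_Q C p_N(s) · (e_j + ∇w̃_j)`. The
constant `κ_N` is annihilated by the first-order distribution, the linear term does not depend on
`N`, and only the factor of `s²` has to converge.

A distribution of unknown order would in principle require convergence of derivatives in `s`. This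
is avoided because the pairing is the limit of `(E φ(B_η) - φ(0)) / η`: an error bounded by `δ s²`,
up to a constant, changes it by at most `δ` times its value on `s²`
(`HasFirstOrder.abs_pairing_sub_le`). Uniform convergence of `p_N(s)` on `[-M, M]` is enough.

The limit is the solution `p(s)` of the same problem among square integrable gradients on the whole
space. Gradients of test functions are dense there (`squareGradients_le_closure`), so `p(s)` is
close to some `∇φ`. For large `N`, `φ` can be periodized, and `V = p_N(s) - ∇φ` is a periodic
gradient on the cell. Truncating its potential gives a whole-space gradient `Z` that equals `V` near
the support of `φ` and near `Q`, with norm at most a constant times that of `V`. Comparing the two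
equations gives `⟨T_s V, V⟩ = ⟨T_s (p(s) - ∇φ), Z⟩`, and coercivity makes `V` small
(`solveOn_periodicGradients_near`). A Lipschitz bound in `s`, independent of `N`, and compactness of
`[-M, M]` make this uniform.

The truncation costs a factor independent of the radius because the Poincaré constant of a ball is
linear in its radius, while the gradient of the cutoff is inversely proportional to it. The same
truncation proves the density. -/

/-! ### Coercive problems on closed subspaces of a Hilbert space -/

section Coercive

variable {X : Type*} [NormedAddCommGroup X] [InnerProductSpace ℝ X]

/-- The operator `T` is coercive on the subspace `K`, with constant `α`. -/
def IsCoerciveOn (K : Submodule ℝ X) (T : X →L[ℝ] X) (α : ℝ) : Prop :=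
  ∀ v ∈ K, α * ‖v‖ ^ 2 ≤ inner ℝ (T v) v

/-- The compression of `T` to `K`. -/
noncomputable def compress (K : Submodule ℝ X) [CompleteSpace K] (T : X →L[ℝ] X) : K →L[ℝ] K :=
  K.orthogonalProjectionOnto ∘L T ∘L K.subtypeL

/-- The solution `p ∈ K` of `⟪T p, v⟫ = -⟪b, v⟫` for all `v ∈ K`. -/
noncomputable def solveOn (K : Submodule ℝ X) [CompleteSpace K] (T : X →L[ℝ] X) (b : X) : X :=
  ((-(compress K T).inverse (K.orthogonalProjectionOnto b) : K) : X)

variable {K : Submodule ℝ X} [CompleteSpace K] {T : X →L[ℝ] X} {α : ℝ} {b : X}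

theorem inner_compress (T : X →L[ℝ] X) (u v : K) :
    inner ℝ (compress K T u) v = inner ℝ (T u) (v : X) := by
  simp [compress]

/-- Lax–Milgram, applied to the bilinear form of the compression. -/
theorem IsCoerciveOn.isInvertible (hα : 0 < α) (hT : IsCoerciveOn K T α) :
    (compress K T).IsInvertible := by
  let B : K →L[ℝ] K →L[ℝ] ℝ := (innerSL ℝ) ∘L (compress K T)
  have hB : IsCoercive B := by
    refine ⟨α, hα, fun u => ?_⟩
    have h1 : B u u = inner ℝ (T u) (u : X) := inner_compress T u u
    rw [h1, mul_assoc, ← pow_two]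
    exact hT u u.2
  refine ⟨hB.continuousLinearEquivOfBilin, ?_⟩
  ext1 u
  refine (hB.unique_continuousLinearEquivOfBilin fun w => ?_).symm
  rfl

theorem solveOn_mem : solveOn K T b ∈ K := Subtype.coe_prop _

theorem IsCoerciveOn.inner_solveOn (hα : 0 < α) (hT : IsCoerciveOn K T α) {v : X} (hv : v ∈ K) :
    inner ℝ (T (solveOn K T b)) v = -inner ℝ b v := by
  obtain ⟨e, he⟩ := hT.isInvertible hα
  have h1 := inner_compress T (-(compress K T).inverse (K.orthogonalProjectionOnto b)) ⟨v, hv⟩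
  have h2 : compress K T (-(compress K T).inverse (K.orthogonalProjectionOnto b)) =
      -K.orthogonalProjectionOnto b := by
    rw [← he, ContinuousLinearMap.inverse_equiv]
    simp
  rw [h2] at h1
  rw [solveOn, ← h1]
  simp

theorem IsCoerciveOn.eq_solveOn (hα : 0 < α) (hT : IsCoerciveOn K T α) {p : X} (hp : p ∈ K)
    (h : ∀ v ∈ K, inner ℝ (T p) v = -inner ℝ b v) : p = solveOn K T b := by
  have hmem : p - solveOn K T b ∈ K := K.sub_mem hp solveOn_mem
  have h1 := hT _ hmem
  have h2 : inner ℝ (T (p - solveOn K T b)) (p - solveOn K T b) = 0 := by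
    rw [map_sub, inner_sub_left, h _ hmem, hT.inner_solveOn hα hmem, sub_self]
  rw [h2] at h1
  have h3 : ‖p - solveOn K T b‖ ^ 2 ≤ 0 := by
    by_contra hc
    push Not at hc
    nlinarith
  have h4 : ‖p - solveOn K T b‖ = 0 := by nlinarith [norm_nonneg (p - solveOn K T b)]
  exact sub_eq_zero.1 (norm_eq_zero.1 h4)

theorem le_of_mul_sq_le {a x y : ℝ} (hx : 0 ≤ x) (hy : 0 ≤ y) (h : a * x ^ 2 ≤ y * x) :
    a * x ≤ y := by
  rcases hx.eq_or_lt with rfl | hx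
  · simpa using hy
  · nlinarith

theorem IsCoerciveOn.norm_solveOn_le (hα : 0 < α) (hT : IsCoerciveOn K T α) :
    α * ‖solveOn K T b‖ ≤ ‖b‖ := by
  refine le_of_mul_sq_le (norm_nonneg _) (norm_nonneg _) ?_
  have h1 := hT _ (solveOn_mem (T := T) (b := b))
  rw [hT.inner_solveOn hα solveOn_mem] at h1
  refine h1.trans ?_
  rw [← inner_neg_left, ← norm_neg b]
  exact real_inner_le_norm _ _

/-- On `K` the difference of the two solutions solves the problem for `T` with source `(T - S)`
applied to the second one; it is tested against itself. -/
theorem IsCoerciveOn.norm_solveOn_sub_le (hα : 0 < α) (hT : IsCoerciveOn K T α) {S : X →L[ℝ] X}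
    (hS : IsCoerciveOn K S α) :
    α * ‖solveOn K T b - solveOn K S b‖ ≤ ‖T - S‖ * ‖solveOn K S b‖ := by
  refine le_of_mul_sq_le (norm_nonneg _) (by positivity) ?_
  set δ := solveOn K T b - solveOn K S b with hδ
  have hmem : δ ∈ K := K.sub_mem solveOn_mem solveOn_mem
  have h1 := hT _ hmem
  have h2 : inner ℝ (T δ) δ = -inner ℝ ((T - S) (solveOn K S b)) δ := by
    have h3 := hT.inner_solveOn (b := b) hα hmem
    have h4 := hS.inner_solveOn (b := b) hα hmem
    rw [sub_apply, inner_sub_left, h4]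
    conv_lhs => rw [hδ, map_sub, ← hδ, inner_sub_left, h3]
    ring
  rw [h2] at h1
  refine h1.trans ?_
  rw [← inner_neg_left]
  refine (real_inner_le_norm _ _).trans ?_
  rw [norm_neg]
  gcongr
  exact (T - S).le_opNorm _

/-- The compression is affine in `s`, and inversion is smooth at invertible operators. All
smoothness in the amplitude of the defect comes from here. -/
theorem contDiffOn_solveOn (hα : 0 < α) {S : Set ℝ} {T₀ T₁ : X →L[ℝ] X}
    (h : ∀ s ∈ S, IsCoerciveOn K (T₀ + s • T₁) α) :
    ContDiffOn ℝ ∞ (fun s : ℝ => solveOn K (T₀ + s • T₁) b) S := by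
  intro s hs
  have h1 : ContDiff ℝ ∞ fun s : ℝ => compress K (T₀ + s • T₁) := by
    exact contDiff_const.clm_comp
      ((contDiff_const.add (contDiff_id.smul contDiff_const)).clm_comp contDiff_const)
  have h2 : ContDiffAt ℝ ∞ (fun s : ℝ => (compress K (T₀ + s • T₁)).inverse) s :=
    ContDiffAt.comp (g := ContinuousLinearMap.inverse) s
      ((h s hs).isInvertible hα).contDiffAt_map_inverse h1.contDiffAt
  have h3 : ContDiffAt ℝ ∞ (fun s : ℝ => solveOn K (T₀ + s • T₁) b) s := by
    unfold solveOn
    exact K.subtypeL.contDiff.contDiffAt.comp s (h2.clm_apply contDiffAt_const).neg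
  exact h3.contDiffWithinAt

end Coercive

/-! ### The first term of the expansion of the laws -/

section Expansion

variable {Ω : Type*} [MeasurableSpace Ω] {P : Measure Ω} {M ε : ℝ} {B : ℝ → Ω → ℝ}
  {P₁ P₂ : CompactDistribution (amplitudes M)}

/-- The expansion of the laws of `B η` to first order. -/
def HasFirstOrder (P : Measure Ω) (B : ℝ → Ω → ℝ) (T : CompactDistribution (amplitudes M)) : Prop :=
  ∀ φ : ℝ → ℝ, ContDiffOn ℝ ∞ φ (Ioo (-M) M) →
    (∀ η > 0, Integrable (fun y => φ (B η y)) P) ∧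
    Tendsto (fun η => ((∫ y, φ (B η y) ∂P) - φ 0) / η) (𝓝[>] (0 : ℝ)) (𝓝 (T.pairing φ))

/-- Nothing is known of `φ` outside the open interval, but the values of `f` almost surely stay in a
compact subinterval, so `φ` may be cut off there; this gives both measurability and a bound. -/
theorem integrable_comp_of_bound [IsFiniteMeasure P] (hε : 0 < ε) {f : Ω → ℝ}
    (hf : AEMeasurable f P) (hbd : ∀ᵐ y ∂P, |f y| ≤ M - ε) {φ : ℝ → ℝ}
    (hφ : ContinuousOn φ (Ioo (-M) M)) : Integrable (fun y => φ (f y)) P := by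
  have hsub : Icc (-(M - ε)) (M - ε) ⊆ Ioo (-M) M := fun x hx => ⟨by linarith [hx.1], by linarith [hx.2]⟩
  have hmeas : Measurable ((Icc (-(M - ε)) (M - ε)).indicator φ) := by
    classical
    rw [← piecewise_eq_indicator]
    exact (hφ.mono hsub).measurable_piecewise continuousOn_const measurableSet_Icc
  obtain ⟨c, hc⟩ := isCompact_Icc.exists_bound_of_continuousOn (hφ.mono hsub)
  have hae : (fun y => (Icc (-(M - ε)) (M - ε)).indicator φ (f y)) =ᵐ[P] fun y => φ (f y) := by
    filter_upwards [hbd] with y hy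
    exact indicator_of_mem (mem_Icc.2 (abs_le.1 hy)) _
  refine Integrable.of_bound ((hmeas.comp_aemeasurable hf).congr hae).aestronglyMeasurable c ?_
  filter_upwards [hbd] with y hy
  exact hc _ (abs_le.1 hy)

theorem hasFirstOrder_of_expansion [IsProbabilityMeasure P] (hε : 0 < ε)
    (hBmeas : ∀ η > 0, AEMeasurable (B η) P) (hBbdd : ∀ η > 0, ∀ᵐ y ∂P, |B η y| ≤ M - ε)
    (hexp : ∀ φ : ℝ → ℝ, ContDiffOn ℝ ∞ φ (Ioo (-M) M) →
      (fun η => (∫ y, φ (B η y) ∂P) - (φ 0 + η * P₁.pairing φ + η ^ 2 * P₂.pairing φ))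
        =o[𝓝[>] (0 : ℝ)] fun η => η ^ 2) : HasFirstOrder P B P₁ := by
  intro φ hφ
  refine ⟨fun η hη => integrable_comp_of_bound hε (hBmeas η hη) (hBbdd η hη) hφ.continuousOn, ?_⟩
  have h1 := (hexp φ hφ).tendsto_div_nhds_zero
  have hη : Tendsto (fun η : ℝ => η) (𝓝[>] 0) (𝓝 0) := tendsto_id.mono_left nhdsWithin_le_nhds
  -- The difference quotient is `η` times the normalized remainder, plus `η` times the second-order
  -- term, plus the first-order pairing.
  have h2 := ((hη.mul h1).add (hη.mul_const (P₂.pairing φ))).add_const (P₁.pairing φ)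
  simp only [zero_mul, zero_add] at h2
  refine h2.congr' ?_
  filter_upwards [self_mem_nhdsWithin] with η hη
  have : η ≠ 0 := ne_of_gt hη
  field_simp
  ring

/-- Additivity is read off from the limits of difference quotients, so that no test functions need
to be compared. -/
theorem HasFirstOrder.pairing_add (hP : HasFirstOrder P B P₁) {f g : ℝ → ℝ}
    (hf : ContDiffOn ℝ ∞ f (Ioo (-M) M)) (hg : ContDiffOn ℝ ∞ g (Ioo (-M) M)) :
    P₁.pairing (fun s => f s + g s) = P₁.pairing f + P₁.pairing g := by
  refine tendsto_nhds_unique (hP _ (hf.add hg)).2 (((hP f hf).2.add (hP g hg).2).congr' ?_)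
  filter_upwards [self_mem_nhdsWithin] with η hη
  rw [integral_add ((hP f hf).1 η hη) ((hP g hg).1 η hη)]
  ring

/-- A bound by `δ s²`, up to a constant, on the difference of two smooth functions bounds the
difference of their pairings. -/
theorem HasFirstOrder.abs_pairing_sub_le [IsProbabilityMeasure P] (hP : HasFirstOrder P B P₁)
    (hM : 0 < M) (hε : 0 < ε) (hBbdd : ∀ η > 0, ∀ᵐ y ∂P, |B η y| ≤ M - ε)
    {f g : ℝ → ℝ} (hf : ContDiffOn ℝ ∞ f (Ioo (-M) M)) (hg : ContDiffOn ℝ ∞ g (Ioo (-M) M))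
    {c δ : ℝ} (h : ∀ s ∈ Ioo (-M) M, |f s - g s - c| ≤ δ * s ^ 2) :
    |P₁.pairing f - P₁.pairing g| ≤ δ * P₁.pairing (fun s => s ^ 2) := by
  have hsq : ContDiffOn ℝ ∞ (fun s : ℝ => s ^ 2) (Ioo (-M) M) := by fun_prop
  refine le_of_tendsto_of_tendsto (((hP f hf).2.sub (hP g hg).2).abs)
    ((hP _ hsq).2.const_mul δ) ?_
  filter_upwards [self_mem_nhdsWithin] with η hη
  have hη' : 0 < η := hη
  have if' := (hP f hf).1 η hη
  have ig' := (hP g hg).1 η hη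
  -- The bound at `s = 0` forces the value of the constant, so subtracting the values at `0` removes
  -- it from the difference quotients.
  have hc : f 0 - g 0 = c := by
    have := h 0 ⟨by linarith, hM⟩
    norm_num at this
    linarith
  have e1 : ((∫ y, f (B η y) ∂P) - f 0) / η - ((∫ y, g (B η y) ∂P) - g 0) / η =
      (∫ y, (f (B η y) - g (B η y) - c) ∂P) / η := by
    rw [integral_sub (f := fun y => f (B η y) - g (B η y)) (if'.sub ig') (integrable_const _),
      integral_sub if' ig', ← hc]
    simp
    ring
  rw [e1, abs_div, abs_of_pos hη']
  have e2 : δ * (((∫ y, (B η y) ^ 2 ∂P) - 0 ^ 2) / η) = (∫ y, δ * (B η y) ^ 2 ∂P) / η := by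
    rw [integral_const_mul]
    ring
  rw [e2]
  gcongr
  refine (norm_integral_le_integral_norm _).trans
    (integral_mono_ae ((if'.sub ig').sub (integrable_const _)).norm
      (((hP _ hsq).1 η hη).const_mul δ) ?_)
  filter_upwards [hBbdd η hη] with y hy
  have := abs_le.1 hy
  exact h _ ⟨by linarith, by linarith⟩

end Expansion

/-! ### Locally square integrable functions and weak gradients -/

section WeakGradients

variable {d : ℕ} {F : Type*} [NormedAddCommGroup F]

theorem MemL2Loc.add {f g : Space d → F} (hf : MemL2Loc f) (hg : MemL2Loc g) :
    MemL2Loc (fun x => f x + g x) := fun K hK => (hf K hK).add (hg K hK)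

theorem MemL2Loc.sub {f g : Space d → F} (hf : MemL2Loc f) (hg : MemL2Loc g) :
    MemL2Loc (fun x => f x - g x) := fun K hK => (hf K hK).sub (hg K hK)

theorem MemL2Loc.const_smul [NormedSpace ℝ F] {f : Space d → F} (hf : MemL2Loc f) (c : ℝ) :
    MemL2Loc (fun x => c • f x) := fun K hK => (hf K hK).const_smul c

theorem MemL2Loc.congr {f g : Space d → F} (hf : MemL2Loc f) (h : f =ᵐ[volume] g) : MemL2Loc g :=
  fun K hK => (hf K hK).ae_eq (ae_restrict_of_ae h)

theorem _root_.Continuous.memL2Loc {f : Space d → F} (hf : Continuous f) : MemL2Loc f := by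
  intro K hK
  have : IsFiniteMeasure (volume.restrict K) := ⟨by simpa using hK.measure_lt_top⟩
  obtain ⟨c, hc⟩ := hK.exists_bound_of_continuousOn hf.continuousOn
  refine MemLp.of_bound hf.aestronglyMeasurable c ?_
  filter_upwards [ae_restrict_mem hK.measurableSet] with x hx using hc x hx

theorem _root_.MeasureTheory.MemLp.memL2Loc {f : Space d → F} (hf : MemLp f 2 volume) :
    MemL2Loc f := fun _ _ => hf.restrict _

theorem MemL2Loc.locallyIntegrable {f : Space d → F} (hf : MemL2Loc f) : LocallyIntegrable f := by
  rw [locallyIntegrable_iff]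
  intro K hK
  have : IsFiniteMeasure (volume.restrict K) := ⟨by simpa using hK.measure_lt_top⟩
  exact (hf K hK).integrable one_le_two

theorem MemL2Loc.aestronglyMeasurable {f : Space d → F} (hf : MemL2Loc f) :
    AEStronglyMeasurable f volume := hf.locallyIntegrable.aestronglyMeasurable

theorem memL2Loc_of_ball {f : Space d → F}
    (hf : ∀ n : ℕ, MemLp f 2 (volume.restrict (Metric.ball 0 n))) : MemL2Loc f := by
  intro K hK
  obtain ⟨R, hR⟩ := hK.isBounded.subset_ball (0 : Space d)
  obtain ⟨n, hn⟩ := exists_nat_ge R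
  exact (hf n).mono_measure (Measure.restrict_mono (hR.trans (Metric.ball_subset_ball hn)) le_rfl)

theorem MemL2Loc.memLp_ball {f : Space d → F} (hf : MemL2Loc f) (a : Space d) (r : ℝ) :
    MemLp f 2 (volume.restrict (Metric.ball a r)) :=
  (hf _ (isCompact_closedBall a r)).mono_measure
    (Measure.restrict_mono Metric.ball_subset_closedBall le_rfl)

theorem measurePreserving_restrict_translate {d : ℕ} (a : Space d) (S : Set (Space d)) :
    MeasurePreserving (fun x => x + a) (volume.restrict ((fun x => x + a) ⁻¹' S))
      (volume.restrict S) :=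
  (measurePreserving_add_right volume a).restrict_preimage_emb
    (MeasurableEquiv.addRight a).measurableEmbedding S

theorem MemL2Loc.translate {f : Space d → F} (hf : MemL2Loc f) (a : Space d) :
    MemL2Loc (fun x => f (x + a)) := by
  intro K hK
  have h := (hf _ (hK.image (continuous_add_const a))).comp_measurePreserving
    (measurePreserving_restrict_translate a _)
  rwa [preimage_image_eq _ (add_left_injective a)] at h

theorem ae_translate {p : Space d → Prop} (h : ∀ᵐ x, p x) (a : Space d) :
    ∀ᵐ x, p (x + a) :=
  (measurePreserving_add_right volume a).quasiMeasurePreserving.ae h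

theorem _root_.MeasureTheory.LocallyIntegrable.component {G : Space d → Space d}
    (hG : LocallyIntegrable G) (i : Fin d) : LocallyIntegrable (fun x => G x i) := by
  intro x
  obtain ⟨s, hs, hi⟩ := hG x
  exact ⟨s, hs, (EuclideanSpace.proj (𝕜 := ℝ) i).integrable_comp hi⟩

theorem _root_.MeasureTheory.LocallyIntegrable.integrable_mul_test {f φ : Space d → ℝ}
    (hf : LocallyIntegrable f) (hφ : Continuous φ) (hc : HasCompactSupport φ) :
    Integrable (fun x => f x * φ x) :=
  hf.integrable_smul_right_of_hasCompactSupport hφ hc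

theorem continuous_fderiv_dir {φ : Space d → ℝ} (hφ : ContDiff ℝ ∞ φ) (h : Space d) :
    Continuous fun x => fderiv ℝ φ x h :=
  (hφ.continuous_fderiv (by simp)).clm_apply continuous_const

theorem _root_.HasCompactSupport.fderiv_dir {φ : Space d → ℝ} (hc : HasCompactSupport φ)
    (h : Space d) : HasCompactSupport fun x => fderiv ℝ φ x h := hc.fderiv_apply (𝕜 := ℝ) h

theorem HasWeakGradient.integral_fderiv {u : Space d → ℝ} {G : Space d → Space d}
    (hu : HasWeakGradient u G) {φ : Space d → ℝ} (hφ : ContDiff ℝ ∞ φ) (hc : HasCompactSupport φ)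
    (h : Space d) : ∫ x, u x * fderiv ℝ φ x h = -∫ x, inner ℝ (G x) h * φ x := by
  have hh : h = ∑ i, h i • unitVec i := by
    ext j
    simp [Finset.sum_apply, Pi.single_apply]
  have e1 : ∀ x, u x * fderiv ℝ φ x h = ∑ i, h i * (u x * fderiv ℝ φ x (unitVec i)) := by
    intro x
    conv_lhs => rw [hh]
    rw [map_sum, Finset.mul_sum]
    refine Finset.sum_congr rfl fun i _ => ?_
    rw [map_smul, smul_eq_mul]
    ring
  have e2 : ∀ x, inner ℝ (G x) h * φ x = ∑ i, h i * (G x i * φ x) := by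
    intro x
    rw [PiLp.inner_apply, Finset.sum_mul]
    refine Finset.sum_congr rfl fun i _ => ?_
    simp [mul_assoc]
  simp only [e1, e2]
  rw [integral_finsetSum _ fun i _ => (hu.1.integrable_mul_test
      (continuous_fderiv_dir hφ _) (hc.fderiv_dir _)).const_mul _,
    integral_finsetSum _ fun i _ => ((hu.2.1.component i).integrable_mul_test
      hφ.continuous hc).const_mul _, ← Finset.sum_neg_distrib]
  refine Finset.sum_congr rfl fun i _ => ?_
  rw [integral_const_mul, integral_const_mul, hu.2.2 φ hφ hc i]
  ring

theorem HasWeakGradient.congr {u v : Space d → ℝ} {G H : Space d → Space d}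
    (hu : HasWeakGradient u G) (huv : u =ᵐ[volume] v) (hGH : G =ᵐ[volume] H) :
    HasWeakGradient v H := by
  refine ⟨hu.1.congr huv, hu.2.1.congr hGH, fun φ hφ hc i => ?_⟩
  have e1 : ∫ x, v x * fderiv ℝ φ x (unitVec i) = ∫ x, u x * fderiv ℝ φ x (unitVec i) :=
    integral_congr_ae (by filter_upwards [huv] with x hx; rw [hx])
  have e2 : ∫ x, H x i * φ x = ∫ x, G x i * φ x :=
    integral_congr_ae (by filter_upwards [hGH] with x hx; rw [hx])
  rw [e1, e2, hu.2.2 φ hφ hc i]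

theorem HasWeakGradient.add {u v : Space d → ℝ} {G H : Space d → Space d}
    (hu : HasWeakGradient u G) (hv : HasWeakGradient v H) :
    HasWeakGradient (fun x => u x + v x) (fun x => G x + H x) := by
  refine ⟨hu.1.add hv.1, hu.2.1.add hv.2.1, fun φ hφ hc i => ?_⟩
  have c1 := continuous_fderiv_dir hφ (unitVec i)
  have c2 := hc.fderiv_dir (unitVec i)
  simp only [PiLp.add_apply, add_mul]
  rw [integral_add (hu.1.integrable_mul_test c1 c2) (hv.1.integrable_mul_test c1 c2),
    integral_add ((hu.2.1.component i).integrable_mul_test hφ.continuous hc)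
      ((hv.2.1.component i).integrable_mul_test hφ.continuous hc), hu.2.2 φ hφ hc i,
    hv.2.2 φ hφ hc i]
  ring

theorem HasWeakGradient.const_smul {u : Space d → ℝ} {G : Space d → Space d}
    (hu : HasWeakGradient u G) (c : ℝ) :
    HasWeakGradient (fun x => c * u x) (fun x => c • G x) := by
  refine ⟨hu.1.smul c, hu.2.1.smul c, fun φ hφ hc i => ?_⟩
  simp only [PiLp.smul_apply, smul_eq_mul, mul_assoc, integral_const_mul]
  rw [hu.2.2 φ hφ hc i]
  ring

theorem HasWeakGradient.sub {u v : Space d → ℝ} {G H : Space d → Space d}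
    (hu : HasWeakGradient u G) (hv : HasWeakGradient v H) :
    HasWeakGradient (fun x => u x - v x) (fun x => G x - H x) := by
  refine (hu.add (hv.const_smul (-1))).congr (.of_forall fun x => ?_) (.of_forall fun x => ?_)
  · simp only []
    ring
  · simp [sub_eq_add_neg]

theorem gradient_component {φ : Space d → ℝ} (x : Space d) (i : Fin d) :
    gradient φ x i = fderiv ℝ φ x (unitVec i) := by
  rw [← inner_gradient_left, PiLp.inner_apply, Finset.sum_eq_single i]
  · simp
  · intro j _ hj
    simp [hj]
  · simp

theorem continuous_gradient {φ : Space d → ℝ} (hφ : ContDiff ℝ ∞ φ) :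
    Continuous (gradient φ) :=
  (InnerProductSpace.toDual ℝ (Space d)).symm.continuous.comp (hφ.continuous_fderiv (by simp))

/-- The product rule. -/
theorem HasWeakGradient.smooth_mul {u : Space d → ℝ} {G : Space d → Space d}
    (hu : HasWeakGradient u G) {χ : Space d → ℝ} (hχ : ContDiff ℝ ∞ χ) :
    HasWeakGradient (fun x => χ x * u x) (fun x => χ x • G x + u x • gradient χ x) := by
  have hl : ∀ {E : Type} [NormedAddCommGroup E] [NormedSpace ℝ E] {f : Space d → E}
      {g : Space d → ℝ}, LocallyIntegrable f → Continuous g →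
      LocallyIntegrable (fun x => g x • f x) := fun hf hg => by
    rw [← locallyIntegrableOn_univ] at hf ⊢
    exact hf.continuousOn_smul isOpen_univ.isLocallyClosed hg.continuousOn
  have hl' : LocallyIntegrable (fun x => u x • gradient χ x) := by
    have hf := hu.1
    rw [← locallyIntegrableOn_univ] at hf ⊢
    exact hf.smul_continuousOn isOpen_univ.isLocallyClosed (continuous_gradient hχ).continuousOn
  refine ⟨hl hu.1 hχ.continuous, (hl hu.2.1 hχ.continuous).add hl', fun φ hφ hc i => ?_⟩
  have hχφ : ContDiff ℝ ∞ (fun x => χ x * φ x) := hχ.mul hφ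
  have hcχφ : HasCompactSupport (fun x => χ x * φ x) := hc.mul_left
  -- The product rule is the definition of the weak gradient of `u` tested with `χ φ`.
  have key := hu.2.2 _ hχφ hcχφ i
  have hd : ∀ x, fderiv ℝ (fun x => χ x * φ x) x (unitVec i) =
      χ x * fderiv ℝ φ x (unitVec i) + φ x * fderiv ℝ χ x (unitVec i) := by
    intro x
    rw [fderiv_fun_mul (hχ.differentiable (by simp)).differentiableAt
      (hφ.differentiable (by simp)).differentiableAt]
    simp
  have c1 := continuous_fderiv_dir hφ (unitVec i)
  have c2 := hc.fderiv_dir (unitVec i)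
  have c3 := continuous_fderiv_dir hχ (unitVec i)
  have i1 : Integrable fun x => u x * (χ x * fderiv ℝ φ x (unitVec i)) :=
    hu.1.integrable_mul_test (hχ.continuous.mul c1) c2.mul_left
  have i2 : Integrable fun x => u x * (φ x * fderiv ℝ χ x (unitVec i)) :=
    hu.1.integrable_mul_test (hφ.continuous.mul c3) hc.mul_right
  have i3 : Integrable fun x => G x i * (χ x * φ x) :=
    (hu.2.1.component i).integrable_mul_test hχφ.continuous hcχφ
  simp only [hd, mul_add] at key
  rw [integral_add i1 i2] at key
  have e1 : ∫ x, χ x * u x * fderiv ℝ φ x (unitVec i) =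
      ∫ x, u x * (χ x * fderiv ℝ φ x (unitVec i)) := by
    congr 1 with x
    ring
  have e2 : ∫ x, (χ x • G x + u x • gradient χ x) i * φ x =
      (∫ x, G x i * (χ x * φ x)) + ∫ x, u x * (φ x * fderiv ℝ χ x (unitVec i)) := by
    rw [← integral_add i3 i2]
    congr 1 with x
    simp only [PiLp.add_apply, PiLp.smul_apply, smul_eq_mul, gradient_component]
    ring
  rw [e1, e2]
  linarith

theorem hasWeakGradient_const (c : ℝ) : HasWeakGradient (fun _ : Space d => c) 0 := by
  refine ⟨continuous_const.locallyIntegrable, continuous_zero.locallyIntegrable,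
    fun φ hφ hc i => ?_⟩
  have := integral_mul_fderiv_eq_neg_fderiv_mul_of_integrable (𝕜 := ℝ)
    (μ := (volume : Measure (Space d))) (f := fun _ => c) (g := φ) (v := unitVec i) (by simp)
    (((continuous_fderiv_dir hφ _).integrable_of_hasCompactSupport (hc.fderiv_dir _)).const_mul c)
    ((hφ.continuous.integrable_of_hasCompactSupport hc).const_mul c) (by simp)
    (fun x _ => (hφ.differentiable (by simp)).differentiableAt)
  simpa using this

theorem hasWeakGradient_of_contDiff {φ : Space d → ℝ} (hφ : ContDiff ℝ ∞ φ) :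
    HasWeakGradient φ (gradient φ) := by
  simpa using (hasWeakGradient_const (d := d) 1).smooth_mul hφ

theorem HasWeakGradient.translate {u : Space d → ℝ} {G : Space d → Space d}
    (hu : HasWeakGradient u G) (a : Space d) :
    HasWeakGradient (fun x => u (x + a)) (fun x => G (x + a)) := by
  have hl : ∀ {E : Type} [NormedAddCommGroup E] {f : Space d → E}, LocallyIntegrable f →
      LocallyIntegrable (fun x => f (x + a)) := by
    intro E _ f hf
    rw [locallyIntegrable_iff] at hf ⊢
    intro K hK
    have h := (measurePreserving_restrict_translate a _).integrable_comp_of_integrable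
      (hf _ (hK.image (continuous_add_const a)))
    rwa [preimage_image_eq _ (add_left_injective a)] at h
  refine ⟨hl hu.1, hl hu.2.1, fun φ hφ hc i => ?_⟩
  have hφ' : ContDiff ℝ ∞ (fun x => φ (x - a)) := hφ.comp (contDiff_id.sub contDiff_const)
  have hc' : HasCompactSupport (fun x => φ (x - a)) := by
    have := hc.comp_homeomorph (Homeomorph.addRight (-a))
    simpa [Function.comp_def, sub_eq_add_neg] using this
  have key := hu.2.2 _ hφ' hc' i
  rw [← integral_add_right_eq_self _ a, ← integral_add_right_eq_self (fun x => G x i * _) a] at key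
  simpa [fderiv_comp_sub] using key

theorem MemH1Loc.hasWeakGradient {u : Space d → ℝ} (hu : MemH1Loc u) :
    HasWeakGradient u (weakGradient u) := by
  have h : ∃ G, HasWeakGradient u G := hu.2.imp fun _ h => h.1
  rw [weakGradient, dif_pos h]
  exact h.choose_spec

theorem MemH1Loc.memL2Loc_weakGradient {u : Space d → ℝ} (hu : MemH1Loc u) :
    MemL2Loc (weakGradient u) := by
  obtain ⟨G, hG, hG2⟩ := hu.2
  exact hG2.congr (hG.ae_eq hu.hasWeakGradient)

theorem HasWeakGradient.memH1Loc {u : Space d → ℝ} {G : Space d → Space d}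
    (hu : HasWeakGradient u G) (h1 : MemL2Loc u) (h2 : MemL2Loc G) : MemH1Loc u := ⟨h1, G, hu, h2⟩

theorem HasWeakGradient.weakGradient_ae_eq {u : Space d → ℝ} {G : Space d → Space d}
    (hu : HasWeakGradient u G) : weakGradient u =ᵐ[volume] G := by
  have h : ∃ G, HasWeakGradient u G := ⟨G, hu⟩
  rw [weakGradient, dif_pos h]
  exact h.choose_spec.ae_eq hu

theorem MemH1Loc.add {u v : Space d → ℝ} (hu : MemH1Loc u) (hv : MemH1Loc v) :
    MemH1Loc (fun x => u x + v x) :=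
  (hu.hasWeakGradient.add hv.hasWeakGradient).memH1Loc (hu.1.add hv.1)
    (hu.memL2Loc_weakGradient.add hv.memL2Loc_weakGradient)

theorem MemH1Loc.sub {u v : Space d → ℝ} (hu : MemH1Loc u) (hv : MemH1Loc v) :
    MemH1Loc (fun x => u x - v x) :=
  (hu.hasWeakGradient.sub hv.hasWeakGradient).memH1Loc (hu.1.sub hv.1)
    (hu.memL2Loc_weakGradient.sub hv.memL2Loc_weakGradient)

theorem MemH1Loc.const_smul {u : Space d → ℝ} (hu : MemH1Loc u) (c : ℝ) :
    MemH1Loc (fun x => c * u x) :=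
  (hu.hasWeakGradient.const_smul c).memH1Loc (hu.1.const_smul c)
    (hu.memL2Loc_weakGradient.const_smul c)

theorem MemH1Loc.translate {u : Space d → ℝ} (hu : MemH1Loc u) (a : Space d) :
    MemH1Loc (fun x => u (x + a)) :=
  (hu.hasWeakGradient.translate a).memH1Loc (hu.1.translate a)
    (hu.memL2Loc_weakGradient.translate a)

theorem memH1Loc_of_contDiff {φ : Space d → ℝ} (hφ : ContDiff ℝ ∞ φ) : MemH1Loc φ :=
  (hasWeakGradient_of_contDiff hφ).memH1Loc hφ.continuous.memL2Loc
    (continuous_gradient hφ).memL2Loc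

end WeakGradients

/-! ### The Poincaré inequality on balls -/

section Poincare

variable {d : ℕ}

/-- Cauchy–Schwarz against the constant `1`. -/
theorem sq_lintegral_le {Y : Type*} [MeasurableSpace Y] (μ : Measure Y) {f : Y → ENNReal}
    (hf : AEMeasurable f μ) : (∫⁻ y, f y ∂μ) ^ 2 ≤ μ univ * ∫⁻ y, f y ^ 2 ∂μ := by
  have h := ENNReal.lintegral_mul_le_Lp_mul_Lq μ Real.HolderConjugate.two_two hf
    (aemeasurable_const (b := (1 : ENNReal)))
  simp only [Pi.mul_apply, mul_one, ENNReal.rpow_ofNat, one_pow, lintegral_const, one_mul] at h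
  calc (∫⁻ y, f y ∂μ) ^ 2
      ≤ ((∫⁻ y, f y ^ 2 ∂μ) ^ (1 / 2 : ℝ) * μ univ ^ (1 / 2 : ℝ)) ^ 2 := by gcongr
    _ = μ univ * ∫⁻ y, f y ^ 2 ∂μ := by
      rw [mul_pow, ← ENNReal.rpow_natCast, ← ENNReal.rpow_natCast, ← ENNReal.rpow_mul,
        ← ENNReal.rpow_mul]
      norm_num [mul_comm]

/-- Integrability of a locally integrable function against a moving bounded weight. -/
theorem integrable_moving_weight {f w : Space d → ℝ} (hf : Measurable f)
    (hfl : LocallyIntegrable f) (hw : Measurable w) {c R : ℝ} (hc : ∀ x, ‖w x‖ ≤ c)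
    (hR : ∀ x, R < ‖x‖ → w x = 0) (h : Space d) :
    Integrable (fun p : ℝ × Space d => f p.2 * w (p.2 - p.1 • h))
      ((volume.restrict (Ioc 0 1)).prod volume) := by
  -- For `0 < t ≤ 1` the translated weight is supported in the ball of radius `R + ‖h‖`, which gives
  -- a dominating function independent of `t`.
  set K := Metric.closedBall (0 : Space d) (R + ‖h‖)
  have hK : IsCompact K := isCompact_closedBall _ _
  have h1 : Integrable (K.indicator f) :=
    (hfl.integrableOn_isCompact hK).integrable_indicator hK.measurableSet
  have h2 : Integrable (fun p : ℝ × Space d => c * ‖K.indicator f p.2‖)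
      ((volume.restrict (Ioc 0 1)).prod volume) :=
    (h1.norm.comp_snd _).const_mul c
  refine h2.mono' (by fun_prop) ?_
  have h3 : ∀ᵐ p : ℝ × Space d ∂(volume.restrict (Ioc 0 1)).prod volume, p.1 ∈ Ioc (0 : ℝ) 1 :=
    Measure.quasiMeasurePreserving_fst.ae (ae_restrict_mem measurableSet_Ioc)
  filter_upwards [h3] with p hp
  by_cases hpK : p.2 ∈ K
  · rw [indicator_of_mem hpK, norm_mul, mul_comm]
    gcongr
    exact hc _
  · have : w (p.2 - p.1 • h) = 0 := by
      apply hR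
      have h4 : R + ‖h‖ < ‖p.2‖ := by simpa [K] using hpK
      have h5 : ‖p.1 • h‖ ≤ ‖h‖ := by
        rw [norm_smul, Real.norm_eq_abs, abs_of_pos hp.1]
        exact mul_le_of_le_one_left (norm_nonneg _) hp.2
      linarith [norm_sub_norm_le p.2 (p.1 • h)]
    rw [this, mul_zero, norm_zero]
    have : 0 ≤ c := (norm_nonneg _).trans (hc 0)
    positivity

theorem measurePreserving_shear (h : Space d) :
    MeasurePreserving (fun p : ℝ × Space d => (p.1, p.2 + p.1 • h))
      ((volume.restrict (Ioc 0 1)).prod volume) ((volume.restrict (Ioc 0 1)).prod volume) :=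
  (MeasurePreserving.id _).skew_product (g := fun t x => x + t • h) (by fun_prop)
    (.of_forall fun t => (measurePreserving_add_right volume (t • h)).map_eq)

/-- The measure-preserving shear `(t, x) ↦ (t, x + t h)` moves the translation from the weight to
the function. -/
theorem integrable_moving_function {f w : Space d → ℝ} (hf : Measurable f)
    (hfl : LocallyIntegrable f) (hw : Measurable w) {c R : ℝ} (hc : ∀ x, ‖w x‖ ≤ c)
    (hR : ∀ x, R < ‖x‖ → w x = 0) (h : Space d) :
    Integrable (fun p : ℝ × Space d => f (p.2 + p.1 • h) * w p.2)
      ((volume.restrict (Ioc 0 1)).prod volume) := by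
  have := (measurePreserving_shear h).integrable_comp_of_integrable
    (integrable_moving_weight hf hfl hw hc hR h)
  simpa [Function.comp_def] using this

theorem _root_.HasCompactSupport.exists_bound_zero {φ : Space d → ℝ} (hφ : Continuous φ)
    (hc : HasCompactSupport φ) : ∃ c R : ℝ, (∀ x, ‖φ x‖ ≤ c) ∧ ∀ x, R < ‖x‖ → φ x = 0 := by
  obtain ⟨c, hc'⟩ := hc.exists_bound_of_continuous hφ
  obtain ⟨R, hR⟩ := hc.isBounded.subset_closedBall (0 : Space d)
  refine ⟨c, R, hc', fun x hx => image_eq_zero_of_notMem_tsupport fun hmem => ?_⟩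
  have := hR hmem
  simp at this
  linarith

/-- Increments of a function are integrals of its weak gradient. -/
theorem HasWeakGradient.increment {u : Space d → ℝ} {G : Space d → Space d}
    (hu : HasWeakGradient u G) (hum : Measurable u) (hGm : Measurable G) (h : Space d) :
    ∀ᵐ x, u (x + h) - u x = ∫ t in Ioc (0 : ℝ) 1, inner ℝ (G (x + t • h)) h := by
  set f : Space d → ℝ := fun x => inner ℝ (G x) h with hfdef
  have hf : Measurable f := by fun_prop
  have hfl : LocallyIntegrable f := fun x => by
    obtain ⟨s, hs, hi⟩ := hu.2.1 x
    exact ⟨s, hs, Integrable.inner_const hi h⟩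
  refine ae_eq_of_integral_contDiff_smul_eq (f := fun x => u (x + h) - u x)
    ((hu.translate h).1.sub hu.1) ?_ ?_
  · rw [locallyIntegrable_iff]
    intro K hK
    obtain ⟨R, hR⟩ := hK.isBounded.subset_closedBall (0 : Space d)
    have h1 := (integrable_moving_function hf hfl (w := K.indicator 1) (c := 1) (R := R)
      (measurable_const.indicator hK.measurableSet)
      (fun x => by by_cases hx : x ∈ K <;> simp [hx])
      (fun x hx => indicator_of_notMem (fun hxK => by
        have := hR hxK
        simp at this
        linarith) _) h).integral_prod_right
    rw [← integrable_indicator_iff hK.measurableSet]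
    refine h1.congr (.of_forall fun x => ?_)
    by_cases hx : x ∈ K <;> simp [hx, f]
  · intro φ hφ hc
    obtain ⟨c, R, hφb, hφR⟩ := hc.exists_bound_zero hφ.continuous
    have hdc := continuous_fderiv_dir hφ h
    obtain ⟨c', R', hdb, hdR⟩ := (hc.fderiv_dir h).exists_bound_zero hdc
    -- Both sides are tested against `φ`. Fubini exposes the integral in `x`, a translation and the
    -- weak gradient identity put the derivative on `φ`, and the fundamental theorem of calculus in
    -- `t` integrates it to `φ x - φ (x - h)`.
    have s1 : ∫ x, φ x • ∫ t in Ioc (0 : ℝ) 1, f (x + t • h) =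
        ∫ t in Ioc (0 : ℝ) 1, ∫ x, f (x + t • h) * φ x := by
      rw [← integral_integral_swap (f := fun x t => f (x + t • h) * φ x)]
      · congr 1 with x
        rw [integral_mul_const, smul_eq_mul, mul_comm]
      · exact (integrable_moving_function hf hfl hφ.continuous.measurable hφb hφR h).swap
    have s2 : ∀ t : ℝ, ∫ x, f (x + t • h) * φ x = -∫ x, u x * fderiv ℝ φ (x - t • h) h := by
      intro t
      have hφ' : ContDiff ℝ ∞ (fun x => φ (x - t • h)) := hφ.comp (contDiff_id.sub contDiff_const)
      have hc' : HasCompactSupport (fun x => φ (x - t • h)) := by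
        have := hc.comp_homeomorph (Homeomorph.addRight (-(t • h)))
        simpa [Function.comp_def, sub_eq_add_neg] using this
      have key := hu.integral_fderiv hφ' hc' h
      rw [← integral_add_right_eq_self (fun x => inner ℝ (G x) h * _) (t • h)] at key
      simp only [fderiv_comp_sub, add_sub_cancel_right] at key
      rw [key, neg_neg]
    have s3 : ∫ t in Ioc (0 : ℝ) 1, ∫ x, u x * fderiv ℝ φ (x - t • h) h =
        ∫ x, u x * (φ x - φ (x - h)) := by
      rw [integral_integral_swap
        (integrable_moving_weight hum hu.1 hdc.measurable hdb hdR h)]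
      congr 1 with x
      rw [integral_const_mul]
      congr 1
      have hder : ∀ t ∈ uIcc (0 : ℝ) 1,
          HasDerivAt (fun t : ℝ => -φ (x - t • h)) (fderiv ℝ φ (x - t • h) h) t := by
        intro t _
        have h1 : HasDerivAt (fun t : ℝ => x - t • h) (-h) t := by
          simpa using ((hasDerivAt_id t).smul_const h).const_sub x
        have h2 := ((hφ.differentiable (by simp)).differentiableAt
          (x := x - t • h)).hasFDerivAt.comp_hasDerivAt t h1
        have h3 : HasDerivAt (fun t : ℝ => -φ (x - t • h)) (-(fderiv ℝ φ (x - t • h) (-h))) t := h2.neg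
        simpa using h3
      have hint := intervalIntegral.integral_eq_sub_of_hasDerivAt hder
        (Continuous.intervalIntegrable (hdc.comp (by fun_prop)) _ _)
      rw [intervalIntegral.integral_of_le zero_le_one] at hint
      rw [hint]
      simp
      ring
    have hc1 : HasCompactSupport (fun x => φ (x - h)) := by
      have := hc.comp_homeomorph (Homeomorph.addRight (-h))
      simpa [Function.comp_def, sub_eq_add_neg] using this
    have hcont1 : Continuous fun x => φ (x - h) := by fun_prop
    have i1 : Integrable fun x => u (x + h) * φ x :=
      (hu.translate h).1.integrable_mul_test hφ.continuous hc
    have i2 : Integrable fun x => u x * φ x := hu.1.integrable_mul_test hφ.continuous hc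
    have i3 : Integrable fun x => u x * φ (x - h) := hu.1.integrable_mul_test hcont1 hc1
    rw [s1, integral_congr_ae (.of_forall s2), integral_neg, s3]
    have e1 : ∫ x, u (x + h) * φ x = ∫ x, u x * φ (x - h) := by
      rw [← integral_add_right_eq_self (fun x => u x * φ (x - h)) h]
      simp
    have e2 : ∫ x, φ x • (u (x + h) - u x) = (∫ x, u (x + h) * φ x) - ∫ x, u x * φ x := by
      rw [← integral_sub i1 i2]
      congr 1 with x
      simp
      ring
    have e3 : ∫ x, u x * (φ x - φ (x - h)) = (∫ x, u x * φ x) - ∫ x, u x * φ (x - h) := by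
      rw [← integral_sub i2 i3]
      congr 1 with x
      ring
    rw [e2, e3, e1]
    ring

/-- Cauchy–Schwarz in `t` in the increment formula, then Fubini. The ball is convex, so the whole
segment from `x` to `x + h` stays inside it and only the gradient on the ball is needed. -/
theorem HasWeakGradient.lintegral_increment_le {u : Space d → ℝ} {G : Space d → Space d}
    (hu : HasWeakGradient u G) (hum : Measurable u) (hGm : Measurable G) (h : Space d) (R : ℝ) :
    ∫⁻ x in Metric.ball 0 R ∩ {x | x + h ∈ Metric.ball 0 R}, ‖u (x + h) - u x‖ₑ ^ 2 ≤
      ‖h‖ₑ ^ 2 * ∫⁻ x in Metric.ball 0 R, ‖G x‖ₑ ^ 2 := by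
  set S : Set (Space d) := Metric.ball 0 R ∩ {x | x + h ∈ Metric.ball 0 R} with hS
  have hSm : MeasurableSet S := Metric.isOpen_ball.measurableSet.inter
    ((measurable_add_const h) Metric.isOpen_ball.measurableSet)
  have h1 : ∀ᵐ x, ‖u (x + h) - u x‖ₑ ^ 2 ≤
      ‖h‖ₑ ^ 2 * ∫⁻ t in Ioc (0 : ℝ) 1, ‖G (x + t • h)‖ₑ ^ 2 := by
    filter_upwards [hu.increment hum hGm h] with x hx
    rw [hx]
    calc ‖∫ t in Ioc (0 : ℝ) 1, inner ℝ (G (x + t • h)) h‖ₑ ^ 2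
        ≤ (∫⁻ t in Ioc (0 : ℝ) 1, ‖h‖ₑ * ‖G (x + t • h)‖ₑ) ^ 2 := by
          gcongr
          refine (enorm_integral_le_lintegral_enorm _).trans (lintegral_mono fun t => ?_)
          simp only [← ofReal_norm, ← ENNReal.ofReal_mul (norm_nonneg _)]
          refine ENNReal.ofReal_le_ofReal ?_
          rw [mul_comm]
          exact norm_inner_le_norm _ _
      _ ≤ 1 * ∫⁻ t in Ioc (0 : ℝ) 1, (‖h‖ₑ * ‖G (x + t • h)‖ₑ) ^ 2 := by
          refine (sq_lintegral_le _ (by fun_prop)).trans_eq ?_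
          simp
      _ = _ := by
          simp only [one_mul, mul_pow]
          rw [lintegral_const_mul _ (by fun_prop)]
  calc ∫⁻ x in S, ‖u (x + h) - u x‖ₑ ^ 2
      ≤ ∫⁻ x in S, ‖h‖ₑ ^ 2 * ∫⁻ t in Ioc (0 : ℝ) 1, ‖G (x + t • h)‖ₑ ^ 2 :=
        lintegral_mono_ae (ae_restrict_of_ae h1)
    _ = ‖h‖ₑ ^ 2 * ∫⁻ x in S, ∫⁻ t in Ioc (0 : ℝ) 1, ‖G (x + t • h)‖ₑ ^ 2 :=
        lintegral_const_mul' _ _ (by simp)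
    _ = ‖h‖ₑ ^ 2 * ∫⁻ t in Ioc (0 : ℝ) 1, ∫⁻ x in S, ‖G (x + t • h)‖ₑ ^ 2 := by
        rw [lintegral_lintegral_swap]
        fun_prop
    _ ≤ ‖h‖ₑ ^ 2 * ∫⁻ t in Ioc (0 : ℝ) 1, ∫⁻ x in Metric.ball 0 R, ‖G x‖ₑ ^ 2 := by
        refine mul_le_mul' le_rfl ?_
        refine setLIntegral_mono' (measurableSet_Ioc : MeasurableSet (Ioc (0 : ℝ) 1)) fun t ht => ?_
        rw [← lintegral_indicator hSm, ← lintegral_indicator Metric.isOpen_ball.measurableSet,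
          ← lintegral_add_right_eq_self ((Metric.ball (0 : Space d) R).indicator _) (t • h)]
        refine lintegral_mono fun x => ?_
        by_cases hx : x ∈ S
        · have hmem : x + t • h ∈ Metric.ball (0 : Space d) R := by
            have := (convex_ball (0 : Space d) R) hx.1 hx.2 (sub_nonneg.2 ht.2) ht.1.le (by ring)
            convert this using 1
            rw [smul_add, ← add_assoc, ← add_smul]
            simp
          rw [indicator_of_mem hx, indicator_of_mem hmem]
        · rw [indicator_of_notMem hx]
          exact zero_le
    _ = ‖h‖ₑ ^ 2 * ∫⁻ x in Metric.ball 0 R, ‖G x‖ₑ ^ 2 := by simp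

/-- Substitute `y = x + h`: two points of the ball differ by less than `2 R`, so `h` ranges over a
ball of that radius, and the increment bound applies for each `h`. -/
theorem HasWeakGradient.lintegral_lintegral_sub_le {u : Space d → ℝ} {G : Space d → Space d}
    (hu : HasWeakGradient u G) (hum : Measurable u) (hGm : Measurable G) (R : ℝ) :
    ∫⁻ x in Metric.ball 0 R, ∫⁻ y in Metric.ball 0 R, ‖u y - u x‖ₑ ^ 2 ≤
      volume (Metric.ball (0 : Space d) (2 * R)) * ENNReal.ofReal (2 * R) ^ 2 *
        ∫⁻ x in Metric.ball 0 R, ‖G x‖ₑ ^ 2 := by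
  set D := Metric.ball (0 : Space d) R with hD
  have hDm : MeasurableSet D := Metric.isOpen_ball.measurableSet
  have e1 : ∀ x ∈ D, ∫⁻ y in D, ‖u y - u x‖ₑ ^ 2 =
      ∫⁻ h, D.indicator (fun _ => ‖u (x + h) - u x‖ₑ ^ 2) (x + h) := by
    intro x _
    rw [← lintegral_indicator hDm, ← lintegral_add_left_eq_self _ x]
    rfl
  rw [setLIntegral_congr_fun hDm e1, lintegral_lintegral_swap]
  · have e2 : ∀ h : Space d, ∫⁻ x in D, D.indicator (fun _ => ‖u (x + h) - u x‖ₑ ^ 2) (x + h) ≤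
        (Metric.ball (0 : Space d) (2 * R)).indicator
          (fun _ => ENNReal.ofReal (2 * R) ^ 2 * ∫⁻ x in D, ‖G x‖ₑ ^ 2) h := by
      intro h
      have e3 : ∫⁻ x in D, D.indicator (fun _ => ‖u (x + h) - u x‖ₑ ^ 2) (x + h) =
          ∫⁻ x in D ∩ {x | x + h ∈ D}, ‖u (x + h) - u x‖ₑ ^ 2 := by
        rw [inter_comm, ← setLIntegral_indicator]
        · rfl
        · exact (measurable_add_const h) hDm
      rw [e3]
      by_cases hh : h ∈ Metric.ball (0 : Space d) (2 * R)
      · rw [indicator_of_mem hh]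
        refine (hu.lintegral_increment_le hum hGm h R).trans ?_
        gcongr
        rw [← ofReal_norm]
        exact ENNReal.ofReal_le_ofReal (by simpa using (mem_ball_zero_iff.1 hh).le)
      · have : D ∩ {x | x + h ∈ D} = ∅ := by
          ext x
          simp only [mem_inter_iff, mem_ofPred_eq, mem_empty_iff_false, iff_false, not_and]
          intro h1 h2
          apply hh
          rw [hD, mem_ball_zero_iff] at h1 h2
          rw [mem_ball_zero_iff]
          have := norm_sub_le (x + h) x
          rw [add_sub_cancel_left] at this
          linarith
        rw [this]
        simp
    refine (lintegral_mono e2).trans_eq ?_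
    rw [lintegral_indicator Metric.isOpen_ball.measurableSet, setLIntegral_const]
    ring
  · refine Measurable.aemeasurable ?_
    have : (Function.uncurry fun (x h : Space d) =>
        D.indicator (fun _ => ‖u (x + h) - u x‖ₑ ^ 2) (x + h)) =
        {p : Space d × Space d | p.1 + p.2 ∈ D}.indicator
          fun p => ‖u (p.1 + p.2) - u p.1‖ₑ ^ 2 := by
      ext p
      rfl
    rw [this]
    refine Measurable.indicator (by fun_prop) ?_
    exact (measurable_fst.add measurable_snd) hDm

theorem eLpNorm_two_sq {Y E : Type*} [MeasurableSpace Y] [NormedAddCommGroup E] (μ : Measure Y)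
    (f : Y → E) : eLpNorm f 2 μ ^ 2 = ∫⁻ y, ‖f y‖ₑ ^ 2 ∂μ := by
  rw [eLpNorm_eq_lintegral_rpow_enorm_toReal two_ne_zero ENNReal.ofNat_ne_top,
    ← ENNReal.rpow_natCast, ← ENNReal.rpow_mul]
  simp

/-- The deviation of `a` from the mean is minus the mean of `f - a`; after Cauchy–Schwarz one factor
of the total mass cancels. -/
theorem sub_average_sq_le {Y : Type*} [MeasurableSpace Y] {μ : Measure Y} [IsFiniteMeasure μ]
    [NeZero μ] {f : Y → ℝ} (hf : Integrable f μ) (a : ℝ) :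
    ‖a - ⨍ y, f y ∂μ‖ₑ ^ 2 * μ univ ≤ ∫⁻ y, ‖f y - a‖ₑ ^ 2 ∂μ := by
  have hV0 : μ univ ≠ 0 := by simpa using NeZero.ne μ
  have hV1 : μ univ ≠ ⊤ := measure_ne_top μ univ
  have hV : μ.real univ ≠ 0 := ENNReal.toReal_ne_zero.2 ⟨hV0, hV1⟩
  have h1 : ‖a - ⨍ y, f y ∂μ‖ₑ * μ univ ≤ ∫⁻ y, ‖f y - a‖ₑ ∂μ := by
    have e1 : (a - ⨍ y, f y ∂μ) * μ.real univ = -∫ y, (f y - a) ∂μ := by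
      rw [integral_sub hf (integrable_const _), average_eq]
      simp only [smul_eq_mul, integral_const]
      field_simp
      ring
    have e2 : ‖μ.real univ‖ₑ = μ univ := by
      rw [Real.enorm_eq_ofReal measureReal_nonneg, ofReal_measureReal]
    rw [← e2, ← enorm_mul, e1, enorm_neg]
    exact enorm_integral_le_lintegral_enorm _
  have h2 : (‖a - ⨍ y, f y ∂μ‖ₑ * μ univ) ^ 2 ≤ μ univ * ∫⁻ y, ‖f y - a‖ₑ ^ 2 ∂μ := by
    refine (pow_le_pow_left' h1 2).trans (sq_lintegral_le μ ?_)
    exact (hf.aestronglyMeasurable.sub aestronglyMeasurable_const).enorm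
  rw [mul_pow, pow_two (μ univ), ← mul_assoc, mul_comm] at h2
  exact (ENNReal.mul_le_mul_iff_right hV0 hV1).1 h2

/-- The Poincaré inequality on balls. -/
theorem MemH1Loc.poincare {u : Space d → ℝ} (hu : MemH1Loc u) {r R : ℝ} (hr : 0 < r)
    (hrR : r ≤ R) :
    eLpNorm (fun x => u x - ⨍ y in Metric.ball 0 r, u y) 2 (volume.restrict (Metric.ball 0 R)) ^ 2 *
        volume (Metric.ball (0 : Space d) r) ≤
      volume (Metric.ball (0 : Space d) (2 * R)) * ENNReal.ofReal (2 * R) ^ 2 *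
        eLpNorm (weakGradient u) 2 (volume.restrict (Metric.ball 0 R)) ^ 2 := by
  -- The increment formula needs genuinely measurable representatives of the function and of its
  -- gradient.
  obtain ⟨u', hu'm, huu'⟩ := hu.1.aestronglyMeasurable
  obtain ⟨G, hGm, hG⟩ := hu.memL2Loc_weakGradient.aestronglyMeasurable
  have hw : HasWeakGradient u' G := hu.hasWeakGradient.congr huu' hG
  have e1 : ⨍ y in Metric.ball 0 r, u y = ⨍ y in Metric.ball 0 r, u' y :=
    average_congr (ae_restrict_of_ae huu')
  have e2 : eLpNorm (fun x => u x - ⨍ y in Metric.ball 0 r, u y) 2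
      (volume.restrict (Metric.ball 0 R)) = eLpNorm (fun x => u' x - ⨍ y in Metric.ball 0 r, u' y) 2
      (volume.restrict (Metric.ball 0 R)) := by
    rw [e1]
    refine eLpNorm_congr_ae (ae_restrict_of_ae ?_)
    filter_upwards [huu'] with x hx
    rw [hx]
  rw [e2, eLpNorm_congr_ae (ae_restrict_of_ae hG), eLpNorm_two_sq, eLpNorm_two_sq]
  refine le_trans ?_ (hw.lintegral_lintegral_sub_le hu'm.measurable hGm.measurable R)
  have hball : volume (Metric.ball (0 : Space d) r) ≠ ⊤ := measure_ball_lt_top.ne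
  rw [← lintegral_mul_const' _ _ hball]
  refine lintegral_mono fun x => ?_
  have : IsFiniteMeasure (volume.restrict (Metric.ball (0 : Space d) r)) :=
    ⟨by simpa using measure_ball_lt_top⟩
  have : NeZero (volume.restrict (Metric.ball (0 : Space d) r)) :=
    ⟨by simpa using (Metric.measure_ball_pos volume (0 : Space d) hr).ne'⟩
  have h1 := sub_average_sq_le (((hu.1.congr huu').memLp_ball 0 r).integrable one_le_two) (u' x)
  rw [Measure.restrict_apply_univ] at h1
  exact h1.trans (lintegral_mono_set (Metric.ball_subset_ball hrR))

end Poincare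

/-! ### Limits of gradients in `L²_loc` -/

section Limits

variable {d : ℕ} {F : Type*} [NormedAddCommGroup F]

/-- The norm of `L²(B(0, R))`. -/
noncomputable def ballNorm (R : ℝ) (f : Space d → F) : ENNReal :=
  eLpNorm f 2 (volume.restrict (Metric.ball 0 R))

theorem ballNorm_mono {R R' : ℝ} (h : R ≤ R') (f : Space d → F) : ballNorm R f ≤ ballNorm R' f :=
  eLpNorm_mono_measure _ (Measure.restrict_mono (Metric.ball_subset_ball h) le_rfl)

theorem ballNorm_congr {R : ℝ} {f g : Space d → F} (h : f =ᵐ[volume] g) :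
    ballNorm R f = ballNorm R g := eLpNorm_congr_ae (ae_restrict_of_ae h)

theorem ballNorm_sub_le {f g : Space d → F} (hf : MemL2Loc f) (hg : MemL2Loc g) (R : ℝ) :
    ballNorm R (fun x => f x - g x) ≤ ballNorm R f + ballNorm R g :=
  eLpNorm_sub_le (hf.memLp_ball 0 R).1 (hg.memLp_ball 0 R).1 one_le_two

/-- Convergence in `L²_loc`. -/
def TendstoL2Loc (f : ℕ → Space d → F) (g : Space d → F) : Prop :=
  ∀ k : ℕ, Tendsto (fun n => ballNorm k (fun x => f n x - g x)) atTop (𝓝 0)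

/-- Cauchy sequences in `L²_loc`. -/
def CauchyL2Loc (f : ℕ → Space d → F) : Prop :=
  ∀ k : ℕ, Tendsto (fun p : ℕ × ℕ => ballNorm k (fun x => f p.1 x - f p.2 x)) atTop (𝓝 0)

theorem le_mul_of_sq_mul_le {a b K V : ENNReal} (hV : V ≠ 0) (hV' : V ≠ ⊤)
    (h : a ^ 2 * V ≤ K * b ^ 2) : a ≤ (K / V) ^ (1 / 2 : ℝ) * b := by
  have h1 : a ^ 2 ≤ (K / V) * b ^ 2 := by
    rw [ENNReal.div_eq_inv_mul, mul_assoc, ← ENNReal.div_eq_inv_mul]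
    exact (ENNReal.le_div_iff_mul_le (.inl hV) (.inl hV')).2 h
  have h2 := ENNReal.rpow_le_rpow h1 (z := 1 / 2) (by norm_num)
  rw [ENNReal.mul_rpow_of_nonneg _ _ (by norm_num), ← ENNReal.rpow_natCast, ← ENNReal.rpow_natCast,
    ← ENNReal.rpow_mul, ← ENNReal.rpow_mul] at h2
  simpa using h2

theorem MemH1Loc.ballNorm_sub_average_le {u : Space d → ℝ} (hu : MemH1Loc u) {r R : ℝ} (hr : 0 < r)
    (hrR : r ≤ R) :
    ballNorm R (fun x => u x - ⨍ y in Metric.ball 0 r, u y) ≤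
      (volume (Metric.ball (0 : Space d) (2 * R)) * ENNReal.ofReal (2 * R) ^ 2 /
        volume (Metric.ball (0 : Space d) r)) ^ (1 / 2 : ℝ) * ballNorm R (weakGradient u) :=
  le_mul_of_sq_mul_le (Metric.measure_ball_pos volume (0 : Space d) hr).ne' measure_ball_lt_top.ne
    (hu.poincare hr hrR)

/-- Balls of radii `2 R` and `R` have volume ratio `2 ^ d`, so the constant is linear in `R`. This
scaling compensates the gradient of a cutoff at scale `R`. -/
theorem exists_ballNorm_sub_average_le (d : ℕ) : ∃ c : ℝ, 0 ≤ c ∧ ∀ (u : Space d → ℝ) (R : ℝ),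
    MemH1Loc u → 0 < R → ballNorm R (fun x => u x - ⨍ y in Metric.ball 0 R, u y) ≤
      ENNReal.ofReal (c * R) * ballNorm R (weakGradient u) := by
  refine ⟨Real.sqrt (2 ^ d) * 2, by positivity, fun u R hu hR => ?_⟩
  refine (hu.ballNorm_sub_average_le hR le_rfl).trans_eq ?_
  congr 1
  have h1 : volume (Metric.ball (0 : Space d) (2 * R)) =
      ENNReal.ofReal (2 ^ d) * volume (Metric.ball (0 : Space d) R) := by
    have := Measure.addHaar_ball_mul_of_pos (volume : Measure (Space d)) 0 (zero_lt_two' ℝ) R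
    simpa using this
  have hV := (Metric.measure_ball_pos volume (0 : Space d) hR).ne'
  have hV' : volume (Metric.ball (0 : Space d) R) ≠ ⊤ := measure_ball_lt_top.ne
  rw [h1, mul_right_comm, ENNReal.mul_div_cancel_right hV hV', ← ENNReal.ofReal_pow (by positivity),
    ← ENNReal.ofReal_mul (by positivity), ENNReal.ofReal_rpow_of_nonneg (by positivity)
    (by norm_num), ← Real.sqrt_eq_rpow, Real.sqrt_mul (by positivity),
    Real.sqrt_sq (by positivity), mul_assoc]

theorem CauchyL2Loc.exists_tendsto [CompleteSpace F] {f : ℕ → Space d → F}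
    (hf : ∀ n, MemL2Loc (f n)) (h : CauchyL2Loc f) :
    ∃ g, MemL2Loc g ∧ TendstoL2Loc f g := by
  have key : ∀ k : ℕ, ∃ g : Space d → F, MemLp g 2 (volume.restrict (Metric.ball 0 k)) ∧
      Tendsto (fun n => ballNorm k (fun x => f n x - g x)) atTop (𝓝 0) := by
    intro k
    have hm : ∀ n, MemLp (f n) 2 (volume.restrict (Metric.ball (0 : Space d) (k : ℝ))) :=
      fun n => (hf n).memLp_ball 0 k
    have hc : CauchySeq fun n => (hm n).toLp := by
      rw [EMetric.cauchySeq_iff]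
      intro ε hε
      have h1 := (ENNReal.tendsto_nhds_zero.1 (h k)) (ε / 2)
        (ENNReal.div_pos hε.ne' ENNReal.ofNat_ne_top)
      by_cases hεt : ε = ⊤
      · refine ⟨0, fun m _ n _ => ?_⟩
        rw [hεt]
        exact edist_lt_top _ _
      · rw [eventually_atTop_prod_self] at h1
        obtain ⟨N, hN⟩ := h1
        refine ⟨N, fun m hm' n hn' => ?_⟩
        rw [Lp.edist_toLp_toLp]
        exact (hN m n hm' hn').trans_lt (ENNReal.half_lt_self hε.ne' hεt)
    obtain ⟨g, hg⟩ := cauchySeq_tendsto_of_complete hc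
    refine ⟨g, Lp.memLp g, ?_⟩
    rw [tendsto_iff_edist_tendsto_0] at hg
    refine hg.congr fun n => ?_
    rw [Lp.edist_def, ballNorm]
    refine eLpNorm_congr_ae ?_
    filter_upwards [(hm n).coeFn_toLp] with x hx
    simp [hx]
  choose g hg hlim using key
  have hcompat : ∀ k l : ℕ, k ≤ l → ∀ᵐ x ∂volume.restrict (Metric.ball (0 : Space d) k),
      g k x = g l x := by
    intro k l hkl
    have hle : volume.restrict (Metric.ball (0 : Space d) k) ≤
        volume.restrict (Metric.ball (0 : Space d) l) :=
      Measure.restrict_mono (Metric.ball_subset_ball (by exact_mod_cast hkl)) le_rfl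
    have hgl := (hg l).mono_measure hle
    have h0 : eLpNorm (fun x => g k x - g l x) 2
        (volume.restrict (Metric.ball (0 : Space d) k)) = 0 := by
      have h1 : Tendsto (fun n => ballNorm k (fun x => f n x - g k x) +
          ballNorm l (fun x => f n x - g l x)) atTop (𝓝 (0 + 0)) := (hlim k).add (hlim l)
      rw [add_zero] at h1
      refine le_antisymm (ge_of_tendsto' h1 fun n => ?_) zero_le
      have e : (fun x => g k x - g l x) = (fun x => f n x - g l x) - (fun x => f n x - g k x) := by
        ext x
        simp
      have hfn := (hf n).memLp_ball 0 k
      rw [e, add_comm]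
      refine (eLpNorm_sub_le (hfn.sub hgl).1 (hfn.sub (hg k)).1 one_le_two).trans ?_
      exact add_le_add (eLpNorm_mono_measure _ hle) le_rfl
    rw [eLpNorm_eq_zero_iff (f := fun x => g k x - g l x) ((hg k).sub hgl).1 (by norm_num)] at h0
    filter_upwards [h0] with x hx
    exact sub_eq_zero.1 hx
  -- The limits on balls agree almost everywhere on smaller balls; at `x` the limit on a ball of
  -- integer radius exceeding `‖x‖` is chosen.
  let G : Space d → F := fun x => g (⌊‖x‖⌋₊ + 1) x
  have hG : ∀ k : ℕ, G =ᵐ[volume.restrict (Metric.ball 0 k)] g k := by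
    intro k
    have h1 : ∀ l : ℕ, ∀ᵐ x ∂volume.restrict (Metric.ball (0 : Space d) k),
        l ≤ k → x ∈ Metric.ball (0 : Space d) l → g l x = g k x := by
      intro l
      by_cases hl : l ≤ k
      · have := (ae_restrict_iff' Metric.isOpen_ball.measurableSet).1 (hcompat l k hl)
        filter_upwards [ae_restrict_of_ae this] with x hx _ hxl using hx hxl
      · exact .of_forall fun x h => absurd h hl
    filter_upwards [ae_all_iff.2 h1, ae_restrict_mem Metric.isOpen_ball.measurableSet] with x hx hxk
    rw [mem_ball_zero_iff] at hxk
    refine hx _ ?_ ?_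
    · have : ⌊‖x‖⌋₊ < k := (Nat.floor_lt (norm_nonneg _)).2 hxk
      omega
    · rw [mem_ball_zero_iff]
      push_cast
      exact Nat.lt_floor_add_one _
  refine ⟨G, memL2Loc_of_ball fun k => (hg k).ae_eq (hG k).symm, fun k => ?_⟩
  refine (hlim k).congr fun n => eLpNorm_congr_ae ?_
  filter_upwards [hG k] with x hx
  rw [hx]

theorem TendstoL2Loc.tendsto_integral {f : ℕ → Space d → ℝ} {g : Space d → ℝ}
    (hf : ∀ n, MemL2Loc (f n)) (hg : MemL2Loc g) (h : TendstoL2Loc f g) {φ : Space d → ℝ}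
    (hφ : Continuous φ) (hc : HasCompactSupport φ) :
    Tendsto (fun n => ∫ x, f n x * φ x) atTop (𝓝 (∫ x, g x * φ x)) := by
  obtain ⟨c, R, hcb, hR⟩ := hc.exists_bound_zero hφ
  obtain ⟨k, hk⟩ := exists_nat_gt R
  set μ := volume.restrict (Metric.ball (0 : Space d) k)
  have hμ : μ univ ≠ ⊤ := by simpa [μ] using measure_ball_lt_top.ne
  refine tendsto_integral_of_L1 _ (hg.locallyIntegrable.integrable_mul_test hφ hc).1
    (.of_forall fun n => (hf n).locallyIntegrable.integrable_mul_test hφ hc) ?_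
  have h1 : Tendsto (fun n => ballNorm k (fun x => f n x - g x) *
      μ univ ^ (1 / (1 : ENNReal).toReal - 1 / (2 : ENNReal).toReal) * ENNReal.ofReal c)
      atTop (𝓝 0) := by
    have h2 := ENNReal.Tendsto.mul_const (b := μ univ ^
      (1 / (1 : ENNReal).toReal - 1 / (2 : ENNReal).toReal) * ENNReal.ofReal c) (h k) (.inr ?_)
    · simpa [mul_assoc] using h2
    · exact ENNReal.mul_ne_top (ENNReal.rpow_ne_top_of_nonneg (by norm_num) hμ)
        ENNReal.ofReal_ne_top
  refine tendsto_of_tendsto_of_tendsto_of_le_of_le tendsto_const_nhds h1 (fun _ => zero_le)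
    fun n => ?_
  have h3 := eLpNorm_le_eLpNorm_mul_rpow_measure_univ (p := 1) (q := 2) (μ := μ) one_le_two
    (((hf n).sub hg).memLp_ball 0 k).1
  rw [eLpNorm_one_eq_lintegral_enorm] at h3
  refine le_trans ?_ (mul_le_mul_left h3 _)
  rw [← lintegral_mul_const' _ _ ENNReal.ofReal_ne_top,
    ← lintegral_indicator Metric.isOpen_ball.measurableSet]
  refine lintegral_mono fun x => ?_
  rw [← sub_mul, enorm_mul]
  by_cases hx : x ∈ Metric.ball (0 : Space d) k
  · rw [indicator_of_mem hx]
    gcongr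
    rw [← ofReal_norm]
    exact ENNReal.ofReal_le_ofReal (hcb x)
  · rw [indicator_of_notMem hx, hR x, enorm_zero, mul_zero]
    rw [mem_ball_zero_iff] at hx
    linarith

theorem MemL2Loc.component {G : Space d → Space d} (hG : MemL2Loc G) (i : Fin d) :
    MemL2Loc (fun x => G x i) := fun K hK =>
  (EuclideanSpace.proj (𝕜 := ℝ) i).comp_memLp' (hG K hK)

theorem TendstoL2Loc.component {G : ℕ → Space d → Space d} {Γ : Space d → Space d}
    (h : TendstoL2Loc G Γ) (i : Fin d) :
    TendstoL2Loc (fun n x => G n x i) (fun x => Γ x i) := fun k =>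
  tendsto_of_tendsto_of_tendsto_of_le_of_le tendsto_const_nhds (h k) (fun _ => zero_le)
    fun n => eLpNorm_mono fun x => PiLp.norm_apply_le (G n x - Γ x) i

theorem HasWeakGradient.of_tendsto {v : ℕ → Space d → ℝ} {G : ℕ → Space d → Space d}
    {u : Space d → ℝ} {Γ : Space d → Space d} (hv : ∀ n, HasWeakGradient (v n) (G n))
    (hv2 : ∀ n, MemL2Loc (v n)) (hG2 : ∀ n, MemL2Loc (G n)) (hu : MemL2Loc u) (hΓ : MemL2Loc Γ)
    (h1 : TendstoL2Loc v u) (h2 : TendstoL2Loc G Γ) : HasWeakGradient u Γ := by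
  refine ⟨hu.locallyIntegrable, hΓ.locallyIntegrable, fun φ hφ hc i => ?_⟩
  have t1 := h1.tendsto_integral hv2 hu (continuous_fderiv_dir hφ (unitVec i)) (hc.fderiv_dir _)
  have t2 := ((h2.component i).tendsto_integral (fun n => (hG2 n).component i) (hΓ.component i)
    hφ.continuous hc).neg
  exact tendsto_nhds_unique t1 (t2.congr fun n => ((hv n).2.2 φ hφ hc i).symm)

/-- The limits of gradients in `L²_loc` are gradients. -/
theorem exists_of_tendsto_weakGradient {v : ℕ → Space d → ℝ} {Γ : Space d → Space d}
    (hv : ∀ n, MemH1Loc (v n)) (hΓ : MemL2Loc Γ)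
    (h : TendstoL2Loc (fun n => weakGradient (v n)) Γ) :
    ∃ u, MemL2Loc u ∧ HasWeakGradient u Γ ∧
      TendstoL2Loc (fun n x => v n x - ⨍ y in Metric.ball 0 1, v n y) u := by
  -- Gradients fix the functions only up to constants. Subtracting the mean over the unit ball lets
  -- the Poincaré inequality turn convergence of gradients into a Cauchy property of the functions.
  set f : ℕ → Space d → ℝ := fun n x => v n x - ⨍ y in Metric.ball 0 1, v n y with hf
  have hf2 : ∀ n, MemL2Loc (f n) := fun n => (hv n).1.sub continuous_const.memL2Loc
  have hfg : ∀ n, HasWeakGradient (f n) (weakGradient (v n)) := fun n => by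
    simpa using (hv n).hasWeakGradient.sub (hasWeakGradient_const (⨍ y in Metric.ball 0 1, v n y))
  have hcau : CauchyL2Loc f := by
    intro k
    -- The ball must contain the unit ball over which the means are taken; below, `k + 1` is an
    -- integer radius that dominates it.
    set R : ℝ := max k 1
    set c := (volume (Metric.ball (0 : Space d) (2 * R)) * ENNReal.ofReal (2 * R) ^ 2 /
        volume (Metric.ball (0 : Space d) 1)) ^ (1 / 2 : ℝ) with hc
    have hct : c ≠ ⊤ := by
      refine ENNReal.rpow_ne_top_of_nonneg (by norm_num) (ENNReal.div_ne_top
        (ENNReal.mul_ne_top measure_ball_lt_top.ne (ENNReal.pow_ne_top ENNReal.ofReal_ne_top))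
        (Metric.measure_ball_pos volume (0 : Space d) one_pos).ne')
    have h1 : ∀ p : ℕ × ℕ, ballNorm k (fun x => f p.1 x - f p.2 x) ≤
        c * (ballNorm (k + 1 : ℕ) (fun x => weakGradient (v p.1) x - Γ x) +
          ballNorm (k + 1 : ℕ) (fun x => weakGradient (v p.2) x - Γ x)) := by
      intro p
      have hd := (hv p.1).sub (hv p.2)
      have hint : ∀ n, IntegrableOn (v n) (Metric.ball 0 1) := fun n =>
        ((hv n).1.locallyIntegrable.integrableOn_isCompact (isCompact_closedBall 0 1)).mono_set
          Metric.ball_subset_closedBall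
      have e1 : (fun x => f p.1 x - f p.2 x) = fun x => (v p.1 x - v p.2 x) -
          ⨍ y in Metric.ball 0 1, (v p.1 y - v p.2 y) := by
        ext x
        simp only [hf, setAverage_eq]
        rw [integral_sub (hint _) (hint _), smul_sub]
        ring
      rw [e1]
      refine (ballNorm_mono (le_max_left _ 1) _).trans
        ((hd.ballNorm_sub_average_le one_pos (le_max_right _ _)).trans ?_)
      refine mul_le_mul' le_rfl ?_
      rw [ballNorm_congr ((hv p.1).hasWeakGradient.sub (hv p.2).hasWeakGradient).weakGradient_ae_eq]
      have e2 : (fun x => weakGradient (v p.1) x - weakGradient (v p.2) x) = fun x =>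
          (weakGradient (v p.1) x - Γ x) - (weakGradient (v p.2) x - Γ x) := by
        ext1 x
        abel
      rw [e2]
      refine (ballNorm_mono (R' := (k + 1 : ℕ)) (by simp) _).trans (ballNorm_sub_le
        ((hv _).memL2Loc_weakGradient.sub hΓ) ((hv _).memL2Loc_weakGradient.sub hΓ) _)
    have h2 := (h (k + 1)).comp tendsto_fst |>.add ((h (k + 1)).comp tendsto_snd)
    rw [prod_atTop_atTop_eq] at h2
    have h3 := ENNReal.Tendsto.const_mul (a := c) h2 (.inr hct)
    rw [add_zero, mul_zero] at h3
    exact tendsto_of_tendsto_of_tendsto_of_le_of_le tendsto_const_nhds h3 (fun _ => zero_le) h1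
  obtain ⟨u, hu, hlim⟩ := hcau.exists_tendsto hf2
  exact ⟨u, hu, .of_tendsto hfg hf2 (fun n => (hv n).memL2Loc_weakGradient) hu hΓ hlim h, hlim⟩

end Limits

/-! ### Periodic functions and supercells -/

section Supercells

variable {d : ℕ} {F : Type*} [NormedAddCommGroup F]

/-- The points of the lattice `(Nℤ)^d`. -/
def latticePoint (N : ℕ) (k : Fin d → ℤ) : Space d := WithLp.toLp 2 fun i => (N : ℝ) * k i

theorem latticePoint_apply (N : ℕ) (k : Fin d → ℤ) (i : Fin d) :
    latticePoint N k i = N * k i := rfl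

theorem IsPeriodicField.ae {Y : Type*} {N : ℕ} {f : Space d → Y} (hf : IsPeriodicField N f)
    (k : Fin d → ℤ) : ∀ᵐ x, f (x + latticePoint N k) = f x := hf k

theorem isClosed_cube (N : ℕ) : IsClosed (cube N : Set (Space d)) := by
  have : (cube N : Set (Space d)) = ⋂ i, {x | x i ∈ Icc (-(N / 2 : ℝ)) (N / 2)} := by
    ext x
    simp [cube]
  rw [this]
  exact isClosed_iInter fun i => isClosed_Icc.preimage (by fun_prop)

theorem measurableSet_cube (N : ℕ) : MeasurableSet (cube N : Set (Space d)) :=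
  (isClosed_cube N).measurableSet

theorem isCompact_cube (N : ℕ) : IsCompact (cube N : Set (Space d)) := by
  have : (cube N : Set (Space d)) =
      WithLp.toLp 2 '' (univ.pi fun _ : Fin d => Icc (-(N / 2 : ℝ)) (N / 2)) := by
    ext x
    constructor
    · intro hx
      exact ⟨x.ofLp, fun i _ => hx i, rfl⟩
    · rintro ⟨y, hy, rfl⟩ i
      exact hy i (mem_univ i)
  rw [this]
  exact (isCompact_univ_pi fun _ => isCompact_Icc).image (PiLp.continuous_toLp 2 _)

theorem exists_add_mem_cube {N : ℕ} (hN : 0 < N) (x : Space d) :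
    x + latticePoint N (fun i => -round (x i / N)) ∈ cube N := by
  intro i
  have hN' : (0 : ℝ) < N := by exact_mod_cast hN
  have h := abs_le.1 (abs_sub_round (x i / N))
  have e : (x + latticePoint N (fun i => -round (x i / N))) i = N * (x i / N - round (x i / N)) := by
    rw [PiLp.add_apply, latticePoint_apply]
    push_cast
    field_simp
    ring
  rw [e]
  constructor <;> nlinarith [h.1, h.2]

theorem lintegral_cube_translate {N : ℕ} {f : Space d → F} (hf : IsPeriodicField N f)
    (k : Fin d → ℤ) : ∫⁻ x in (fun x => x + latticePoint N k) ⁻¹' cube N, ‖f x‖ₑ ^ 2 =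
      ∫⁻ x in cube N, ‖f x‖ₑ ^ 2 := by
  have h1 := (measurePreserving_add_right volume (latticePoint N k)).setLIntegral_comp_preimage_emb
    (MeasurableEquiv.addRight _).measurableEmbedding (fun x => ‖f x‖ₑ ^ 2) (cube N)
  rw [← h1]
  refine lintegral_congr_ae (ae_restrict_of_ae ?_)
  filter_upwards [hf.ae k] with x hx
  rw [hx]

/-- The `L²` norms of periodic functions on balls are controlled by those on the cell. -/
theorem exists_ballNorm_le {N : ℕ} (hN : 0 < N) (R : ℝ) : ∃ c : ENNReal, c ≠ ⊤ ∧
    ∀ f : Space d → F, IsPeriodicField N f →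
      ballNorm R f ≤ c * eLpNorm f 2 (volume.restrict (cube N)) := by
  classical
  -- Points of the ball have `|round (x i / N)| ≤ R + 1/2`, so finitely many translates of the cell
  -- cover it.
  obtain ⟨m, hm⟩ := exists_nat_ge (R + 1)
  set S : Finset (Fin d → ℤ) := Fintype.piFinset fun _ => Finset.Icc (-(m : ℤ)) m
  have hcover : Metric.ball (0 : Space d) R ⊆
      ⋃ k : S, (fun x => x + latticePoint N k) ⁻¹' cube N := by
    intro x hx
    refine mem_iUnion.2 ⟨⟨fun i => -round (x i / N), ?_⟩, exists_add_mem_cube hN x⟩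
    rw [mem_ball_zero_iff] at hx
    rw [Fintype.mem_piFinset]
    intro i
    have h1 : |x i| ≤ ‖x‖ := PiLp.norm_apply_le x i
    have hN' : (1 : ℝ) ≤ N := by exact_mod_cast hN
    have h2 : |x i / N| ≤ |x i| := by
      rw [abs_div, Nat.abs_cast]
      exact div_le_self (abs_nonneg _) hN'
    have h3 := abs_le.1 (abs_sub_round (x i / N))
    have h4 := abs_le.1 (h2.trans h1)
    rw [Finset.mem_Icc]
    constructor
    · have : ((round (x i / N) : ℤ) : ℝ) ≤ m := by linarith [h3.1, h4.2]
      have : round (x i / N) ≤ (m : ℤ) := by exact_mod_cast this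
      linarith
    · have : -(m : ℝ) ≤ ((round (x i / N) : ℤ) : ℝ) := by linarith [h3.2, h4.1]
      have : -(m : ℤ) ≤ round (x i / N) := by exact_mod_cast this
      linarith
  refine ⟨((S.card : ENNReal) / 1) ^ (1 / 2 : ℝ), ENNReal.rpow_ne_top_of_nonneg (by norm_num)
    (by simp), fun f hf => ?_⟩
  refine le_mul_of_sq_mul_le one_ne_zero ENNReal.one_ne_top ?_
  rw [mul_one, ballNorm, eLpNorm_two_sq, eLpNorm_two_sq]
  calc ∫⁻ x in Metric.ball (0 : Space d) R, ‖f x‖ₑ ^ 2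
      ≤ ∫⁻ x in ⋃ k : S, (fun x => x + latticePoint N k) ⁻¹' cube N, ‖f x‖ₑ ^ 2 :=
        lintegral_mono_set hcover
    _ ≤ ∑' k : S, ∫⁻ x in (fun x => x + latticePoint N k) ⁻¹' cube N, ‖f x‖ₑ ^ 2 :=
        lintegral_iUnion_le _ _
    _ = S.card * ∫⁻ x in cube N, ‖f x‖ₑ ^ 2 := by
        rw [tsum_fintype, Finset.sum_congr rfl fun (k : S) _ => lintegral_cube_translate hf k,
          Finset.sum_const, nsmul_eq_mul, Finset.card_univ, Fintype.card_coe]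

theorem IsPeriodicField.ae_eq_of_cube {Y : Type*} {N : ℕ} (hN : 0 < N) {f g : Space d → Y}
    (hf : IsPeriodicField N f) (hg : IsPeriodicField N g)
    (h : f =ᵐ[volume.restrict (cube N)] g) : f =ᵐ[volume] g := by
  have h1 : ∀ᵐ x, x ∈ cube N → f x = g x := (ae_restrict_iff' (measurableSet_cube N)).1 h
  have h2 : ∀ᵐ x, ∀ k : Fin d → ℤ, x + latticePoint N k ∈ cube N → f x = g x := by
    refine ae_all_iff.2 fun k => ?_
    filter_upwards [ae_translate h1 (latticePoint N k), hf.ae k, hg.ae k] with x hx hfx hgx hm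
    rw [← hfx, ← hgx]
    exact hx hm
  filter_upwards [h2] with x hx using hx _ (exists_add_mem_cube hN x)

theorem IsPeriodicField.of_dvd {Y : Type*} {N m : ℕ} {f : Space d → Y} (hf : IsPeriodicField N f)
    (h : N ∣ m) : IsPeriodicField m f := by
  obtain ⟨c, rfl⟩ := h
  intro k
  have := hf fun i => c * k i
  simpa [mul_assoc] using this

/-- A translate of the weak gradient is a weak gradient of the translate, and weak gradients are
unique. -/
theorem IsPeriodicField.weakGradient {N : ℕ} {u : Space d → ℝ} (hu : MemH1Loc u)
    (hper : IsPeriodicField N u) : IsPeriodicField N (weakGradient u) := by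
  intro k
  have h1 := hu.hasWeakGradient.translate (latticePoint N k)
  exact (h1.congr (hper k) .rfl).ae_eq hu.hasWeakGradient

/-! ### The tiling of an odd supercell by unit cells -/

/-- The representative in `{-(N-1)/2, …, (N-1)/2}^d` of a class modulo `N`. -/
def cellShift (N : ℕ) (k : Fin d → ZMod N) : Space d := latticePoint 1 fun i => (k i).valMinAbs

theorem cellShift_apply (N : ℕ) (k : Fin d → ZMod N) (i : Fin d) :
    cellShift N k i = ((k i).valMinAbs : ℝ) := by
  simp [cellShift, latticePoint_apply]

theorem abs_valMinAbs_le {N : ℕ} (hN : Odd N) (a : ZMod N) :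
    |(a.valMinAbs : ℝ)| ≤ (N - 1) / 2 := by
  obtain ⟨m, rfl⟩ := hN
  have h := a.natAbs_valMinAbs_le
  have h1 : a.valMinAbs.natAbs ≤ m := by omega
  have h2 : |a.valMinAbs| ≤ (m : ℤ) := by
    rw [Int.abs_eq_natAbs]
    exact_mod_cast h1
  have h3 : |(a.valMinAbs : ℝ)| ≤ m := by exact_mod_cast h2
  push_cast
  linarith

theorem ae_forall_ne (c : ℝ) : ∀ᵐ x : Space d, ∀ i, x i ≠ c := by
  refine ae_all_iff.2 fun i => ?_
  have h : ∀ᵐ y : Fin d → ℝ, y i ≠ c := by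
    rw [ae_iff]
    simp only [not_not]
    exact Measure.pi_hyperplane (fun _ : Fin d => (volume : Measure ℝ)) i c
  exact (PiLp.volume_preserving_ofLp (Fin d)).quasiMeasurePreserving.ae h

/-- For odd `N` the supercell is a union of unit cells centred at integer points, and the centre of
the cell of `x` is found by rounding its coordinates. Half-integer coordinates, where cells share
faces, are excluded; they form a null set. -/
theorem sub_cellShift_mem_cube_iff {N : ℕ} (hN : Odd N) {x : Space d}
    (hx : ∀ n : ℤ, ∀ i, x i ≠ n + 1 / 2) (k : Fin d → ZMod N) :
    x - cellShift N k ∈ cube 1 ↔ x ∈ cube N ∧ k = fun i => ((round (x i) : ℤ) : ZMod N) := by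
  have hN0 : NeZero N := ⟨by rintro rfl; simp at hN⟩
  constructor
  · intro h
    have h' : ∀ i, |x i - (k i).valMinAbs| ≤ 1 / 2 := by
      intro i
      have := h i
      rw [PiLp.sub_apply, cellShift_apply] at this
      rw [abs_le]
      simpa using this
    refine ⟨fun i => ?_, funext fun i => ?_⟩
    · have h1 := abs_le.1 (abs_valMinAbs_le hN (k i))
      have h2 := abs_le.1 (h' i)
      constructor <;> linarith [h1.1, h1.2, h2.1, h2.2]
    · have h2 := abs_le.1 (h' i)
      have h3 : round (x i) = (k i).valMinAbs := by
        rw [round_eq, Int.floor_eq_iff]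
        refine ⟨by linarith [h2.1], lt_of_le_of_ne (by linarith [h2.2]) fun hc => ?_⟩
        exact hx (k i).valMinAbs i (by linarith)
      rw [h3, ZMod.coe_valMinAbs]
  · rintro ⟨h, rfl⟩ i
    have h1 := abs_le.1 (abs_sub_round (x i))
    have h2 := h i
    have h4 : ((round (x i) : ℤ) : ZMod N).valMinAbs = round (x i) := by
      rw [ZMod.valMinAbs_spec]
      refine ⟨rfl, ?_⟩
      obtain ⟨m, rfl⟩ := hN
      have hne1 := hx m i
      have hne2 := hx (-m - 1) i
      push_cast at h2 hne1 hne2 ⊢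
      have hl : -((m : ℤ) : ℝ) - 1 < round (x i) := by
        have : -((m : ℝ)) - 1 + 1 / 2 < x i := lt_of_le_of_ne (by linarith [h2.1]) hne2.symm
        push_cast
        linarith [h1.2]
      have hu : ((round (x i) : ℤ) : ℝ) < (m : ℤ) + 1 := by
        have : x i < (m : ℝ) + 1 / 2 := lt_of_le_of_ne (by linarith [h2.2]) hne1
        push_cast
        linarith [h1.1]
      have hl' : -(m : ℤ) - 1 < round (x i) := by exact_mod_cast hl
      have hu' : round (x i) < (m : ℤ) + 1 := by exact_mod_cast hu
      constructor <;> omega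
    rw [PiLp.sub_apply, cellShift_apply, h4]
    push_cast
    exact ⟨by linarith [h1.1], by linarith [h1.2]⟩

theorem setIntegral_cube_eq_sum {N : ℕ} (hN : Odd N) [NeZero N] {f : Space d → ℝ}
    (hf : ∀ k : Fin d → ZMod N, IntegrableOn (fun x => f (x + cellShift N k)) (cube 1)) :
    ∫ x in cube N, f x = ∑ k : Fin d → ZMod N, ∫ x in cube 1, f (x + cellShift N k) := by
  have hgood : ∀ᵐ x : Space d, ∀ n : ℤ, ∀ i, x i ≠ n + 1 / 2 :=
    ae_all_iff.2 fun n => ae_forall_ne _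
  have e1 : ∀ k : Fin d → ZMod N, ∫ x in cube 1, f (x + cellShift N k) =
      ∫ x, (cube 1).indicator (fun x => f (x + cellShift N k)) (x - cellShift N k) := by
    intro k
    rw [← integral_indicator (measurableSet_cube 1),
      integral_sub_right_eq_self (fun x => (cube 1).indicator (fun x => f (x + cellShift N k)) x)]
  rw [Finset.sum_congr rfl fun k _ => e1 k, ← integral_finsetSum _ fun k _ =>
    ((integrable_indicator_iff (measurableSet_cube 1)).2 (hf k)).comp_sub_right _,
    ← integral_indicator (measurableSet_cube N)]
  refine integral_congr_ae ?_
  filter_upwards [hgood] with x hx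
  have e2 : ∀ k : Fin d → ZMod N,
      (cube 1).indicator (fun x => f (x + cellShift N k)) (x - cellShift N k) =
        if k = (fun i => ((round (x i) : ℤ) : ZMod N)) then (cube N).indicator f x else 0 := by
    intro k
    have h := sub_cellShift_mem_cube_iff hN hx k
    by_cases h1 : x - cellShift N k ∈ cube 1
    · rw [indicator_of_mem h1, if_pos (h.1 h1).2, indicator_of_mem (h.1 h1).1, sub_add_cancel]
    · rw [indicator_of_notMem h1]
      by_cases h2 : k = fun i => ((round (x i) : ℤ) : ZMod N)
      · rw [if_pos h2, indicator_of_notMem fun h3 => h1 (h.2 ⟨h3, h2⟩)]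
      · rw [if_neg h2]
  simp only [e2]
  simp

/-- An integer translation permutes the classes modulo `N`; it shifts representatives by multiples
of `N`, which periodicity absorbs. -/
theorem IsPeriodicField.cellSum {N : ℕ} [NeZero N] {v : Space d → ℝ} (hv : IsPeriodicField N v) :
    IsPeriodicField 1 fun x => ∑ k : Fin d → ZMod N, v (x + cellShift N k) := by
  intro l
  have h1 : ∀ k : Fin d → ZMod N, ∀ᵐ x, v (x + latticePoint 1 l + cellShift N k) =
      v (x + cellShift N (k + fun i => (l i : ZMod N))) := by
    intro k
    set k' : Fin d → ZMod N := k + fun i => (l i : ZMod N)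
    have h2 : ∀ i, ∃ m : ℤ, l i + (k i).valMinAbs - (k' i).valMinAbs = N * m := by
      intro i
      have : (((k' i).valMinAbs : ℤ) : ZMod N) = ((l i + (k i).valMinAbs : ℤ) : ZMod N) := by
        rw [Int.cast_add, ZMod.coe_valMinAbs, ZMod.coe_valMinAbs]
        simp [k', add_comm]
      exact (ZMod.intCast_eq_intCast_iff_dvd_sub _ _ _).1 this
    choose m hm using h2
    filter_upwards [ae_translate (hv.ae m) (cellShift N k')] with x hx
    rw [← hx]
    congr 1
    ext i
    have := hm i
    have h3 : (l i : ℝ) + (k i).valMinAbs - (k' i).valMinAbs = N * m i := by exact_mod_cast this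
    simp only [PiLp.add_apply, cellShift_apply, latticePoint_apply, Nat.cast_one, one_mul]
    linarith
  have h2 := ae_all_iff.2 h1
  filter_upwards [h2] with x hx
  change ∑ k : Fin d → ZMod N, v (x + latticePoint 1 l + cellShift N k) = _
  rw [Finset.sum_congr rfl fun k _ => hx k]
  exact Equiv.sum_comp (Equiv.addRight fun i => (l i : ZMod N))
    (fun k : Fin d → ZMod N => v (x + cellShift N k))

theorem MemH1Loc.sum {ι : Type*} (s : Finset ι) {v : ι → Space d → ℝ}
    (hv : ∀ k ∈ s, MemH1Loc (v k)) :
    MemH1Loc (fun x => ∑ k ∈ s, v k x) ∧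
      HasWeakGradient (fun x => ∑ k ∈ s, v k x) (fun x => ∑ k ∈ s, weakGradient (v k) x) := by
  classical
  induction s using Finset.induction_on with
  | empty =>
    simp only [Finset.sum_empty]
    exact ⟨(hasWeakGradient_const 0).memH1Loc continuous_const.memL2Loc continuous_zero.memL2Loc,
      hasWeakGradient_const 0⟩
  | insert a s ha ih =>
    simp only [Finset.sum_insert ha]
    have h1 := hv a (Finset.mem_insert_self a s)
    obtain ⟨h2, h3⟩ := ih fun k hk => hv k (Finset.mem_insert_of_mem hk)
    exact ⟨h1.add h2, h1.hasWeakGradient.add h3⟩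

end Supercells

/-! ### Bounded tensor fields -/

section TensorFields

variable {d : ℕ} {A C : Space d → Matrix (Fin d) (Fin d) ℝ} {c : ℝ}

/-- Measurable tensor fields bounded by `c`. -/
structure IsBoundedField (A : Space d → Matrix (Fin d) (Fin d) ℝ) (c : ℝ) : Prop where
  aemeasurable : ∀ i j, AEMeasurable fun x => A x i j
  bound : ∀ᵐ x, ∀ ξ : Space d, ‖act (A x) ξ‖ ≤ c * ‖ξ‖

theorem act_apply (A : Matrix (Fin d) (Fin d) ℝ) (ξ : Space d) (i : Fin d) :
    act A ξ i = ∑ j, A i j * ξ j := by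
  simp [act, Matrix.toLpLin_apply, Matrix.mulVec, dotProduct]

theorem act_add (A B : Matrix (Fin d) (Fin d) ℝ) (ξ : Space d) :
    act (A + B) ξ = act A ξ + act B ξ := by
  simp [act]

theorem act_smul (s : ℝ) (A : Matrix (Fin d) (Fin d) ℝ) (ξ : Space d) :
    act (s • A) ξ = s • act A ξ := by
  simp [act]

theorem act_zero (ξ : Space d) : act (0 : Matrix (Fin d) (Fin d) ℝ) ξ = 0 := by
  simp [act]

theorem inner_act_transpose (A : Matrix (Fin d) (Fin d) ℝ) (ξ η : Space d) :
    inner ℝ (act A.transpose ξ) η = inner ℝ ξ (act A η) := by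
  simp only [PiLp.inner_apply, act_apply, Matrix.transpose_apply]
  simp only [RCLike.inner_apply, conj_trivial, Finset.mul_sum, Finset.sum_mul]
  rw [Finset.sum_comm]
  refine Finset.sum_congr rfl fun i _ => Finset.sum_congr rfl fun j _ => ?_
  ring

theorem continuous_act (A : Matrix (Fin d) (Fin d) ℝ) : Continuous (act A) :=
  LinearMap.continuous_of_finiteDimensional (Matrix.toEuclideanLin A)

theorem IsBoundedField.memLp (hA : IsBoundedField A c) {S : Set (Space d)} {f : Space d → Space d}
    (hf : MemLp f 2 (volume.restrict S)) :
    MemLp (fun x => act (A x) (f x)) 2 (volume.restrict S) := by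
  refine hf.of_le_mul (c := c) ?_ ?_
  · refine AEMeasurable.aestronglyMeasurable ?_
    have hcomp : ∀ i, AEMeasurable (fun x => f x i) (volume.restrict S) := fun i =>
      ((EuclideanSpace.proj (𝕜 := ℝ) i).continuous.measurable).comp_aemeasurable hf.1.aemeasurable
    have h1 : AEMeasurable (fun x => (fun i => ∑ j, A x i j * f x j : Fin d → ℝ))
        (volume.restrict S) := by
      refine aemeasurable_pi_lambda _ fun i => ?_
      exact Finset.aemeasurable_fun_sum _ fun j _ => (hA.aemeasurable i j).restrict.mul (hcomp j)
    have h2 := (WithLp.measurable_toLp 2 (Fin d → ℝ)).comp_aemeasurable h1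
    refine h2.congr (.of_forall fun x => ?_)
    ext i
    simp [act_apply]
  · filter_upwards [ae_restrict_of_ae hA.bound] with x hx using hx _

/-- With `η = Aᵀ ξ` one has `‖η‖² = ξ · A η`, which is at most `c ‖ξ‖ ‖η‖`. -/
theorem IsBoundedField.transpose (hA : IsBoundedField A c) :
    IsBoundedField (fun x => (A x).transpose) c := by
  refine ⟨fun i j => hA.aemeasurable j i, ?_⟩
  filter_upwards [hA.bound] with x hx ξ
  set η := act (A x).transpose ξ with hη
  have h1 : ‖η‖ ^ 2 ≤ c * ‖ξ‖ * ‖η‖ := by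
    rw [← real_inner_self_eq_norm_sq]
    conv_lhs => rw [hη, inner_act_transpose, ← hη]
    calc inner ℝ ξ (act (A x) η) ≤ ‖ξ‖ * ‖act (A x) η‖ := real_inner_le_norm _ _
      _ ≤ ‖ξ‖ * (c * ‖η‖) := by gcongr; exact hx η
      _ = c * ‖ξ‖ * ‖η‖ := by ring
  rcases (norm_nonneg η).eq_or_lt with h0 | h0
  · rw [← h0]
    exact (norm_nonneg _).trans (hx ξ)
  · nlinarith

theorem IsBoundedField.add {c' : ℝ} (hA : IsBoundedField A c) (hC : IsBoundedField C c') :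
    IsBoundedField (fun x => A x + C x) (c + c') := by
  refine ⟨fun i j => (hA.aemeasurable i j).add (hC.aemeasurable i j), ?_⟩
  filter_upwards [hA.bound, hC.bound] with x h1 h2 ξ
  rw [act_add, add_mul]
  exact (norm_add_le _ _).trans (add_le_add (h1 ξ) (h2 ξ))

theorem IsBoundedField.const_smul (hA : IsBoundedField A c) (s : ℝ) :
    IsBoundedField (fun x => s • A x) (|s| * c) := by
  refine ⟨fun i j => (hA.aemeasurable i j).const_mul s, ?_⟩
  filter_upwards [hA.bound] with x h1 ξ
  rw [act_smul, norm_smul, mul_assoc, Real.norm_eq_abs]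
  exact mul_le_mul_of_nonneg_left (h1 ξ) (abs_nonneg _)

theorem IsBoundedField.indicator (hA : IsBoundedField A c) (hc : 0 ≤ c) {S : Set (Space d)}
    (hS : MeasurableSet S) : IsBoundedField (S.indicator A) c := by
  refine ⟨fun i j => ?_, ?_⟩
  · have : (fun x => S.indicator A x i j) = S.indicator fun x => A x i j := by
      ext x
      by_cases hx : x ∈ S <;> simp [hx]
    rw [this]
    exact (hA.aemeasurable i j).indicator hS
  · filter_upwards [hA.bound] with x h1 ξ
    by_cases hx : x ∈ S
    · rw [indicator_of_mem hx]
      exact h1 ξ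
    · rw [indicator_of_notMem hx, act_zero, norm_zero]
      positivity

theorem _root_.MeasureTheory.MemLp.integrable_inner_two {Y : Type*} [MeasurableSpace Y]
    {μ : Measure Y} {f g : Y → Space d} (hf : MemLp f 2 μ) (hg : MemLp g 2 μ) :
    Integrable (fun x => inner ℝ (f x) (g x)) μ := by
  refine (L2.integrable_inner (𝕜 := ℝ) hf.toLp hg.toLp).congr ?_
  filter_upwards [hf.coeFn_toLp, hg.coeFn_toLp] with x h1 h2
  rw [h1, h2]

theorem IsBoundedField.integrable_inner (hA : IsBoundedField A c) {S : Set (Space d)}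
    {f g : Space d → Space d} (hf : MemLp f 2 (volume.restrict S))
    (hg : MemLp g 2 (volume.restrict S)) :
    IntegrableOn (fun x => inner ℝ (act (A x) (f x)) (g x)) S :=
  (hA.memLp hf).integrable_inner_two hg

/-- A corrector on the unit cell is a corrector on all supercells. -/
theorem IsPeriodicCorrector.supercell (hA : IsBoundedField A c) (hper : IsPeriodicField 1 A)
    {i : Fin d} {w : Space d → ℝ} (hw : IsPeriodicCorrector 1 A i w) {N : ℕ} (hN : Odd N) :
    IsPeriodicCorrector N A i w := by
  have hN0 : NeZero N := ⟨by rintro rfl; simp at hN⟩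
  refine ⟨hw.1, hw.2.1.of_dvd (one_dvd N), fun v hv hvper => ?_⟩
  have hmem : ∀ g : Space d → Space d, MemL2Loc g → MemLp g 2 (volume.restrict (cube 1)) :=
    fun g hg => hg _ (isCompact_cube 1)
  have hW : MemL2Loc fun x => weakGradient w x + unitVec i :=
    hw.1.memL2Loc_weakGradient.add continuous_const.memL2Loc
  have hper' := hw.2.1.weakGradient hw.1
  have e1 : ∀ k : Fin d → ZMod N, ∀ᵐ x,
      inner ℝ (act (A (x + cellShift N k)) (weakGradient w (x + cellShift N k) + unitVec i))
        (weakGradient v (x + cellShift N k)) =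
      inner ℝ (act (A x) (weakGradient w x + unitVec i)) (weakGradient v (x + cellShift N k)) := by
    intro k
    filter_upwards [hper.ae fun i => (k i).valMinAbs, hper'.ae fun i => (k i).valMinAbs]
      with x h1 h2
    rw [cellShift, h1, h2]
  have hint : ∀ k : Fin d → ZMod N, IntegrableOn (fun x =>
      inner ℝ (act (A x) (weakGradient w x + unitVec i)) (weakGradient v (x + cellShift N k)))
      (cube 1) := fun k =>
    hA.integrable_inner (hmem _ hW) (hmem _ (hv.memL2Loc_weakGradient.translate _))
  rw [setIntegral_cube_eq_sum hN fun k => (hint k).congr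
    (ae_restrict_of_ae ((e1 k).mono fun x hx => hx.symm))]
  -- Since `A` and `∇w` are periodic with period one, integrating against `∇v` over the supercell
  -- amounts to integrating over `Q` against the gradient of the sum of the translates of `v`, an
  -- admissible test function on the unit cell.
  have hsum := MemH1Loc.sum Finset.univ (v := fun (k : Fin d → ZMod N) x => v (x + cellShift N k))
    fun k _ => hv.translate _
  have h0 := hw.2.2 _ hsum.1 hvper.cellSum
  rw [Finset.sum_congr rfl fun k _ => integral_congr_ae (ae_restrict_of_ae (e1 k)),
    ← integral_finsetSum _ fun k _ => hint k, ← h0]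
  have e2 : ∀ᵐ x, ∀ k : Fin d → ZMod N, weakGradient (fun x => v (x + cellShift N k)) x =
      weakGradient v (x + cellShift N k) :=
    ae_all_iff.2 fun k => (hv.hasWeakGradient.translate _).weakGradient_ae_eq
  refine integral_congr_ae (ae_restrict_of_ae ?_)
  filter_upwards [hsum.2.weakGradient_ae_eq, e2] with x h1 h2
  rw [h1, inner_sum]
  exact Finset.sum_congr rfl fun k _ => by rw [h2 k]

end TensorFields

/-! ### Density of the gradients of test functions -/

section Density

variable {d : ℕ}

/-- Translations act continuously on `L²`. -/
theorem continuous_integral_translate {G U : Space d → Space d} (hG : MemLp G 2 volume)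
    (hU : MemLp U 2 volume) : Continuous fun h : Space d => ∫ y, inner ℝ (G (y + h)) (U y) := by
  let g : Space d → C(Space d, Space d) := fun h => ⟨fun y => y + h, by fun_prop⟩
  have hg : Continuous g :=
    (ContinuousMap.curry ⟨fun p : Space d × Space d => p.2 + p.1, by fun_prop⟩).continuous
  have hgm : ∀ h, MeasurePreserving (g h) volume volume := fun h =>
    measurePreserving_add_right volume h
  have h1 : Continuous fun h => Lp.compMeasurePreserving (g h) (hgm h) hG.toLp :=
    continuous_const.compMeasurePreservingLp hg hgm (by simp)
  have h2 : Continuous fun h =>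
      (inner ℝ (Lp.compMeasurePreserving (g h) (hgm h) hG.toLp) hU.toLp : ℝ) :=
    h1.inner continuous_const
  refine h2.congr fun h => ?_
  rw [L2.inner_def]
  refine integral_congr_ae ?_
  have h3 := (hgm h).quasiMeasurePreserving.ae hG.coeFn_toLp
  filter_upwards [Lp.coeFn_compMeasurePreserving hG.toLp (hgm h), h3, hU.coeFn_toLp]
    with y e1 e2 e3
  rw [e1, Function.comp_apply, e2, e3]
  rfl

theorem abs_inner_le_sq_add_sq (a b : Space d) : |inner ℝ a b| ≤ ‖a‖ ^ 2 + ‖b‖ ^ 2 := by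
  refine (abs_real_inner_le_norm a b).trans ?_
  nlinarith [sq_nonneg (‖a‖ - ‖b‖), sq_nonneg ‖a‖, sq_nonneg ‖b‖]

/-- The integral of `|G (y + h) · U y|` over `y` is at most the sum of the squared norms, uniformly
in `h`, and `ρ` is integrable. This licenses the exchanges of integrals in the mollification
argument. -/
theorem integrable_weighted_inner {G U : Space d → Space d} (hG : MemLp G 2 volume)
    (hU : MemLp U 2 volume) (hGm : Measurable G) (hUm : Measurable U) {ρ : Space d → ℝ}
    (hρ : Continuous ρ) (hc : HasCompactSupport ρ) :
    Integrable (fun p : Space d × Space d => ρ p.2 * inner ℝ (G (p.1 + p.2)) (U p.1))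
      (volume.prod volume) := by
  have hm : Measurable fun p : Space d × Space d => ρ p.2 * inner ℝ (G (p.1 + p.2)) (U p.1) := by
    have := hρ.measurable
    fun_prop
  have hi : ∀ h : Space d, Integrable fun y => inner ℝ (G (y + h)) (U y) := fun h =>
    ((hG.comp_measurePreserving (measurePreserving_add_right volume h)).integrable_inner_two hU)
  refine (integrable_prod_iff' hm.aestronglyMeasurable).2 ⟨.of_forall fun h => (hi h).const_mul (ρ h), ?_⟩
  have hρi := hρ.integrable_of_hasCompactSupport hc (μ := volume)
  refine (hρi.norm.mul_const ((∫ y, ‖G y‖ ^ 2) + ∫ y, ‖U y‖ ^ 2)).mono'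
    hm.norm.stronglyMeasurable.integral_prod_left'.aestronglyMeasurable (.of_forall fun h => ?_)
  rw [Real.norm_of_nonneg (integral_nonneg fun _ => norm_nonneg _)]
  simp only [norm_mul]
  rw [integral_const_mul]
  gcongr
  have hG2 := (memLp_two_iff_integrable_sq_norm hG.1).1 hG
  have hU2 := (memLp_two_iff_integrable_sq_norm hU.1).1 hU
  rw [← integral_add_right_eq_self (fun y => ‖G y‖ ^ 2) h,
    ← integral_add (hG2.comp_add_right h) hU2]
  exact integral_mono (hi h).norm ((hG2.comp_add_right h).add hU2)
    fun y => abs_inner_le_sq_add_sq _ _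

/-- The gradient of a mollification is the mollification of the weak gradient. -/
theorem HasWeakGradient.inner_gradient_convolution {u : Space d → ℝ} {U : Space d → Space d}
    (hu : HasWeakGradient u U) {ρ : Space d → ℝ} (hρ : ContDiff ℝ ∞ ρ) (hc : HasCompactSupport ρ)
    (x ξ : Space d) :
    inner ℝ ξ (gradient (convolution u ρ (ContinuousLinearMap.mul ℝ ℝ) volume) x) =
      ∫ y, ρ (x - y) * inner ℝ ξ (U y) := by
  have h1 := hc.hasFDerivAt_convolution_right (ContinuousLinearMap.mul ℝ ℝ) hu.1
    (hρ.of_le (by simp)) x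
  have h2 : ConvolutionExistsAt u (fderiv ℝ ρ) x
      ((ContinuousLinearMap.mul ℝ ℝ).precompR (Space d)) volume :=
    (hc.fderiv ℝ).convolutionExists_right _ hu.1 (hρ.continuous_fderiv (by simp)) x
  rw [real_inner_comm, inner_gradient_left, h1.fderiv, convolution,
    ContinuousLinearMap.integral_apply h2]
  have h3 : ContDiff ℝ ∞ fun y => ρ (x - y) := hρ.comp (contDiff_const.sub contDiff_id)
  have h4 : HasCompactSupport fun y => ρ (x - y) := hc.comp_homeomorph (Homeomorph.subLeft x)
  have h5 := hu.integral_fderiv h3 h4 ξ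
  have h6 : ∀ y, fderiv ℝ (fun y => ρ (x - y)) y ξ = -fderiv ℝ ρ (x - y) ξ := by
    intro y
    have e := ((hρ.differentiable (by simp)).differentiableAt (x := x - y)).hasFDerivAt.comp y
      ((hasFDerivAt_id y).const_sub x)
    have e' : HasFDerivAt (fun y => ρ (x - y)) _ y := e
    rw [e'.fderiv]
    simp
  simp only [h6, mul_neg, integral_neg, neg_inj] at h5
  refine (Eq.trans rfl h5).trans ?_
  congr 1 with y
  rw [mul_comm, real_inner_comm]

/-- Averaging `k ↦ ∫ G (y + k) · U y` against `ρ` gives the integral of `G` against the gradient of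
the mollification of `u` by `ρ`, a test function; so every such average vanishes. The function of
`k` is continuous, hence zero, in particular at `k = 0`. No convergence of mollifiers is needed. -/
theorem integral_inner_eq_zero_of_measurable {G U : Space d → Space d} {u : Space d → ℝ}
    (hG : MemLp G 2 volume) (hGm : Measurable G)
    (h : ∀ φ : Space d → ℝ, ContDiff ℝ ∞ φ → HasCompactSupport φ →
      ∫ x, inner ℝ (G x) (gradient φ x) = 0)
    (hu : HasWeakGradient u U) (hcu : HasCompactSupport u) (hU : MemLp U 2 volume)
    (hUm : Measurable U) : ∫ x, inner ℝ (G x) (U x) = 0 := by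
  have hcont := continuous_integral_translate hG hU
  have h0 : ∀ᵐ k : Space d, ∫ y, inner ℝ (G (y + k)) (U y) = 0 := by
    refine ae_eq_zero_of_integral_contDiff_smul_eq_zero hcont.locallyIntegrable fun ρ hρ hc => ?_
    have hint := integrable_weighted_inner hG hU hGm hUm hρ.continuous hc
    have hint' : Integrable (fun p : Space d × Space d =>
        ρ (p.2 - p.1) * inner ℝ (G p.2) (U p.1)) (volume.prod volume) := by
      have hmp := (measurePreserving_prod_add (volume : Measure (Space d)) volume).symm
        (MeasurableEquiv.shearAddRight (Space d))
      have h2 := hmp.integrable_comp_of_integrable hint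
      refine h2.congr (.of_forall fun p => ?_)
      simp [MeasurableEquiv.shearAddRight, sub_eq_neg_add]
    have e1 : ∫ k, ρ k • ∫ y, inner ℝ (G (y + k)) (U y) =
        ∫ y, ∫ k, ρ k * inner ℝ (G (y + k)) (U y) := by
      rw [integral_integral_swap hint]
      congr 1 with k
      rw [integral_const_mul, smul_eq_mul]
    have e2 : ∀ y, ∫ k, ρ k * inner ℝ (G (y + k)) (U y) =
        ∫ x, ρ (x - y) * inner ℝ (G x) (U y) := by
      intro y
      rw [← integral_add_left_eq_self (fun x => ρ (x - y) * inner ℝ (G x) (U y)) y]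
      simp
    have hψ : ContDiff ℝ ∞ (convolution u ρ (ContinuousLinearMap.mul ℝ ℝ) volume) :=
      hc.contDiff_convolution_right _ hu.1 hρ
    have hψc : HasCompactSupport (convolution u ρ (ContinuousLinearMap.mul ℝ ℝ) volume) :=
      hcu.convolution _ hc
    rw [e1, integral_congr_ae (.of_forall e2), integral_integral_swap hint', ← h _ hψ hψc]
    congr 1 with x
    exact (hu.inner_gradient_convolution hρ hc x (G x)).symm
  have h1 := (Continuous.ae_eq_iff_eq volume hcont continuous_const).1 h0
  simpa using congrFun h1 0

theorem integral_inner_eq_zero_of_compactSupport {G U : Space d → Space d} {u : Space d → ℝ}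
    (hG : MemLp G 2 volume)
    (h : ∀ φ : Space d → ℝ, ContDiff ℝ ∞ φ → HasCompactSupport φ →
      ∫ x, inner ℝ (G x) (gradient φ x) = 0)
    (hu : HasWeakGradient u U) (hcu : HasCompactSupport u) (hU : MemLp U 2 volume) :
    ∫ x, inner ℝ (G x) (U x) = 0 := by
  obtain ⟨G', hG'm, hG'⟩ := hG.1
  obtain ⟨U', hU'm, hU'⟩ := hU.1
  rw [← integral_inner_eq_zero_of_measurable (hG.ae_eq hG') hG'm.measurable (fun φ hφ hc => ?_)
    (hu.congr .rfl hU') hcu (hU.ae_eq hU') hU'm.measurable]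
  · refine integral_congr_ae ?_
    filter_upwards [hG', hU'] with x h1 h2
    rw [h1, h2]
  · rw [← h φ hφ hc]
    refine integral_congr_ae ?_
    filter_upwards [hG'] with x h1
    rw [h1]

theorem exists_cutoff (d : ℕ) : ∃ c : ℝ, 0 ≤ c ∧ ∀ R : ℝ, 0 < R → ∃ χ : Space d → ℝ,
    ContDiff ℝ ∞ χ ∧ HasCompactSupport χ ∧ (∀ x, |χ x| ≤ 1) ∧
    (∀ x ∈ Metric.ball (0 : Space d) (R / 2), χ x = 1 ∧ gradient χ x = 0) ∧
    (∀ x ∉ Metric.ball (0 : Space d) R, χ x = 0 ∧ gradient χ x = 0) ∧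
    ∀ x, ‖gradient χ x‖ ≤ c / R := by
  let b : ContDiffBump (0 : Space d) := ⟨1 / 2, 3 / 4, by norm_num, by norm_num⟩
  have hb : ContDiff ℝ ∞ b := b.contDiff
  obtain ⟨c, hc⟩ := (b.hasCompactSupport.fderiv ℝ).exists_bound_of_continuous
    (hb.continuous_fderiv (by simp))
  refine ⟨c, (norm_nonneg _).trans (hc 0), fun R hR => ?_⟩
  have hRi : 0 < R⁻¹ := inv_pos.2 hR
  have hsm : ContDiff ℝ ∞ fun x : Space d => b (R⁻¹ • x) :=
    hb.comp (contDiff_id.const_smul R⁻¹)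
  have hts : tsupport (fun x : Space d => b (R⁻¹ • x)) ⊆ Metric.closedBall 0 (3 / 4 * R) := by
    refine closure_minimal (fun x hx => ?_) Metric.isClosed_closedBall
    have h1 : R⁻¹ • x ∈ Function.support b := hx
    rw [b.support_eq, mem_ball_zero_iff, norm_smul, norm_inv, Real.norm_of_nonneg hR.le,
      inv_mul_lt_iff₀ hR] at h1
    rw [mem_closedBall_zero_iff]
    change ‖x‖ < R * (3 / 4) at h1
    linarith
  refine ⟨fun x => b (R⁻¹ • x), hsm, (isCompact_closedBall _ _).of_isClosed_subset
    (isClosed_tsupport _) hts, fun x => ?_, fun x hx => ?_, fun x hx => ?_, fun x => ?_⟩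
  · rw [abs_of_nonneg b.nonneg]
    exact b.le_one
  · have h1 : ∀ y ∈ Metric.ball (0 : Space d) (R / 2), b (R⁻¹ • y) = 1 := by
      intro y hy
      refine b.one_of_mem_closedBall ?_
      rw [mem_ball_zero_iff] at hy
      rw [mem_closedBall_zero_iff, norm_smul, norm_inv, Real.norm_of_nonneg hR.le,
        inv_mul_le_iff₀ hR]
      change ‖y‖ ≤ R * (1 / 2)
      linarith
    refine ⟨h1 x hx, ?_⟩
    have h2 : (fun x : Space d => b (R⁻¹ • x)) =ᶠ[𝓝 x] fun _ => 1 := by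
      filter_upwards [Metric.isOpen_ball.mem_nhds hx] with y hy using h1 y hy
    rw [h2.gradient_eq, gradient_fun_const]
  · have h1 : x ∉ tsupport (fun x : Space d => b (R⁻¹ • x)) := by
      intro h
      have := hts h
      rw [mem_closedBall_zero_iff] at this
      rw [mem_ball_zero_iff] at hx
      linarith
    refine ⟨image_eq_zero_of_notMem_tsupport (f := fun x : Space d => b (R⁻¹ • x)) h1, ?_⟩
    rw [notMem_tsupport_iff_eventuallyEq] at h1
    rw [h1.gradient_eq]
    exact gradient_fun_const x (0 : ℝ)
  · have h1 : fderiv ℝ (fun x : Space d => b (R⁻¹ • x)) x = R⁻¹ • fderiv ℝ b (R⁻¹ • x) :=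
      fderiv_comp_smul _
    rw [gradient, LinearIsometryEquiv.norm_map, h1, norm_smul, norm_inv, Real.norm_of_nonneg hR.le,
      inv_mul_eq_div]
    gcongr
    exact hc _

/-- Truncation of an `H¹_loc` function to a ball. -/
theorem exists_truncation (d : ℕ) : ∃ c : ℝ, 0 ≤ c ∧ ∀ (v : Space d → ℝ) (R : ℝ), MemH1Loc v →
    0 < R → ∃ (z : Space d → ℝ) (Z : Space d → Space d), HasCompactSupport z ∧ MemL2Loc z ∧
      HasWeakGradient z Z ∧ MemLp Z 2 volume ∧
      (∀ x ∈ Metric.ball (0 : Space d) (R / 2), Z x = weakGradient v x) ∧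
      (∀ x ∉ Metric.ball (0 : Space d) R, Z x = 0) ∧
      eLpNorm Z 2 volume ≤ ENNReal.ofReal c * ballNorm R (weakGradient v) := by
  obtain ⟨c₁, hc₁, hcut⟩ := exists_cutoff d
  obtain ⟨c₂, hc₂, hpoin⟩ := exists_ballNorm_sub_average_le d
  refine ⟨1 + c₁ * c₂, by positivity, fun v R hv hR => ?_⟩
  obtain ⟨χ, hχ, hχc, hχ1, hχin, hχout, hχg⟩ := hcut R hR
  -- The cutoff multiplies `v - m`, not `v`: by the Poincaré inequality the term `(v - m) ∇χ` costs
  -- `(c₁ / R) (c₂ R)`, a factor free of `R`.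
  set m := ⨍ y in Metric.ball 0 R, v y
  have hvm : HasWeakGradient (fun x => v x - m) (weakGradient v) := by
    simpa using hv.hasWeakGradient.sub (hasWeakGradient_const m)
  have hvm2 : MemL2Loc fun x => v x - m := hv.1.sub continuous_const.memL2Loc
  have hG2 := hv.memL2Loc_weakGradient
  set Z : Space d → Space d := fun x => χ x • weakGradient v x + (v x - m) • gradient χ x with hZ
  have hZout : ∀ x ∉ Metric.ball (0 : Space d) R, Z x = 0 := fun x hx => by
    simp [hZ, (hχout x hx).1, (hχout x hx).2]
  have hind : (Metric.ball (0 : Space d) R).indicator Z = Z :=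
    indicator_eq_self.2 fun x hx => by
      by_contra h
      exact hx (hZout x h)
  have hm1 : AEStronglyMeasurable (fun x => χ x • weakGradient v x) volume :=
    hχ.continuous.aestronglyMeasurable.smul hG2.aestronglyMeasurable
  have hm2 : AEStronglyMeasurable (fun x => (v x - m) • gradient χ x) volume :=
    hvm2.aestronglyMeasurable.smul (continuous_gradient hχ).aestronglyMeasurable
  have hbound : eLpNorm Z 2 volume ≤
      ENNReal.ofReal (1 + c₁ * c₂) * ballNorm R (weakGradient v) := by
    rw [← hind, eLpNorm_indicator_eq_eLpNorm_restrict Metric.isOpen_ball.measurableSet]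
    refine (eLpNorm_add_le hm1.restrict hm2.restrict one_le_two).trans ?_
    rw [ENNReal.ofReal_add zero_le_one (by positivity), ENNReal.ofReal_one, add_mul, one_mul]
    refine add_le_add ?_ ?_
    · refine eLpNorm_mono fun x => ?_
      rw [norm_smul]
      exact mul_le_of_le_one_left (norm_nonneg _) (hχ1 x)
    · have h1 : eLpNorm (fun x => (v x - m) • gradient χ x) 2
          (volume.restrict (Metric.ball 0 R)) ≤ ENNReal.ofReal (c₁ / R) *
            ballNorm R (fun x => v x - m) := by
        refine eLpNorm_le_mul_eLpNorm_of_ae_le_mul (.of_forall fun x => ?_) 2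
        rw [norm_smul, mul_comm]
        gcongr
        exact hχg x
      refine h1.trans ((mul_le_mul_right (hpoin v R hv hR) _).trans_eq ?_)
      rw [← mul_assoc, ← ENNReal.ofReal_mul (by positivity)]
      congr 2
      field_simp
  refine ⟨fun x => χ x * (v x - m), Z, hχc.mul_right, ?_, hvm.smooth_mul hχ, ⟨hm1.add hm2, ?_⟩,
    fun x hx => ?_, hZout, hbound⟩
  · intro K hK
    refine (hvm2 K hK).of_le (hχ.continuous.aestronglyMeasurable.mul
      (hvm2 K hK).1) (.of_forall fun x => ?_)
    rw [norm_mul]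
    exact mul_le_of_le_one_left (norm_nonneg _) (hχ1 x)
  · exact hbound.trans_lt (ENNReal.mul_lt_top ENNReal.ofReal_lt_top (hG2.memLp_ball 0 R).2)
  · simp [hZ, (hχin x hx).1, (hχin x hx).2]

theorem integral_norm_sq_eq {f : Space d → Space d} (hf : MemLp f 2 volume) :
    ∫ x, ‖f x‖ ^ 2 = (eLpNorm f 2 volume).toReal ^ 2 := by
  rw [← ENNReal.toReal_pow, eLpNorm_two_sq, ← integral_toReal]
  · simp
  · exact hf.1.enorm.pow_const 2
  · have := hf.2
    refine ae_lt_top' (hf.1.enorm.pow_const 2) ?_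
    rw [← eLpNorm_two_sq]
    exact ENNReal.pow_ne_top this.ne

/-- A square integrable gradient orthogonal to the gradients of all test functions vanishes. -/
theorem HasWeakGradient.ae_eq_zero {r : Space d → ℝ} {G : Space d → Space d}
    (hr : HasWeakGradient r G) (hr2 : MemL2Loc r) (hG : MemLp G 2 volume)
    (h : ∀ φ : Space d → ℝ, ContDiff ℝ ∞ φ → HasCompactSupport φ →
      ∫ x, inner ℝ (G x) (gradient φ x) = 0) : G =ᵐ[volume] 0 := by
  obtain ⟨c, hc, htr⟩ := exists_truncation d
  have hH1 : MemH1Loc r := hr.memH1Loc hr2 hG.memL2Loc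
  set E := ∫ x, ‖G x‖ ^ 2 with hE
  have hG2 := (memLp_two_iff_integrable_sq_norm hG.1).1 hG
  -- Any positive `δ` with `δ c² ≤ 1` serves; adding `1` covers the case `c = 0`.
  set δ : ℝ := 1 / (c ^ 2 + 1) with hδ
  have hδ0 : 0 < δ := by positivity
  set b : ℕ → Set (Space d) := fun n => Metric.ball 0 ((n + 1 : ℝ) / 2)
  -- `G` is orthogonal to the gradient `Z` of the truncation of `r`, and `Z = G` on the half ball,
  -- so the energy there equals minus the integral of `G · Z` outside. Young's inequality with
  -- weight `δ` bounds this by the tail energy of `G` and the total energy of `Z`.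
  have key : ∀ n : ℕ, ∫ x in b n, ‖G x‖ ^ 2 ≤
      (1 / (2 * δ)) * (E - ∫ x in b n, ‖G x‖ ^ 2) + δ / 2 * (c ^ 2 * E) := by
    intro n
    obtain ⟨z, Z, hzc, -, hzZ, hZ2, hZin, -, hZn⟩ := htr r (n + 1) hH1 (by positivity)
    have hbm : MeasurableSet (b n) := Metric.isOpen_ball.measurableSet
    have h0 := integral_inner_eq_zero_of_compactSupport hG h hzZ hzc hZ2
    have hi := hG.integrable_inner_two hZ2
    have hZi := (memLp_two_iff_integrable_sq_norm hZ2.1).1 hZ2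
    rw [← integral_add_compl hbm hi] at h0
    have h1 : ∫ x in b n, inner ℝ (G x) (Z x) = ∫ x in b n, ‖G x‖ ^ 2 := by
      refine integral_congr_ae ?_
      filter_upwards [ae_restrict_mem hbm, ae_restrict_of_ae hr.weakGradient_ae_eq] with x hx hxw
      rw [hZin x hx, hxw, real_inner_self_eq_norm_sq]
    have h2 : -∫ x in (b n)ᶜ, inner ℝ (G x) (Z x) ≤
        ∫ x in (b n)ᶜ, (1 / (2 * δ) * ‖G x‖ ^ 2 + δ / 2 * ‖Z x‖ ^ 2) := by
      rw [← integral_neg]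
      refine integral_mono hi.integrableOn.neg
        ((hG2.integrableOn.const_mul _).add (hZi.integrableOn.const_mul _)) fun x => ?_
      have e1 := neg_le_of_abs_le (abs_real_inner_le_norm (G x) (Z x))
      have e2 : ‖G x‖ * ‖Z x‖ ≤ 1 / (2 * δ) * ‖G x‖ ^ 2 + δ / 2 * ‖Z x‖ ^ 2 := by
        have := sq_nonneg (‖G x‖ - δ * ‖Z x‖)
        have e3 : 1 / (2 * δ) * ‖G x‖ ^ 2 + δ / 2 * ‖Z x‖ ^ 2 - ‖G x‖ * ‖Z x‖ =
            (‖G x‖ - δ * ‖Z x‖) ^ 2 / (2 * δ) := by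
          field_simp
          ring
        have : 0 ≤ (‖G x‖ - δ * ‖Z x‖) ^ 2 / (2 * δ) := by positivity
        linarith
      change -inner ℝ (G x) (Z x) ≤ _
      linarith
    rw [integral_add (hG2.integrableOn.const_mul _) (hZi.integrableOn.const_mul _),
      integral_const_mul, integral_const_mul] at h2
    have h3 : ∫ x in (b n)ᶜ, ‖G x‖ ^ 2 = E - ∫ x in b n, ‖G x‖ ^ 2 := by
      rw [hE, ← integral_add_compl hbm hG2]
      ring
    have h4 : ∫ x in (b n)ᶜ, ‖Z x‖ ^ 2 ≤ c ^ 2 * E := by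
      refine (setIntegral_le_integral hZi (.of_forall fun x => by positivity)).trans ?_
      rw [integral_norm_sq_eq hZ2, hE, integral_norm_sq_eq hG, ← mul_pow]
      have h5 : eLpNorm Z 2 volume ≤ ENNReal.ofReal c * eLpNorm G 2 volume := by
        refine hZn.trans (mul_le_mul_right ?_ _)
        rw [ballNorm_congr hr.weakGradient_ae_eq]
        exact eLpNorm_mono_measure _ Measure.restrict_le_self
      have h6 := ENNReal.toReal_mono (ENNReal.mul_ne_top ENNReal.ofReal_ne_top hG.2.ne) h5
      rw [ENNReal.toReal_mul, ENNReal.toReal_ofReal hc] at h6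
      gcongr
    have h7 : δ / 2 * ∫ x in (b n)ᶜ, ‖Z x‖ ^ 2 ≤ δ / 2 * (c ^ 2 * E) := by gcongr
    rw [h3] at h2
    linarith
  have hlim : Tendsto (fun n => ∫ x in b n, ‖G x‖ ^ 2) atTop (𝓝 E) := by
    have hU : ⋃ n, b n = univ := by
      refine eq_univ_of_forall fun x => ?_
      obtain ⟨n, hn⟩ := exists_nat_gt (2 * ‖x‖)
      refine mem_iUnion.2 ⟨n, ?_⟩
      rw [mem_ball_zero_iff]
      linarith
    have := tendsto_setIntegral_of_monotone (s := b) (f := fun x => ‖G x‖ ^ 2) (μ := volume)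
      (fun n => Metric.isOpen_ball.measurableSet) (fun m n hmn => Metric.ball_subset_ball (by
        have : (m : ℝ) ≤ n := by exact_mod_cast hmn
        linarith)) hG2.integrableOn
    rwa [hU, setIntegral_univ] at this
  have hE0 : 0 ≤ E := integral_nonneg fun x => by positivity
  -- The tail energy disappears in the limit, leaving `E ≤ (δ / 2) c² E ≤ E / 2`.
  have hle := le_of_tendsto_of_tendsto' hlim
    (((hlim.const_sub E).const_mul (1 / (2 * δ))).add_const (δ / 2 * (c ^ 2 * E))) key
  have hδc : δ * c ^ 2 ≤ 1 := by
    rw [hδ, one_div, inv_mul_le_iff₀ (by positivity)]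
    linarith
  have hE' : E = 0 := by nlinarith
  have h8 := (integral_eq_zero_iff_of_nonneg (fun x => by positivity) hG2).1 (hE.symm.trans hE')
  filter_upwards [h8] with x hx
  simpa using hx

end Density

/-! ### Square integrable fields and spaces of gradients -/

section FieldSpaces

variable {d : ℕ}

/-- The Hilbert space of square integrable vector fields. -/
abbrev L2Field (d : ℕ) : Type := Lp (Space d) 2 (volume : Measure (Space d))

theorem L2Field.inner_eq (F G : L2Field d) : inner ℝ F G = ∫ x, inner ℝ (F x) (G x) :=
  L2.inner_def F G

section Operators

variable {A C : Space d → Matrix (Fin d) (Fin d) ℝ} {c c' : ℝ}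

theorem IsBoundedField.memLp_volume (hA : IsBoundedField A c) {f : Space d → Space d}
    (hf : MemLp f 2 volume) : MemLp (fun x => act (A x) (f x)) 2 volume := by
  have := hA.memLp (S := univ) (by simpa using hf)
  simpa using this

/-- The multiplication operator by a bounded tensor field. -/
noncomputable def IsBoundedField.op (hA : IsBoundedField A c) : L2Field d →L[ℝ] L2Field d :=
  LinearMap.mkContinuous
    { toFun := fun F => (hA.memLp_volume (Lp.memLp F)).toLp
      map_add' := fun F G => by
        rw [← MemLp.toLp_add]
        refine MemLp.toLp_congr _ _ ?_
        filter_upwards [Lp.coeFn_add F G] with x hx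
        change act (A x) ((F + G : L2Field d) x) = act (A x) (F x) + act (A x) (G x)
        rw [hx]
        exact map_add (Matrix.toEuclideanLin (A x)) (F x) (G x)
      map_smul' := fun s F => by
        rw [RingHom.id_apply, ← MemLp.toLp_const_smul]
        refine MemLp.toLp_congr _ _ ?_
        filter_upwards [Lp.coeFn_smul s F] with x hx
        change act (A x) ((s • F : L2Field d) x) = s • act (A x) (F x)
        rw [hx]
        exact map_smul (Matrix.toEuclideanLin (A x)) s (F x) } c fun F => by
    refine Lp.norm_le_mul_norm_of_ae_le_mul ?_
    filter_upwards [hA.bound, (hA.memLp_volume (Lp.memLp F)).coeFn_toLp] with x h1 h2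
    rw [LinearMap.coe_mk, AddHom.coe_mk, h2]
    exact h1 _

theorem IsBoundedField.coeFn_op (hA : IsBoundedField A c) (F : L2Field d) :
    hA.op F =ᵐ[volume] fun x => act (A x) (F x) := (hA.memLp_volume (Lp.memLp F)).coeFn_toLp

theorem IsBoundedField.inner_op (hA : IsBoundedField A c) (F G : L2Field d) :
    inner ℝ (hA.op F) G = ∫ x, inner ℝ (act (A x) (F x)) (G x) := by
  rw [L2Field.inner_eq]
  refine integral_congr_ae ?_
  filter_upwards [hA.coeFn_op F] with x hx
  rw [hx]

theorem IsBoundedField.inner_op_transpose (hA : IsBoundedField A c) (F G : L2Field d) :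
    inner ℝ (hA.transpose.op F) G = inner ℝ F (hA.op G) := by
  rw [IsBoundedField.inner_op, real_inner_comm, IsBoundedField.inner_op]
  congr 1 with x
  rw [inner_act_transpose, real_inner_comm]

theorem IsBoundedField.op_add_const_smul (hA : IsBoundedField A c) (hC : IsBoundedField C c')
    (s : ℝ) : (hA.add (hC.const_smul s)).op = hA.op + s • hC.op := by
  ext1 F
  refine Lp.ext ?_
  rw [add_apply, smul_apply]
  filter_upwards [(hA.add (hC.const_smul s)).coeFn_op F, hA.coeFn_op F, hC.coeFn_op F,
    Lp.coeFn_add (hA.op F) (s • hC.op F), Lp.coeFn_smul s (hC.op F)] with x h1 h2 h3 h4 h5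
  rw [h1, h4, Pi.add_apply, h5, Pi.smul_apply, h2, h3, act_add, act_smul]

theorem IsBoundedField.isCoerciveOn_op (hA : IsBoundedField A c) {α : ℝ}
    (hα : ∀ᵐ x, ∀ ξ : Space d, α * ‖ξ‖ ^ 2 ≤ inner ℝ (act (A x) ξ) ξ)
    (K : Submodule ℝ (L2Field d)) : IsCoerciveOn K hA.op α := by
  intro F _
  rw [hA.inner_op, ← real_inner_self_eq_norm_sq, L2Field.inner_eq, ← integral_const_mul]
  have h1 := (Lp.memLp F).integrable_inner_two (Lp.memLp F)
  refine integral_mono_ae (h1.const_mul α)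
    ((hA.memLp_volume (Lp.memLp F)).integrable_inner_two (Lp.memLp F)) ?_
  filter_upwards [hα] with x hx
  simp only [real_inner_self_eq_norm_sq]
  exact hx _

end Operators

theorem MemL2Loc.memLp_indicator_cube {f : Space d → Space d} (hf : MemL2Loc f) (N : ℕ) :
    MemLp ((cube N).indicator f) 2 volume :=
  (memLp_indicator_iff_restrict (measurableSet_cube N)).2 (hf _ (isCompact_cube N))

/-- The field `1_{I_N} f`. -/
noncomputable def cubeField (N : ℕ) (f : Space d → Space d) (hf : MemL2Loc f) : L2Field d :=
  (hf.memLp_indicator_cube N).toLp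

theorem coeFn_cubeField (N : ℕ) {f : Space d → Space d} (hf : MemL2Loc f) :
    cubeField N f hf =ᵐ[volume] (cube N).indicator f := MemLp.coeFn_toLp _

theorem memL2Loc_const (ξ : Space d) : MemL2Loc fun _ : Space d => ξ :=
  continuous_const.memL2Loc

/-- The gradients of `(Nℤ)^d`-periodic functions, restricted to the cell `I_N`. -/
def periodicGradients (d N : ℕ) : Submodule ℝ (L2Field d) where
  carrier := {F | ∃ v, MemH1Loc v ∧ IsPeriodicField N v ∧
    F =ᵐ[volume] (cube N).indicator (weakGradient v)}
  add_mem' := by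
    rintro F G ⟨u, hu, hup, hF⟩ ⟨v, hv, hvp, hG⟩
    refine ⟨fun x => u x + v x, hu.add hv, fun k => ?_, ?_⟩
    · filter_upwards [hup k, hvp k] with x h1 h2
      rw [h1, h2]
    · filter_upwards [hF, hG, Lp.coeFn_add F G,
        (hu.hasWeakGradient.add hv.hasWeakGradient).weakGradient_ae_eq] with x h1 h2 h3 h4
      by_cases hx : x ∈ cube N <;> simp_all
  zero_mem' := by
    refine ⟨fun _ => 0, (hasWeakGradient_const 0).memH1Loc continuous_const.memL2Loc
      continuous_zero.memL2Loc, fun k => .of_forall fun _ => rfl, ?_⟩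
    filter_upwards [Lp.coeFn_zero (Space d) 2 (volume : Measure (Space d)),
      (hasWeakGradient_const (d := d) 0).weakGradient_ae_eq] with x h1 h2
    by_cases hx : x ∈ cube N <;> simp_all
  smul_mem' := by
    rintro s F ⟨u, hu, hup, hF⟩
    refine ⟨fun x => s * u x, hu.const_smul s, fun k => ?_, ?_⟩
    · filter_upwards [hup k] with x h1
      rw [h1]
    · filter_upwards [hF, Lp.coeFn_smul s F,
        (hu.hasWeakGradient.const_smul s).weakGradient_ae_eq] with x h1 h2 h3
      by_cases hx : x ∈ cube N <;> simp_all

/-- The square integrable gradients. -/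
def squareGradients (d : ℕ) : Submodule ℝ (L2Field d) where
  carrier := {F | ∃ v, MemL2Loc v ∧ HasWeakGradient v F}
  add_mem' := by
    rintro F G ⟨u, hu, hF⟩ ⟨v, hv, hG⟩
    exact ⟨fun x => u x + v x, hu.add hv, (hF.add hG).congr .rfl (Lp.coeFn_add F G).symm⟩
  zero_mem' := ⟨fun _ => 0, continuous_const.memL2Loc,
    (hasWeakGradient_const 0).congr .rfl (Lp.coeFn_zero _ _ _).symm⟩
  smul_mem' := by
    rintro s F ⟨u, hu, hF⟩
    exact ⟨fun x => s * u x, hu.const_smul s, (hF.const_smul s).congr .rfl (Lp.coeFn_smul s F).symm⟩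

/-- The gradients of test functions. -/
def testGradients (d : ℕ) : Submodule ℝ (L2Field d) where
  carrier := {F | ∃ φ : Space d → ℝ, ContDiff ℝ ∞ φ ∧ HasCompactSupport φ ∧
    F =ᵐ[volume] gradient φ}
  add_mem' := by
    rintro F G ⟨u, hu, hcu, hF⟩ ⟨v, hv, hcv, hG⟩
    refine ⟨fun x => u x + v x, hu.add hv, hcu.add hcv, ?_⟩
    filter_upwards [hF, hG, Lp.coeFn_add F G] with x h1 h2 h3
    rw [h3, Pi.add_apply, h1, h2, gradient, gradient, gradient,
      fderiv_fun_add (hu.differentiable (by simp)).differentiableAt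
      (hv.differentiable (by simp)).differentiableAt, map_add]
  zero_mem' := by
    refine ⟨fun _ => 0, contDiff_const, HasCompactSupport.zero, ?_⟩
    filter_upwards [Lp.coeFn_zero (Space d) 2 (volume : Measure (Space d))] with x h1
    rw [h1, gradient_fun_const, Pi.zero_apply]
  smul_mem' := by
    rintro s F ⟨u, hu, hcu, hF⟩
    refine ⟨fun x => s * u x, contDiff_const.mul hu, hcu.mul_left, ?_⟩
    filter_upwards [hF, Lp.coeFn_smul s F] with x h1 h2
    rw [h2, Pi.smul_apply, h1, gradient, gradient,
      fderiv_const_mul (hu.differentiable (by simp)).differentiableAt]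
    simp

theorem memLp_gradient {φ : Space d → ℝ} (hφ : ContDiff ℝ ∞ φ) (hc : HasCompactSupport φ) :
    MemLp (gradient φ) 2 volume := by
  refine (continuous_gradient hφ).memLp_of_hasCompactSupport ?_
  exact (hc.fderiv ℝ).comp_left (map_zero _)

theorem toLp_gradient_mem {φ : Space d → ℝ} (hφ : ContDiff ℝ ∞ φ) (hc : HasCompactSupport φ) :
    (memLp_gradient hφ hc).toLp ∈ testGradients d := ⟨φ, hφ, hc, MemLp.coeFn_toLp _⟩

theorem testGradients_le : testGradients d ≤ squareGradients d := by
  rintro F ⟨φ, hφ, hc, hF⟩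
  exact ⟨φ, hφ.continuous.memL2Loc, (hasWeakGradient_of_contDiff hφ).congr .rfl hF.symm⟩

theorem tendsto_eLpNorm_sub {F : ℕ → L2Field d} {G : L2Field d} (h : Tendsto F atTop (𝓝 G)) :
    Tendsto (fun n => eLpNorm (fun x => F n x - G x) 2 volume) atTop (𝓝 0) := by
  rw [tendsto_iff_edist_tendsto_0] at h
  refine h.congr fun n => ?_
  rw [Lp.edist_def]
  rfl

/-- Limits of gradients in `L²_loc` are gradients. Closedness makes the space complete, as
Lax–Milgram requires. -/
theorem isClosed_squareGradients : IsClosed (squareGradients d : Set (L2Field d)) := by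
  refine IsSeqClosed.isClosed fun F G hF hlim => ?_
  choose v hv hvF using hF
  have hH : ∀ n, MemH1Loc (v n) := fun n => (hvF n).memH1Loc (hv n) (Lp.memLp (F n)).memL2Loc
  have ht : TendstoL2Loc (fun n => weakGradient (v n)) G := by
    intro k
    refine tendsto_of_tendsto_of_tendsto_of_le_of_le tendsto_const_nhds (tendsto_eLpNorm_sub hlim)
      (fun _ => zero_le) fun n => ?_
    have e : (fun x => weakGradient (v n) x - G x) =ᵐ[volume] fun x => F n x - G x := by
      filter_upwards [(hvF n).weakGradient_ae_eq] with x hx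
      rw [hx]
    change ballNorm k (fun x => weakGradient (v n) x - G x) ≤ _
    rw [ballNorm_congr e]
    exact eLpNorm_mono_measure _ Measure.restrict_le_self
  obtain ⟨u, hu, huG, -⟩ := exists_of_tendsto_weakGradient hH (Lp.memLp G).memL2Loc ht
  exact ⟨u, hu, huG⟩

instance : CompleteSpace (squareGradients d) :=
  isClosed_squareGradients.completeSpace_coe

theorem ballNorm_translate_le {F : Type*} [NormedAddCommGroup F] {f : Space d → F}
    (hf : MemL2Loc f) (a : Space d) (R : ℝ) :
    ballNorm R (fun x => f (x + a)) ≤ ballNorm (R + ‖a‖) f := by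
  have hsub : Metric.ball (0 : Space d) R ⊆
      (fun x => x + a) ⁻¹' Metric.ball (0 : Space d) (R + ‖a‖) := by
    intro x hx
    rw [mem_ball_zero_iff] at hx
    rw [mem_preimage, mem_ball_zero_iff]
    exact (norm_add_le x a).trans_lt (by linarith)
  refine (eLpNorm_mono_measure _ (Measure.restrict_mono hsub le_rfl)).trans_eq ?_
  exact eLpNorm_comp_measurePreserving (g := f) hf.aestronglyMeasurable.restrict
    (measurePreserving_restrict_translate a _)

theorem ae_eq_of_ballNorm_sub {F : Type*} [NormedAddCommGroup F] {f g : Space d → F}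
    (hf : MemL2Loc f) (hg : MemL2Loc g) (h : ∀ k : ℕ, ballNorm k (fun x => f x - g x) = 0) :
    f =ᵐ[volume] g := by
  have h1 : ∀ k : ℕ, ∀ᵐ x, x ∈ Metric.ball (0 : Space d) k → f x = g x := by
    intro k
    have h2 := h k
    rw [ballNorm, eLpNorm_eq_zero_iff ((hf.sub hg).memLp_ball 0 k).1 (by norm_num)] at h2
    filter_upwards [(ae_restrict_iff' Metric.isOpen_ball.measurableSet).1 h2] with x hx hxk
    exact sub_eq_zero.1 (hx hxk)
  filter_upwards [ae_all_iff.2 h1] with x hx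
  obtain ⟨k, hk⟩ := exists_nat_gt ‖x‖
  exact hx k (mem_ball_zero_iff.2 hk)

theorem IsPeriodicField.of_tendsto {N : ℕ} {f : ℕ → Space d → ℝ} {u : Space d → ℝ}
    (hf : ∀ n, MemL2Loc (f n)) (hu : MemL2Loc u) (hper : ∀ n, IsPeriodicField N (f n))
    (h : TendstoL2Loc f u) : IsPeriodicField N u := by
  intro k
  refine ae_eq_of_ballNorm_sub (f := fun x => u (x + latticePoint N k)) (hu.translate _) hu
    fun R => ?_
  set a := latticePoint N k
  obtain ⟨R', hR'⟩ := exists_nat_ge (R + ‖a‖)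
  have h1 := (h R').add (h R)
  rw [add_zero] at h1
  refine le_antisymm (ge_of_tendsto' h1 fun n => ?_) zero_le
  have e : (fun x => u (x + a) - u x) =ᵐ[volume]
      fun x => (f n x - u x) - (f n (x + a) - u (x + a)) := by
    filter_upwards [(hper n).ae k] with x hx
    rw [hx]
    ring
  rw [ballNorm_congr e, add_comm]
  have hn := (hf n).sub hu
  refine (ballNorm_sub_le hn (hn.translate a) _).trans (add_le_add le_rfl ?_)
  exact (ballNorm_translate_le hn a _).trans (ballNorm_mono hR' _)

/-- Convergence is given only on the cell, but periodicity spreads it to every ball. The potentials,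
normalized by constants, then converge in `L²_loc` to a periodic function, whose gradient is the
limit on the cell. -/
theorem isClosed_periodicGradients {N : ℕ} (hN : 0 < N) :
    IsClosed (periodicGradients d N : Set (L2Field d)) := by
  refine IsSeqClosed.isClosed fun F G hF hlim => ?_
  choose v hv hper hvF using hF
  have hG2 := fun n => (hv n).memL2Loc_weakGradient
  have hgp := fun n => (hper n).weakGradient (hv n)
  have hcau : CauchyL2Loc fun n => weakGradient (v n) := by
    intro k
    obtain ⟨c, hc, hle⟩ := exists_ballNorm_le (d := d) (F := Space d) hN k
    have h1 := (tendsto_eLpNorm_sub hlim).comp tendsto_fst |>.add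
      ((tendsto_eLpNorm_sub hlim).comp tendsto_snd)
    rw [prod_atTop_atTop_eq] at h1
    have h2 := ENNReal.Tendsto.const_mul (a := c) h1 (.inr hc)
    rw [add_zero, mul_zero] at h2
    refine tendsto_of_tendsto_of_tendsto_of_le_of_le tendsto_const_nhds h2 (fun _ => zero_le)
      fun p => ?_
    refine (hle _ fun l => ?_).trans (mul_le_mul_right ?_ _)
    · filter_upwards [hgp p.1 l, hgp p.2 l] with x h3 h4
      rw [h3, h4]
    · rw [← eLpNorm_indicator_eq_eLpNorm_restrict (measurableSet_cube N)]
      have e : (cube N).indicator (fun x => weakGradient (v p.1) x - weakGradient (v p.2) x)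
          =ᵐ[volume] fun x => (F p.1 x - G x) - (F p.2 x - G x) := by
        filter_upwards [hvF p.1, hvF p.2] with x h3 h4
        rw [h3, h4]
        by_cases hx : x ∈ cube N <;> simp [hx]
      rw [eLpNorm_congr_ae e]
      exact eLpNorm_sub_le ((Lp.aestronglyMeasurable _).sub (Lp.aestronglyMeasurable _))
        ((Lp.aestronglyMeasurable _).sub (Lp.aestronglyMeasurable _)) one_le_two
  obtain ⟨Γ, hΓ, hlimΓ⟩ := hcau.exists_tendsto hG2
  obtain ⟨u, hu, huΓ, hut⟩ := exists_of_tendsto_weakGradient hv hΓ hlimΓ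
  have hup : IsPeriodicField N u := by
    refine .of_tendsto (fun n => (hv n).1.sub continuous_const.memL2Loc) hu (fun n k => ?_) hut
    filter_upwards [hper n k] with x hx
    rw [hx]
  refine ⟨u, huΓ.memH1Loc hu hΓ, hup, ?_⟩
  obtain ⟨R, hR⟩ := (isCompact_cube (d := d) N).isBounded.subset_ball (0 : Space d)
  obtain ⟨k, hk⟩ := exists_nat_ge R
  have h0 : eLpNorm (fun x => G x - (cube N).indicator Γ x) 2 volume = 0 := by
    have h1 := (tendsto_eLpNorm_sub hlim).add (hlimΓ k)
    rw [add_zero] at h1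
    refine le_antisymm (ge_of_tendsto' h1 fun n => ?_) zero_le
    have e : (fun x => G x - (cube N).indicator Γ x) =ᵐ[volume]
        fun x => (cube N).indicator (fun x => weakGradient (v n) x - Γ x) x - (F n x - G x) := by
      filter_upwards [hvF n] with x h3
      rw [h3]
      by_cases hx : x ∈ cube N <;> simp [hx]
    rw [eLpNorm_congr_ae e, add_comm]
    refine (eLpNorm_sub_le (((hG2 n).sub hΓ).memLp_indicator_cube N).1
      ((Lp.aestronglyMeasurable _).sub (Lp.aestronglyMeasurable _)) one_le_two).trans
      (add_le_add ?_ le_rfl)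
    rw [eLpNorm_indicator_eq_eLpNorm_restrict (measurableSet_cube N)]
    exact eLpNorm_mono_measure _ (Measure.restrict_mono
      (hR.trans (Metric.ball_subset_ball hk)) le_rfl)
  rw [eLpNorm_eq_zero_iff (f := fun x => G x - (cube N).indicator Γ x)
    ((Lp.aestronglyMeasurable G).sub (hΓ.memLp_indicator_cube N).1) (by norm_num)] at h0
  filter_upwards [h0, huΓ.weakGradient_ae_eq] with x h1 h2
  rw [sub_eq_zero.1 h1]
  by_cases hx : x ∈ cube N <;> simp [hx, h2]

/-- Project onto the closure of the test gradients: the remainder is a square integrable gradient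
orthogonal to all of them, so it vanishes. -/
theorem squareGradients_le_closure :
    squareGradients d ≤ (testGradients d).topologicalClosure := by
  intro F hF
  set K := (testGradients d).topologicalClosure
  have hKc : IsClosed (K : Set (L2Field d)) := Submodule.isClosed_topologicalClosure _
  have : CompleteSpace K := hKc.completeSpace_coe
  have hK : K ≤ squareGradients d :=
    Submodule.topologicalClosure_minimal _ testGradients_le isClosed_squareGradients
  set P : L2Field d := K.starProjection F
  have hPK : P ∈ K := K.starProjection_apply_mem F
  obtain ⟨r, hr, hrG⟩ := (squareGradients d).sub_mem hF (hK hPK)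
  have h0 : ((F - P : L2Field d) : Space d → Space d) =ᵐ[volume] 0 := by
    refine hrG.ae_eq_zero hr (Lp.memLp _) fun φ hφ hc => ?_
    have h1 : inner ℝ (F - P) ((memLp_gradient hφ hc).toLp) = 0 :=
      Submodule.inner_left_of_mem_orthogonal
        (Submodule.le_topologicalClosure _ (toLp_gradient_mem hφ hc))
        (Submodule.sub_starProjection_mem_orthogonal F)
    rw [L2Field.inner_eq] at h1
    rw [← h1]
    refine integral_congr_ae ?_
    filter_upwards [(memLp_gradient hφ hc).coeFn_toLp] with x hx
    rw [hx]
  have h1 : F - P = 0 := Lp.ext (h0.trans (Lp.coeFn_zero _ _ _).symm)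
  rw [sub_eq_zero.1 h1]
  exact hPK

/-- By density, an equation in the sense of distributions becomes a variational one on all square
integrable gradients. -/
theorem inner_eq_of_testGradients {L L' : L2Field d}
    (h : ∀ V ∈ testGradients d, inner ℝ L V = inner ℝ L' V) :
    ∀ V ∈ squareGradients d, inner ℝ L V = inner ℝ L' V := by
  intro V hV
  have h1 : V ∈ closure (testGradients d : Set (L2Field d)) := squareGradients_le_closure hV
  have hcl : IsClosed {V : L2Field d | (inner ℝ L V : ℝ) = inner ℝ L' V} :=
    isClosed_eq (by fun_prop) (by fun_prop)
  exact closure_minimal (fun V hV => h V hV) hcl h1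

end FieldSpaces

/-! ### Correctors as solutions of coercive problems -/

section Correctors

variable {d N : ℕ} {A C a : Space d → Matrix (Fin d) (Fin d) ℝ} {c c' α M s : ℝ} {i j : Fin d}

instance [NeZero N] : CompleteSpace (periodicGradients d N) :=
  (isClosed_periodicGradients (NeZero.pos N)).completeSpace_coe

/-- The field `1_{I_N} ∇w`. -/
noncomputable def gradField (N : ℕ) {w : Space d → ℝ} (hw : MemH1Loc w) : L2Field d :=
  cubeField N (weakGradient w) hw.memL2Loc_weakGradient

/-- The field `1_{I_N} e_i`. -/
noncomputable def unitField (N : ℕ) (i : Fin d) : L2Field d :=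
  cubeField N (fun _ => unitVec i) (memL2Loc_const _)

theorem gradField_mem {w : Space d → ℝ} (hw : MemH1Loc w) (hper : IsPeriodicField N w) :
    gradField N hw ∈ periodicGradients d N := ⟨w, hw, hper, coeFn_cubeField N _⟩

theorem cubeField_apply {f : Space d → Space d} (hf : MemL2Loc f) :
    ∀ᵐ x, x ∈ cube N → cubeField N f hf x = f x := by
  filter_upwards [coeFn_cubeField N hf] with x hx hxN
  rw [hx, indicator_of_mem hxN]

theorem gradField_add_unitField_apply {w : Space d → ℝ} (hw : MemH1Loc w) :
    ∀ᵐ x, x ∈ cube N → (gradField N hw + unitField N i : L2Field d) x =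
      weakGradient w x + unitVec i := by
  filter_upwards [Lp.coeFn_add (gradField N hw) (unitField N i),
    cubeField_apply (N := N) hw.memL2Loc_weakGradient,
    cubeField_apply (N := N) (memL2Loc_const (unitVec i))] with x h1 h2 h3 hx
  rw [h1, Pi.add_apply]
  exact congrArg₂ _ (h2 hx) (h3 hx)

theorem cube_subset {N N' : ℕ} (hN : N ≤ N') :
    (cube N : Set (Space d)) ⊆ cube N' := by
  intro x hx i
  have h1 := hx i
  have h2 : (N : ℝ) ≤ N' := by exact_mod_cast hN
  exact ⟨by linarith [h1.1], by linarith [h1.2]⟩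

theorem gradField_add_unitField_cube_one [NeZero N] {w : Space d → ℝ} (hw : MemH1Loc w) :
    ∀ᵐ x, x ∈ cube 1 → (gradField N hw + unitField N i : L2Field d) x =
      (gradField 1 hw + unitField 1 i : L2Field d) x := by
  filter_upwards [gradField_add_unitField_apply (N := N) (i := i) hw,
    gradField_add_unitField_apply (N := 1) (i := i) hw] with x h1 h2 hx
  rw [h1 (cube_subset (Nat.one_le_iff_ne_zero.2 (NeZero.ne N)) hx), h2 hx]

theorem IsBoundedField.inner_op_cube (ha : IsBoundedField a c) {F G : L2Field d}
    {f g : Space d → Space d} (hF : ∀ᵐ x, x ∈ cube N → F x = f x)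
    (hG : G =ᵐ[volume] (cube N).indicator g) :
    inner ℝ (ha.op F) G = ∫ x in cube N, inner ℝ (act (a x) (f x)) (g x) := by
  rw [ha.inner_op, ← integral_indicator (measurableSet_cube N)]
  refine integral_congr_ae ?_
  filter_upwards [hF, hG] with x h1 h2
  by_cases hx : x ∈ cube N
  · rw [h2, indicator_of_mem hx, indicator_of_mem hx, h1 hx]
  · rw [h2, indicator_of_notMem hx, indicator_of_notMem hx, inner_zero_right]

/-- This carries the variational formulation over to the Hilbert space of square integrable fields,
with fields extended by zero outside the cell. -/
theorem isPeriodicCorrector_iff (ha : IsBoundedField a c) {w : Space d → ℝ} (hw : MemH1Loc w)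
    (hper : IsPeriodicField N w) : IsPeriodicCorrector N a i w ↔
      ∀ V ∈ periodicGradients d N, inner ℝ (ha.op (gradField N hw + unitField N i)) V = 0 := by
  constructor
  · rintro h V ⟨v, hv, hvper, hV⟩
    rw [ha.inner_op_cube (gradField_add_unitField_apply hw) hV]
    exact h.2.2 v hv hvper
  · refine fun h => ⟨hw, hper, fun v hv hvper => ?_⟩
    rw [← h _ (gradField_mem hv hvper)]
    exact (ha.inner_op_cube (gradField_add_unitField_apply hw) (coeFn_cubeField N _)).symm

theorem IsPeriodicCorrector.gradField_eq [NeZero N] (ha : IsBoundedField a c) (hα : 0 < α)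
    (hc : IsCoerciveOn (periodicGradients d N) ha.op α) {w : Space d → ℝ}
    (hw : IsPeriodicCorrector N a i w) :
    gradField N hw.1 = solveOn (periodicGradients d N) ha.op (ha.op (unitField N i)) := by
  refine hc.eq_solveOn hα (gradField_mem hw.1 hw.2.1) fun V hV => ?_
  have h := (isPeriodicCorrector_iff ha hw.1 hw.2.1).1 hw V hV
  rw [map_add, inner_add_left] at h
  linarith

theorem IsPeriodicCorrector.weakGradient_ae_eq [NeZero N] (ha : IsBoundedField a c) (hα : 0 < α)
    (hc : IsCoerciveOn (periodicGradients d N) ha.op α) {w w' : Space d → ℝ}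
    (hw : IsPeriodicCorrector N a i w) (hw' : IsPeriodicCorrector N a i w') :
    weakGradient w' =ᵐ[volume] weakGradient w := by
  have h1 := (hw'.gradField_eq ha hα hc).trans (hw.gradField_eq ha hα hc).symm
  refine (hw'.2.1.weakGradient hw'.1).ae_eq_of_cube (NeZero.pos N) (hw.2.1.weakGradient hw.1) ?_
  refine (ae_restrict_iff' (measurableSet_cube N)).2 ?_
  filter_upwards [cubeField_apply (N := N) hw.1.memL2Loc_weakGradient,
    cubeField_apply (N := N) hw'.1.memL2Loc_weakGradient] with x h2 h3 hx
  rw [← h2 hx, ← h3 hx]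
  exact congrArg (fun F : L2Field d => F x) h1

theorem exists_isPeriodicCorrector [NeZero N] (ha : IsBoundedField a c) (hα : 0 < α)
    (hc : IsCoerciveOn (periodicGradients d N) ha.op α) (i : Fin d) :
    ∃ w, IsPeriodicCorrector N a i w ∧
      ∀ w', IsPeriodicCorrector N a i w' → weakGradient w' =ᵐ[volume] weakGradient w := by
  obtain ⟨w, hw, hper, hW⟩ : solveOn (periodicGradients d N) ha.op (ha.op (unitField N i)) ∈
    periodicGradients d N := solveOn_mem
  have hcor : IsPeriodicCorrector N a i w := by
    rw [isPeriodicCorrector_iff ha hw hper]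
    intro V hV
    have h1 : gradField N hw = solveOn (periodicGradients d N) ha.op (ha.op (unitField N i)) :=
      Lp.ext ((coeFn_cubeField N _).trans hW.symm)
    rw [h1, map_add, inner_add_left, hc.inner_solveOn hα hV]
    ring
  exact ⟨w, hcor, fun w' hw' => hcor.weakGradient_ae_eq ha hα hc hw'⟩

/-- Bounded periodic tensor fields `A`, `C` such that `A + s C` is coercive for `|s| ≤ M`. -/
structure IsDefectFamily (A C : Space d → Matrix (Fin d) (Fin d) ℝ) (α M c c' : ℝ) : Prop where
  alpha_pos : 0 < α
  M_pos : 0 < M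
  bounded : IsBoundedField A c
  periodic : IsPeriodicField 1 A
  bounded_perturbation : IsBoundedField C c'
  nonneg : 0 ≤ c'
  coercive : ∀ᵐ x, ∀ ξ : Space d, ∀ s ∈ Icc (-M) M,
    α * ‖ξ‖ ^ 2 ≤ inner ℝ (act (A x + s • C x) ξ) ξ

/-! ### Operators with one defect, their correctors and the supercell flux -/

namespace IsDefectFamily

variable (h : IsDefectFamily A C α M c c')
include h

theorem bounded_indicator : IsBoundedField ((cube 1).indicator C) c' :=
  h.bounded_perturbation.indicator h.nonneg (measurableSet_cube 1)

/-- Multiplication by `1_Q C`. -/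
noncomputable def defectOp : L2Field d →L[ℝ] L2Field d := h.bounded_indicator.op

/-- Multiplication by `A + s 1_Q C`. -/
noncomputable def opAt (s : ℝ) : L2Field d →L[ℝ] L2Field d := h.bounded.op + s • h.defectOp

theorem bounded_defectField (s : ℝ) : IsBoundedField (defectField A C s) (c + |s| * c') :=
  h.bounded.add (h.bounded_indicator.const_smul s)

theorem op_defectField (s : ℝ) : (h.bounded_defectField s).op = h.opAt s :=
  h.bounded.op_add_const_smul h.bounded_indicator s

theorem coercive_defectField : ∀ᵐ x, ∀ ξ : Space d, ∀ s ∈ Icc (-M) M,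
    α * ‖ξ‖ ^ 2 ≤ inner ℝ (act (defectField A C s x) ξ) ξ := by
  filter_upwards [h.coercive] with x hx ξ s hs
  by_cases hxQ : x ∈ cube 1
  · rw [defectField, indicator_of_mem hxQ]
    exact hx ξ s hs
  · rw [defectField, indicator_of_notMem hxQ]
    simpa using hx ξ 0 ⟨by linarith [h.M_pos], h.M_pos.le⟩

theorem isCoerciveOn_opAt (hs : s ∈ Icc (-M) M) (K : Submodule ℝ (L2Field d)) :
    IsCoerciveOn K (h.opAt s) α := by
  rw [← h.op_defectField]
  refine (h.bounded_defectField s).isCoerciveOn_op ?_ K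
  filter_upwards [h.coercive_defectField] with x hx ξ using hx ξ s hs

theorem isCoerciveOn_bounded (K : Submodule ℝ (L2Field d)) : IsCoerciveOn K h.bounded.op α := by
  refine h.bounded.isCoerciveOn_op ?_ K
  filter_upwards [h.coercive] with x hx ξ
  simpa using hx ξ 0 ⟨by linarith [h.M_pos], h.M_pos.le⟩

theorem isCoerciveOn_transpose (K : Submodule ℝ (L2Field d)) :
    IsCoerciveOn K h.bounded.transpose.op α := by
  intro F hF
  rw [h.bounded.inner_op_transpose, real_inner_comm]
  exact h.isCoerciveOn_bounded K F hF

/-- The defect lives in `Q`, so restrictions of one field to different supercells yield the same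
source. -/
theorem defectOp_congr {F G : L2Field d} (hFG : ∀ᵐ x, x ∈ cube 1 → F x = G x) :
    h.defectOp F = h.defectOp G := by
  refine Lp.ext ?_
  filter_upwards [h.bounded_indicator.coeFn_op F, h.bounded_indicator.coeFn_op G, hFG]
    with x h1 h2 h3
  rw [defectOp, h1, h2]
  by_cases hx : x ∈ cube 1
  · rw [h3 hx]
  · rw [indicator_of_notMem hx, act_zero, act_zero]

theorem inner_defectOp {F G : L2Field d} {f g : Space d → Space d}
    (hF : ∀ᵐ x, x ∈ cube 1 → F x = f x) (hG : ∀ᵐ x, x ∈ cube 1 → G x = g x) :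
    inner ℝ (h.defectOp F) G = ∫ x in cube 1, inner ℝ (act (C x) (f x)) (g x) := by
  rw [defectOp, IsBoundedField.inner_op, ← integral_indicator (measurableSet_cube 1)]
  refine integral_congr_ae ?_
  filter_upwards [hF, hG] with x h1 h2
  by_cases hx : x ∈ cube 1
  · rw [indicator_of_mem hx, indicator_of_mem hx, h1 hx, h2 hx]
  · rw [indicator_of_notMem hx, indicator_of_notMem hx, act_zero, inner_zero_left]

theorem inner_defectOp_congr {F G G' : L2Field d} (hG : ∀ᵐ x, x ∈ cube 1 → G x = G' x) :
    inner ℝ (h.defectOp F) G = inner ℝ (h.defectOp F) G' := by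
  rw [h.inner_defectOp (.of_forall fun _ _ => rfl) hG,
    h.inner_defectOp (.of_forall fun _ _ => rfl) (.of_forall fun _ _ => rfl)]

/-- The source `1_Q C (∇w₀ + e_i)`. -/
noncomputable def source {w₀ : Space d → ℝ} (hw₀ : MemH1Loc w₀) (i : Fin d) : L2Field d :=
  h.defectOp (gradField 1 hw₀ + unitField 1 i)

theorem cellForm_eq {v : Space d → ℝ} (hv : MemH1Loc v) {F : L2Field d} {f : Space d → Space d}
    (hF : ∀ᵐ x, x ∈ cube 1 → F x = f x) :
    cellForm C f v j = inner ℝ (h.defectOp F) (gradField 1 hv + unitField 1 j) := by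
  rw [h.inner_defectOp hF (gradField_add_unitField_apply hv), cellForm]
  simp only [add_comm]

/-- The equation against test functions extends by density to all square integrable gradients, where
coercivity leaves a single solution; the factor `s` of the source comes out by linearity. -/
theorem isDefectCorrector_iff {w₀ q : Space d → ℝ} (hw₀ : MemH1Loc w₀) (hq : MemH1Loc q)
    (hq2 : MemLp (weakGradient q) 2 volume) (hs : s ∈ Icc (-M) M) :
    IsDefectCorrector A C s i w₀ q ↔
      hq2.toLp = s • solveOn (squareGradients d) (h.opAt s) (h.source hw₀ i) := by
  have hQ : hq2.toLp ∈ squareGradients d :=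
    ⟨q, hq.1, hq.hasWeakGradient.congr .rfl hq2.coeFn_toLp.symm⟩
  have hc := h.isCoerciveOn_opAt hs (squareGradients d)
  have e1 : ∀ {V : L2Field d} {φ : Space d → ℝ}, V =ᵐ[volume] gradient φ →
      ∫ x, inner ℝ (act (defectField A C s x) (weakGradient q x)) (gradient φ x) =
        inner ℝ (h.opAt s hq2.toLp) V := by
    intro V φ hV
    rw [← h.op_defectField, IsBoundedField.inner_op]
    refine integral_congr_ae ?_
    filter_upwards [hV, hq2.coeFn_toLp] with x h1 h2
    rw [h1, h2]
  have e2 : ∀ {V : L2Field d} {φ : Space d → ℝ}, V =ᵐ[volume] gradient φ →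
      ∫ x in cube 1, s * inner ℝ (act (C x) (weakGradient w₀ x + unitVec i)) (gradient φ x) =
        s * inner ℝ (h.source hw₀ i) V := by
    intro V φ hV
    rw [integral_const_mul, source, h.inner_defectOp (gradField_add_unitField_apply hw₀)
      (hV.mono fun x hx _ => hx)]
  constructor
  · rintro ⟨-, -, heq⟩
    have e3 : ∀ V ∈ testGradients d,
        inner ℝ (h.opAt s hq2.toLp) V = inner ℝ (-(s • h.source hw₀ i)) V := by
      rintro V ⟨φ, hφ, hφc, hV⟩
      rw [← e1 hV, heq φ hφ hφc, e2 hV, inner_neg_left, real_inner_smul_left]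
    have e4 := hc.eq_solveOn h.alpha_pos (b := s • h.source hw₀ i) hQ fun V hV => by
      rw [inner_eq_of_testGradients e3 V hV, inner_neg_left]
    rw [e4]
    simp [solveOn]
  · refine fun heq => ⟨hq, hq2, fun φ hφ hφc => ?_⟩
    have hV := (memLp_gradient hφ hφc).coeFn_toLp
    rw [e1 hV, e2 hV, heq, map_smul, real_inner_smul_left,
      hc.inner_solveOn h.alpha_pos (testGradients_le (toLp_gradient_mem hφ hφc))]
    ring

theorem exists_isDefectCorrector {w₀ : Space d → ℝ} (hw₀ : MemH1Loc w₀) (i : Fin d)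
    (hs : s ∈ Icc (-M) M) : ∃ q, IsDefectCorrector A C s i w₀ q ∧
      ∀ q', IsDefectCorrector A C s i w₀ q' → weakGradient q' =ᵐ[volume] weakGradient q := by
  obtain ⟨q, hq, hQ⟩ := (squareGradients d).smul_mem s
    (solveOn_mem (T := h.opAt s) (b := h.source hw₀ i))
  have hq1 : MemH1Loc q := hQ.memH1Loc hq (Lp.memLp _).memL2Loc
  have hq2 : MemLp (weakGradient q) 2 volume :=
    (Lp.memLp _).ae_eq hQ.weakGradient_ae_eq.symm
  have heq : hq2.toLp = s • solveOn (squareGradients d) (h.opAt s) (h.source hw₀ i) :=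
    Lp.ext (hq2.coeFn_toLp.trans hQ.weakGradient_ae_eq)
  refine ⟨q, (h.isDefectCorrector_iff hw₀ hq1 hq2 hs).2 heq, fun q' hq' => ?_⟩
  have h1 := (h.isDefectCorrector_iff hw₀ hq'.1 hq'.2.1 hs).1 hq'
  rw [← heq] at h1
  have h2 := hq'.2.1.coeFn_toLp
  rw [h1] at h2
  exact h2.symm.trans hq2.coeFn_toLp

/-- The form applied to the whole-space corrector, as a function of `s`. -/
theorem cellForm_defectCorrector {w₀ v q : Space d → ℝ} (hw₀ : MemH1Loc w₀) (hv : MemH1Loc v)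
    (hs : s ∈ Icc (-M) M) (hq : IsDefectCorrector A C s i w₀ q) :
    cellForm C (weakGradient q) v j = s * inner ℝ
      (h.defectOp (solveOn (squareGradients d) (h.opAt s) (h.source hw₀ i)))
      (gradField 1 hv + unitField 1 j) := by
  rw [h.cellForm_eq hv (hq.2.1.coeFn_toLp.mono fun x hx _ => hx),
    (h.isDefectCorrector_iff hw₀ hq.1 hq.2.1 hs).1 hq, map_smul, real_inner_smul_left]

/-- `w₀` solves the supercell problem for `A`. Inserting `∇w₀` in the problem for `A + s 1_Q C`
leaves only `s` times the source, which the second term cancels. -/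
theorem gradField_defect [NeZero N] {w w₀ : Space d → ℝ} (hN : Odd N) (hs : s ∈ Icc (-M) M)
    (hw : IsPeriodicCorrector N (defectField A C s) i w) (hw₀ : IsPeriodicCorrector 1 A i w₀) :
    gradField N hw.1 = gradField N hw₀.1 +
      s • solveOn (periodicGradients d N) (h.opAt s) (h.source hw₀.1 i) := by
  have hc := h.isCoerciveOn_opAt hs (periodicGradients d N)
  have h0 := hw₀.supercell h.bounded h.periodic hN
  have e1 := hw.gradField_eq (h.bounded_defectField s) h.alpha_pos
    (by rw [h.op_defectField]; exact hc)
  rw [h.op_defectField] at e1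
  rw [e1]
  refine (hc.eq_solveOn h.alpha_pos ?_ fun V hV => ?_).symm
  · exact Submodule.add_mem _ (gradField_mem h0.1 h0.2.1) (Submodule.smul_mem _ _ solveOn_mem)
  · have h1 := (isPeriodicCorrector_iff h.bounded h0.1 h0.2.1).1 h0 V hV
    have h2 := hc.inner_solveOn (b := h.source hw₀.1 i) h.alpha_pos hV
    have h3 : h.source hw₀.1 i = h.defectOp (gradField N hw₀.1 + unitField N i) :=
      h.defectOp_congr ((gradField_add_unitField_cube_one hw₀.1).mono
        fun x hx hxQ => (hx hxQ).symm)
    have h4 : ∀ F, h.opAt s F = h.bounded.op F + s • h.defectOp F := fun F => rfl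
    rw [map_add (h.opAt s), map_smul (h.opAt s), inner_add_left, real_inner_smul_left, h2, h3]
    rw [map_add, inner_add_left] at h1
    rw [h4, h4, inner_add_left, inner_add_left, real_inner_smul_left, real_inner_smul_left,
      map_add, inner_add_left]
    linarith

/-- The flux through the supercell as a function of the amplitude of the defect. -/
theorem supercellFlux_eq [NeZero N] {w w₀ wt : Space d → ℝ} (hN : Odd N) (hs : s ∈ Icc (-M) M)
    (hw : IsPeriodicCorrector N (defectField A C s) i w) (hw₀ : IsPeriodicCorrector 1 A i w₀)
    (hwt : IsPeriodicCorrector 1 (fun x => (A x).transpose) j wt) :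
    supercellFlux A C N s w i j =
      inner ℝ (h.bounded.transpose.op (gradField N hwt.1 + unitField N j)) (unitField N i) +
      s * inner ℝ (h.source hw₀.1 i) (gradField 1 hwt.1 + unitField 1 j) +
      s ^ 2 * inner ℝ
        (h.defectOp (solveOn (periodicGradients d N) (h.opAt s) (h.source hw₀.1 i)))
        (gradField 1 hwt.1 + unitField 1 j) := by
  have hAt := h.bounded.transpose
  have ht := hwt.supercell hAt
    (fun k => (h.periodic k).mono fun x hx => congrArg Matrix.transpose hx) hN
  set Et := gradField N hwt.1 + unitField N j with hEt
  have e1 : supercellFlux A C N s w i j =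
      inner ℝ (h.opAt s (gradField N hw.1 + unitField N i)) (unitField N j) := by
    rw [← h.op_defectField]
    exact ((h.bounded_defectField s).inner_op_cube (gradField_add_unitField_apply hw.1)
      (coeFn_cubeField N _)).symm
  -- By the equation of `w` the flux is orthogonal to periodic gradients, so `e_j` may be replaced
  -- by `e_j + ∇w̃_j`.
  have e2 : inner ℝ (h.opAt s (gradField N hw.1 + unitField N i)) (gradField N hwt.1) = 0 := by
    rw [← h.op_defectField]
    exact (isPeriodicCorrector_iff (h.bounded_defectField s) hw.1 hw.2.1).1 hw _
      (gradField_mem ht.1 ht.2.1)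
  have e3 : inner ℝ (h.opAt s (gradField N hw.1 + unitField N i)) (unitField N j) =
      inner ℝ (h.opAt s (gradField N hw.1 + unitField N i)) Et := by
    rw [hEt, inner_add_right, e2, zero_add]
  -- After passing to the transpose, the adjoint equation removes `∇w`; what remains depends neither
  -- on `s` nor on `w`.
  have e4 : inner ℝ (h.bounded.op (gradField N hw.1 + unitField N i)) Et =
      inner ℝ (h.bounded.transpose.op Et) (unitField N i) := by
    rw [real_inner_comm, ← h.bounded.inner_op_transpose, inner_add_right,
      (isPeriodicCorrector_iff hAt ht.1 ht.2.1).1 ht _ (gradField_mem hw.1 hw.2.1), zero_add]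
  have e5 : ∀ F, inner ℝ (h.defectOp F) Et =
      inner ℝ (h.defectOp F) (gradField 1 hwt.1 + unitField 1 j) := fun F =>
    h.inner_defectOp_congr (gradField_add_unitField_cube_one hwt.1)
  have e6 : h.defectOp (gradField N hw.1 + unitField N i) = h.source hw₀.1 i +
      s • h.defectOp (solveOn (periodicGradients d N) (h.opAt s) (h.source hw₀.1 i)) := by
    rw [h.gradField_defect hN hs hw hw₀, add_right_comm, map_add, map_smul]
    congr 1
    exact h.defectOp_congr (gradField_add_unitField_cube_one hw₀.1)
  have h4 : ∀ F, h.opAt s F = h.bounded.op F + s • h.defectOp F := fun F => rfl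
  rw [e1, e3, h4, inner_add_left, e4, real_inner_smul_left, e5, e6, inner_add_left,
    real_inner_smul_left]
  ring

end IsDefectFamily

end Correctors

/-! ### Convergence of the supercell correctors -/

section Convergence

variable {d N : ℕ}

/-- Sum over lattice translates. The support of `φ` lies in a ball inside the cell, so in the open
cell only the term without translation survives; the faces are negligible. -/
theorem exists_periodization (hN : 0 < N) {φ : Space d → ℝ} (hφ : ContDiff ℝ ∞ φ)
    (hsupp : ∀ x, φ x ≠ 0 → ‖x‖ < N / 2) :
    ∃ ψ : Space d → ℝ, ContDiff ℝ ∞ ψ ∧ IsPeriodicField N ψ ∧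
      ∀ᵐ x, x ∈ cube N → gradient ψ x = gradient φ x := by
  have hN' : (0 : ℝ) < N := by exact_mod_cast hN
  have hN1 : (1 : ℝ) ≤ N := by exact_mod_cast hN
  set ψ : Space d → ℝ := fun x => ∑ᶠ k : Fin d → ℤ, φ (x + latticePoint N k) with hψ
  have hlf : LocallyFinite fun k : Fin d → ℤ =>
      Function.support fun x => φ (x + latticePoint N k) := by
    intro x
    obtain ⟨m, hm⟩ := exists_nat_ge (‖x‖ + 2)
    refine ⟨Metric.ball x 1, Metric.ball_mem_nhds x one_pos, ?_⟩
    refine (Finset.finite_toSet (Fintype.piFinset fun _ : Fin d =>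
      Finset.Icc (-(m : ℤ)) m)).subset ?_
    rintro k ⟨y, hy, hyx⟩
    rw [Finset.mem_coe, Fintype.mem_piFinset]
    intro i
    have h1 := hsupp _ hy
    have h2 := PiLp.norm_apply_le (y + latticePoint N k) i
    rw [PiLp.add_apply, latticePoint_apply, Real.norm_eq_abs] at h2
    have h3 := PiLp.norm_apply_le y i
    rw [Real.norm_eq_abs] at h3
    have h4 : ‖y‖ < ‖x‖ + 1 := by
      have := norm_sub_norm_le y x
      rw [Metric.mem_ball, dist_eq_norm] at hyx
      linarith
    have h5 : (N : ℝ) * |(k i : ℝ)| ≤ ‖x‖ + 1 + N / 2 := by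
      have h6 := abs_sub_abs_le_abs_sub ((N : ℝ) * k i) (-y i)
      rw [sub_neg_eq_add, abs_mul, abs_neg, Nat.abs_cast, add_comm] at h6
      linarith
    have h7 : |(k i : ℝ)| ≤ m := by
      refine le_trans ?_ hm
      have h8 : (N : ℝ) * |(k i : ℝ)| ≤ N * (‖x‖ + 2) := by
        nlinarith [norm_nonneg x, mul_nonneg (sub_nonneg.2 hN1) (norm_nonneg x)]
      exact le_of_mul_le_mul_left h8 hN'
    rw [Finset.mem_Icc, ← abs_le]
    exact_mod_cast h7
  have hsm : ContDiff ℝ ∞ ψ := by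
    have := contMDiff_finsum (I := modelWithCornersSelf ℝ ℝ)
      (I' := modelWithCornersSelf ℝ (Space d)) (n := ∞)
      (f := fun (k : Fin d → ℤ) x => φ (x + latticePoint N k))
      (fun k => (hφ.comp (contDiff_id.add contDiff_const)).contMDiff) hlf
    exact this.contDiff
  refine ⟨ψ, hsm, fun l => .of_forall fun x => ?_, ?_⟩
  · change ∑ᶠ k : Fin d → ℤ, φ (x + latticePoint N l + latticePoint N k) = ψ x
    rw [hψ]
    simp only []
    rw [← finsum_comp_equiv (Equiv.addLeft l) (f := fun k => φ (x + latticePoint N k))]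
    refine finsum_congr fun k => ?_
    congr 1
    ext i
    simp only [PiLp.add_apply, latticePoint_apply, Equiv.coe_addLeft, Pi.add_apply]
    push_cast
    ring
  · set U : Set (Space d) := {x | ∀ i, |x i| < N / 2} with hU
    have hUo : IsOpen U := by
      rw [hU, Set.ofPred_forall]
      exact isOpen_iInter_of_finite fun i => isOpen_lt (by fun_prop) continuous_const
    have heq : ∀ x ∈ U, ψ x = φ x := by
      intro x hx
      have h1 := finsum_eq_single (fun k : Fin d → ℤ => φ (x + latticePoint N k)) 0 fun k hk => ?_
      · have h0 : latticePoint N (0 : Fin d → ℤ) = 0 := by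
          ext i
          simp [latticePoint_apply]
        rw [h0, add_zero] at h1
        exact h1
      · by_contra hne
        obtain ⟨i, hi⟩ := Function.ne_iff.1 hk
        have h2 := (PiLp.norm_apply_le (x + latticePoint N k) i).trans_lt (hsupp _ hne)
        rw [PiLp.add_apply, latticePoint_apply, Real.norm_eq_abs] at h2
        have h3 : (1 : ℝ) ≤ |(k i : ℝ)| := by
          have := Int.one_le_abs hi
          exact_mod_cast this
        have h6 := abs_sub_abs_le_abs_sub ((N : ℝ) * k i) (-x i)
        rw [sub_neg_eq_add, abs_mul, abs_neg, Nat.abs_cast, add_comm] at h6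
        have h7 := hx i
        nlinarith
    filter_upwards [ae_forall_ne ((N : ℝ) / 2), ae_forall_ne (-((N : ℝ) / 2))] with x h1 h2 hx
    have hxU : x ∈ U := fun i => abs_lt.2
      ⟨lt_of_le_of_ne (hx i).1 (h2 i).symm, lt_of_le_of_ne (hx i).2 (h1 i)⟩
    have h3 : ψ =ᶠ[𝓝 x] φ := by
      filter_upwards [hUo.mem_nhds hxU] with y hy using heq y hy
    exact h3.gradient_eq

theorem ball_subset_cube : Metric.ball (0 : Space d) (N / 2) ⊆ cube N := by
  intro x hx i
  rw [mem_ball_zero_iff] at hx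
  have := PiLp.norm_apply_le x i
  rw [Real.norm_eq_abs] at this
  exact abs_le.1 (by linarith)

variable {A C : Space d → Matrix (Fin d) (Fin d) ℝ} {c c' α M s : ℝ} {i j : Fin d}

namespace IsDefectFamily

variable (h : IsDefectFamily A C α M c c')
include h

theorem inner_opAt_congr {F G G' : L2Field d} (hFG : ∀ᵐ x, F x ≠ 0 → G x = G' x) :
    inner ℝ (h.opAt s F) G = inner ℝ (h.opAt s F) G' := by
  rw [← h.op_defectField, IsBoundedField.inner_op, IsBoundedField.inner_op]
  refine integral_congr_ae ?_
  filter_upwards [hFG] with x hx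
  by_cases h0 : F x = 0
  · simp [h0]
  · rw [hx h0]

/-- The correctors on the supercells converge to the whole-space corrector. -/
theorem solveOn_periodicGradients_near (hs : s ∈ Icc (-M) M) (F : L2Field d) {ε : ℝ}
    (hε : 0 < ε) : ∃ N₀ : ℕ, ∀ (N : ℕ) [NeZero N], N₀ ≤ N →
      ‖solveOn (periodicGradients d N) (h.opAt s) (h.defectOp F) -
        solveOn (squareGradients d) (h.opAt s) (h.defectOp F)‖ ≤ ε := by
  obtain ⟨κ, hκ, htr⟩ := exists_truncation d
  set T := h.opAt s
  set b := h.defectOp F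
  set p := solveOn (squareGradients d) T b
  have hα := h.alpha_pos
  -- Chosen so that the final bound `‖T‖ δ κ / α + δ` equals `ε`.
  set δ : ℝ := ε / (‖T‖ * κ / α + 1) with hδ
  have hδ0 : 0 < δ := by positivity
  have hp : p ∈ closure (testGradients d : Set (L2Field d)) := squareGradients_le_closure solveOn_mem
  obtain ⟨Φ, ⟨φ, hφ, hφc, hΦ⟩, hdist⟩ := Metric.mem_closure_iff.1 hp δ hδ0
  rw [dist_eq_norm] at hdist
  -- The ball of radius `r` contains both the support of `φ` and `Q`. Requiring `N ≥ 4 r` puts it in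
  -- the ball of radius `N / 4`, where truncation at radius `N / 2` changes nothing.
  obtain ⟨r, hr⟩ := (hφc.isBounded.union
    (isCompact_cube (d := d) 1).isBounded).subset_ball (0 : Space d)
  obtain ⟨N₀, hN₀⟩ := exists_nat_ge (4 * r)
  refine ⟨N₀, fun N _ hN => ?_⟩
  have hN' : (0 : ℝ) < N := by exact_mod_cast NeZero.pos N
  have hrN : r ≤ N / 2 / 2 := by
    have : (N₀ : ℝ) ≤ N := by exact_mod_cast hN
    linarith
  have hball : Metric.ball (0 : Space d) r ⊆ Metric.ball 0 ((N : ℝ) / 2 / 2) :=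
    Metric.ball_subset_ball hrN
  have hball' : Metric.ball (0 : Space d) ((N : ℝ) / 2 / 2) ⊆ cube N :=
    (Metric.ball_subset_ball (by linarith)).trans ball_subset_cube
  have hφ0 : ∀ x ∉ Metric.ball (0 : Space d) r, gradient φ x = 0 := by
    intro x hx
    have h1 : x ∉ tsupport φ := fun hmem => hx (hr (.inl hmem))
    rw [notMem_tsupport_iff_eventuallyEq] at h1
    rw [h1.gradient_eq]
    exact gradient_fun_const x (0 : ℝ)
  obtain ⟨ψ, hψ, hψper, hψφ⟩ := exists_periodization (N := N) (NeZero.pos N) hφ fun x hx => by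
    have := hr (.inl (subset_tsupport φ hx))
    rw [mem_ball_zero_iff] at this
    linarith
  set pN := solveOn (periodicGradients d N) T b
  obtain ⟨u, hu, huper, hpu⟩ : pN ∈ periodicGradients d N := solveOn_mem
  have hψH := memH1Loc_of_contDiff hψ
  set v : Space d → ℝ := fun x => u x - ψ x
  have hv : MemH1Loc v := hu.sub hψH
  have hvper : IsPeriodicField N v := fun k => by
    filter_upwards [huper k, hψper k] with x h1 h2
    change u _ - ψ _ = u x - ψ x
    rw [h1, h2]
  -- On the cell the periodization `ψ` of `φ` has gradient `∇φ`, so the error is an admissible test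
  -- field for the supercell problem.
  have hVeq : pN - Φ = gradField N hv := by
    refine Lp.ext ?_
    filter_upwards [Lp.coeFn_sub pN Φ, coeFn_cubeField N hv.memL2Loc_weakGradient, hpu, hΦ, hψφ,
      (hu.hasWeakGradient.sub (hasWeakGradient_of_contDiff hψ)).weakGradient_ae_eq]
      with x h1 h2 h3 h4 h5 h6
    rw [h1, gradField, h2, Pi.sub_apply, h3, h4]
    by_cases hx : x ∈ cube N
    · rw [indicator_of_mem hx, indicator_of_mem hx, h6, h5 hx]
    · rw [indicator_of_notMem hx, indicator_of_notMem hx,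
        hφ0 x fun hxr => hx (hball' (hball hxr)), sub_zero]
  set V : L2Field d := gradField N hv with hV
  have hVmem : V ∈ periodicGradients d N := gradField_mem hv hvper
  obtain ⟨z, Z, -, hz, hzZ, hZ2, hZin, -, hZn⟩ := htr v (N / 2) hv (by positivity)
  have hZmem : hZ2.toLp ∈ squareGradients d := ⟨z, hz, hzZ.congr .rfl hZ2.coeFn_toLp.symm⟩
  have hZV : ‖hZ2.toLp‖ ≤ κ * ‖V‖ := by
    rw [Lp.norm_toLp, Lp.norm_def]
    have h1 : ballNorm (N / 2) (weakGradient v) ≤ eLpNorm V 2 volume := by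
      rw [hV, gradField, eLpNorm_congr_ae (coeFn_cubeField N _),
        eLpNorm_indicator_eq_eLpNorm_restrict (measurableSet_cube N)]
      exact eLpNorm_mono_measure _ (Measure.restrict_mono ball_subset_cube le_rfl)
    have h2 := ENNReal.toReal_mono (ENNReal.mul_ne_top ENNReal.ofReal_ne_top (Lp.memLp V).2.ne)
      (hZn.trans (mul_le_mul_right h1 _))
    rwa [ENNReal.toReal_mul, ENNReal.toReal_ofReal hκ] at h2
  have hVZ : ∀ᵐ x, x ∈ Metric.ball (0 : Space d) r → V x = (hZ2.toLp : L2Field d) x := by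
    filter_upwards [cubeField_apply (N := N) hv.memL2Loc_weakGradient, hZ2.coeFn_toLp]
      with x h1 h2 hx
    rw [h2, hZin x (hball hx)]
    exact h1 (hball' (hball hx))
  have e1 : inner ℝ b V = inner ℝ b hZ2.toLp :=
    h.inner_defectOp_congr (hVZ.mono fun x hx hxQ => hx (hr (.inr hxQ)))
  have e2 : inner ℝ (T Φ) V = inner ℝ (T Φ) hZ2.toLp := by
    refine h.inner_opAt_congr ?_
    filter_upwards [hVZ, hΦ] with x h1 h2 hx0
    refine h1 (by_contra fun hxr => hx0 ?_)
    rw [h2, hφ0 x hxr]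
  have hcoer := h.isCoerciveOn_opAt hs (periodicGradients d N)
  -- The source and `T Φ` see `V` only where it equals `Z`. The supercell equation is tested with
  -- `V`, the whole-space one with `Z`, and the source cancels.
  have e3 : inner ℝ (T V) V = inner ℝ (T (p - Φ)) hZ2.toLp := by
    conv_lhs => rw [← hVeq, map_sub, inner_sub_left, hVeq, hcoer.inner_solveOn hα hVmem, e1, e2]
    rw [map_sub, inner_sub_left,
      (h.isCoerciveOn_opAt hs (squareGradients d)).inner_solveOn hα hZmem]
  have e4 : α * ‖V‖ ≤ ‖T‖ * δ * κ := by
    refine le_of_mul_sq_le (norm_nonneg _) (by positivity) ?_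
    refine (hcoer V hVmem).trans ?_
    rw [e3]
    calc inner ℝ (T (p - Φ)) hZ2.toLp ≤ ‖T (p - Φ)‖ * ‖hZ2.toLp‖ := real_inner_le_norm _ _
      _ ≤ (‖T‖ * δ) * (κ * ‖V‖) := by
        gcongr
        exact (T.le_opNorm _).trans (by gcongr)
      _ = ‖T‖ * δ * κ * ‖V‖ := by ring
  calc ‖pN - p‖ = ‖V - (p - Φ)‖ := by
        rw [← hVeq]
        congr 1
        abel
    _ ≤ ‖V‖ + ‖p - Φ‖ := norm_sub_le _ _
    _ ≤ ‖T‖ * δ * κ / α + δ := by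
        refine add_le_add ?_ hdist.le
        rw [le_div_iff₀ hα, mul_comm]
        exact e4
    _ = δ * (‖T‖ * κ / α + 1) := by ring
    _ = ε := by
        rw [hδ]
        field_simp

/-- `T_s - T_t` is `s - t` times the defect operator. The Lipschitz constant does not depend on `K`,
hence not on `N`. -/
theorem norm_solveOn_sub_le (K : Submodule ℝ (L2Field d)) [CompleteSpace K] {s t : ℝ}
    (hs : s ∈ Icc (-M) M) (ht : t ∈ Icc (-M) M) (b : L2Field d) :
    ‖solveOn K (h.opAt s) b - solveOn K (h.opAt t) b‖ ≤
      ‖h.defectOp‖ * ‖b‖ / α ^ 2 * |s - t| := by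
  have hα := h.alpha_pos
  have h1 := (h.isCoerciveOn_opAt hs K).norm_solveOn_sub_le (b := b) hα (h.isCoerciveOn_opAt ht K)
  have h2 := (h.isCoerciveOn_opAt ht K).norm_solveOn_le (b := b) hα
  have h3 : h.opAt s - h.opAt t = (s - t) • h.defectOp := by
    rw [opAt, opAt, sub_smul]
    abel
  rw [h3, norm_smul, Real.norm_eq_abs] at h1
  have h4 : α ^ 2 * ‖solveOn K (h.opAt s) b - solveOn K (h.opAt t) b‖ ≤
      |s - t| * ‖h.defectOp‖ * ‖b‖ := by
    calc α ^ 2 * ‖solveOn K (h.opAt s) b - solveOn K (h.opAt t) b‖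
        = α * (α * ‖solveOn K (h.opAt s) b - solveOn K (h.opAt t) b‖) := by ring
      _ ≤ α * (|s - t| * ‖h.defectOp‖ * ‖solveOn K (h.opAt t) b‖) := by gcongr
      _ = |s - t| * ‖h.defectOp‖ * (α * ‖solveOn K (h.opAt t) b‖) := by ring
      _ ≤ _ := by gcongr
  rw [div_mul_eq_mul_div, le_div_iff₀ (by positivity)]
  linarith

/-- Pointwise convergence of uniformly Lipschitz functions on a compact interval is uniform. -/
theorem solveOn_periodicGradients_near_uniform (F : L2Field d) {ε : ℝ} (hε : 0 < ε) :
    ∃ N₀ : ℕ, ∀ (N : ℕ) [NeZero N], N₀ ≤ N → ∀ s ∈ Icc (-M) M,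
      ‖solveOn (periodicGradients d N) (h.opAt s) (h.defectOp F) -
        solveOn (squareGradients d) (h.opAt s) (h.defectOp F)‖ ≤ ε := by
  set b := h.defectOp F
  set L := ‖h.defectOp‖ * ‖b‖ / α ^ 2
  have hα := h.alpha_pos
  have hL : 0 ≤ L := by positivity
  have key : ∃ N₀ : ℕ, ∀ (N : ℕ) [NeZero N], N₀ ≤ N → ∀ s ∈ Icc (-M) M, s ∈ Icc (-M) M →
      ‖solveOn (periodicGradients d N) (h.opAt s) b -
        solveOn (squareGradients d) (h.opAt s) b‖ ≤ ε := by
    refine (isCompact_Icc (a := -M) (b := M)).induction_on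
      (p := fun S => ∃ N₀ : ℕ, ∀ (N : ℕ) [NeZero N], N₀ ≤ N → ∀ s ∈ S, s ∈ Icc (-M) M →
      ‖solveOn (periodicGradients d N) (h.opAt s) b -
        solveOn (squareGradients d) (h.opAt s) b‖ ≤ ε) ?_ ?_ ?_ ?_
    · exact ⟨0, fun N _ _ s hs => absurd hs (notMem_empty s)⟩
    · rintro S S' hSS' ⟨N₀, hN₀⟩
      exact ⟨N₀, fun N _ hN s hs => hN₀ N hN s (hSS' hs)⟩
    · rintro S S' ⟨N₀, hN₀⟩ ⟨N₁, hN₁⟩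
      refine ⟨max N₀ N₁, fun N _ hN s hs hsM => ?_⟩
      rcases hs with hs | hs
      · exact hN₀ N ((le_max_left _ _).trans hN) s hs hsM
      · exact hN₁ N ((le_max_right _ _).trans hN) s hs hsM
    · intro t ht
      -- Near `t` the two Lipschitz errors are at most `ε / 4` each, and the error at `t` is at most
      -- `ε / 2`.
      set η : ℝ := ε / (4 * (L + 1))
      have hη : 0 < η := by positivity
      obtain ⟨N₀, hN₀⟩ := h.solveOn_periodicGradients_near ht F (half_pos hε)
      refine ⟨Metric.ball t η, mem_nhdsWithin_of_mem_nhds (Metric.ball_mem_nhds t hη), N₀,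
        fun N _ hN s hs hsM => ?_⟩
      have h1 := hN₀ N hN
      have h2 := h.norm_solveOn_sub_le (periodicGradients d N) hsM ht b
      have h3 := h.norm_solveOn_sub_le (squareGradients d) hsM ht b
      have h4 : L * |s - t| ≤ ε / 4 := by
        rw [Metric.mem_ball, Real.dist_eq] at hs
        calc L * |s - t| ≤ (L + 1) * η := by
              gcongr
              linarith
          _ = ε / 4 := by
              simp only [η]
              field_simp
      set X₁ := solveOn (periodicGradients d N) (h.opAt s) b
      set X₂ := solveOn (squareGradients d) (h.opAt s) b
      set Y₁ := solveOn (periodicGradients d N) (h.opAt t) b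
      set Y₂ := solveOn (squareGradients d) (h.opAt t) b
      have h5 : X₁ - X₂ = (X₁ - Y₁) + (Y₁ - Y₂) - (X₂ - Y₂) := by abel
      rw [h5]
      have h6 := norm_sub_le ((X₁ - Y₁) + (Y₁ - Y₂)) (X₂ - Y₂)
      have h7 := norm_add_le (X₁ - Y₁) (Y₁ - Y₂)
      linarith
  obtain ⟨N₀, hN₀⟩ := key
  exact ⟨N₀, fun N _ hN s hs => hN₀ N hN s hs hs⟩

theorem contDiffOn_inner_solveOn (K : Submodule ℝ (L2Field d)) [CompleteSpace K]
    (b g : L2Field d) : ContDiffOn ℝ ∞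
      (fun s => (inner ℝ (h.defectOp (solveOn K (h.opAt s) b)) g : ℝ)) (Icc (-M) M) := by
  have h1 : ContDiffOn ℝ ∞ (fun s => solveOn K (h.opAt s) b) (Icc (-M) M) :=
    contDiffOn_solveOn h.alpha_pos fun s hs => h.isCoerciveOn_opAt hs K
  exact (h.defectOp.contDiff.comp_contDiffOn h1).inner ℝ contDiffOn_const

end IsDefectFamily

end Convergence

/-! ### The first-order tensor in the limit of large supercells -/

section Limit

variable {d N : ℕ} {A C : Space d → Matrix (Fin d) (Fin d) ℝ} {α β c c' M : ℝ} {i j : Fin d}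

/-- The exceptional null set may depend on `ξ`; a countable dense set of vectors and closedness of
the condition provide a common one. -/
theorem ae_forall_of_forall_ae {Y : Type*} [MeasurableSpace Y] {μ : Measure Y}
    {p : Y → Space d → ℝ → Prop} {S : Set ℝ} (hp : ∀ y s, IsClosed {ξ | p y ξ s})
    (h : ∀ ξ, ∀ᵐ y ∂μ, ∀ s ∈ S, p y ξ s) : ∀ᵐ y ∂μ, ∀ ξ, ∀ s ∈ S, p y ξ s := by
  filter_upwards [ae_all_iff.2 fun n => h (TopologicalSpace.denseSeq (Space d) n)] with y hy ξ s hs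
  refine (TopologicalSpace.denseRange_denseSeq (Space d)).induction_on
    (p := fun ξ => p y ξ s) ξ (hp y s) fun n => hy n s hs

/-- The bound on `C` comes from `M C = (A + M C) - A`, both terms being bounded by `β`. -/
theorem IsDefectFamily.of_bounds (hα : 0 < α) (hαβ : α ≤ β) (hM : 0 < M)
    (hAmeas : ∀ i j, AEMeasurable fun x => A x i j)
    (hCmeas : ∀ i j, AEMeasurable fun x => C x i j) (hAper : IsPeriodicField 1 A)
    (hcoer : ∀ ξ : Space d, ∀ᵐ x : Space d, ∀ s ∈ Icc (-M) M,
      α * ‖ξ‖ ^ 2 ≤ inner ℝ (act (A x + s • C x) ξ) ξ)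
    (hbdd : ∀ ξ : Space d, ∀ᵐ x : Space d, ∀ s ∈ Icc (-M) M,
      ‖act (A x + s • C x) ξ‖ ≤ β * ‖ξ‖) : IsDefectFamily A C α M β (2 * β / M) := by
  have hβ : 0 < β := hα.trans_le hαβ
  have h0 : (0 : ℝ) ∈ Icc (-M) M := ⟨by linarith, hM.le⟩
  have h1 := ae_forall_of_forall_ae (fun x s => isClosed_le (by fun_prop)
    ((continuous_act (A x + s • C x)).inner continuous_id)) hcoer
  have h2 := ae_forall_of_forall_ae (fun x s => isClosed_le
    (continuous_act (A x + s • C x)).norm (by fun_prop)) hbdd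
  refine ⟨hα, hM, ⟨hAmeas, ?_⟩, hAper, ⟨hCmeas, ?_⟩, by positivity, h1⟩
  · filter_upwards [h2] with x hx ξ
    simpa using hx ξ 0 h0
  · filter_upwards [h2] with x hx ξ
    have h3 := hx ξ 0 h0
    have h4 := hx ξ M ⟨by linarith, le_rfl⟩
    rw [zero_smul, add_zero] at h3
    rw [act_add, act_smul] at h4
    have h5 := norm_sub_le (act (A x) ξ + M • act (C x) ξ) (act (A x) ξ)
    rw [add_sub_cancel_left, norm_smul, Real.norm_eq_abs, abs_of_pos hM] at h5
    rw [div_mul_eq_mul_div, le_div_iff₀ hM]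
    linarith

/-- The field `∇w + e_i` on the unit cell, `w` being the `i`-th cell solution for `a`. -/
noncomputable def cellField {a : Space d → Matrix (Fin d) (Fin d) ℝ} (ha : IsBoundedField a c)
    (i : Fin d) : L2Field d :=
  solveOn (periodicGradients d 1) ha.op (ha.op (unitField 1 i)) + unitField 1 i

namespace IsDefectFamily

variable (h : IsDefectFamily A C α M c c')
include h

/-- The function of the amplitude `s` to which the first-order distribution is applied in the
limit of large supercells. -/
noncomputable def limitFlux (i j : Fin d) (s : ℝ) : ℝ :=
  s * inner ℝ (h.defectOp (cellField h.bounded i)) (cellField h.bounded.transpose j) +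
    s ^ 2 * inner ℝ (h.defectOp (solveOn (squareGradients d) (h.opAt s)
      (h.defectOp (cellField h.bounded i)))) (cellField h.bounded.transpose j)

theorem gradField_add_unitField_eq {w : Space d → ℝ} (hw : IsPeriodicCorrector 1 A i w) :
    gradField 1 hw.1 + unitField 1 i = cellField h.bounded i := by
  rw [cellField, hw.gradField_eq h.bounded h.alpha_pos (h.isCoerciveOn_bounded _)]

theorem gradField_add_unitField_eq_transpose {w : Space d → ℝ}
    (hw : IsPeriodicCorrector 1 (fun x => (A x).transpose) j w) :
    gradField 1 hw.1 + unitField 1 j = cellField h.bounded.transpose j := by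
  rw [cellField, hw.gradField_eq h.bounded.transpose h.alpha_pos (h.isCoerciveOn_transpose _)]

theorem contDiffOn_limitFlux (i j : Fin d) : ContDiffOn ℝ ∞ (h.limitFlux i j) (Ioo (-M) M) :=
  (contDiffOn_id.mul contDiffOn_const).add ((contDiffOn_id.pow 2).mul
    ((h.contDiffOn_inner_solveOn _ _ _).mono Ioo_subset_Icc_self))

/-- The point is that `κ`, which depends on `N`, is the same for all amplitudes and all correctors:
the first-order distribution ignores it. -/
theorem exists_supercellFlux_eq [NeZero N] (hN : Odd N) (i j : Fin d) : ∃ κ : ℝ,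
    ∀ s ∈ Icc (-M) M, ∀ w, IsPeriodicCorrector N (defectField A C s) i w →
      supercellFlux A C N s w i j = κ +
        s * inner ℝ (h.defectOp (cellField h.bounded i)) (cellField h.bounded.transpose j) +
        s ^ 2 * inner ℝ (h.defectOp (solveOn (periodicGradients d N) (h.opAt s)
          (h.defectOp (cellField h.bounded i)))) (cellField h.bounded.transpose j) := by
  obtain ⟨w₀, hw₀, -⟩ := exists_isPeriodicCorrector (N := 1) h.bounded h.alpha_pos
    (h.isCoerciveOn_bounded _) i
  obtain ⟨wt, hwt, -⟩ := exists_isPeriodicCorrector (N := 1) h.bounded.transpose h.alpha_pos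
    (h.isCoerciveOn_transpose _) j
  refine ⟨inner ℝ (h.bounded.transpose.op (gradField N hwt.1 + unitField N j)) (unitField N i),
    fun s hs w hw => ?_⟩
  rw [h.supercellFlux_eq hN hs hw hw₀ hwt, source, h.gradField_add_unitField_eq hw₀,
    h.gradField_add_unitField_eq_transpose hwt]

theorem contDiffOn_supercellFlux (hN : Odd N) {w : ℝ → Space d → ℝ}
    (hw : ∀ s ∈ Icc (-M) M, IsPeriodicCorrector N (defectField A C s) i (w s)) (j : Fin d) :
    ContDiffOn ℝ ∞ (fun s => supercellFlux A C N s (w s) i j) (Ioo (-M) M) := by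
  have : NeZero N := ⟨by rintro rfl; simp at hN⟩
  obtain ⟨κ, hκ⟩ := h.exists_supercellFlux_eq hN i j
  refine ContDiffOn.congr ?_ fun s hs =>
    hκ s (Ioo_subset_Icc_self hs) _ (hw s (Ioo_subset_Icc_self hs))
  exact (contDiffOn_const.add (contDiffOn_id.mul contDiffOn_const)).add ((contDiffOn_id.pow 2).mul
    ((h.contDiffOn_inner_solveOn _ _ _).mono Ioo_subset_Icc_self))

variable {Ω : Type*} [MeasurableSpace Ω] {P : Measure Ω} [IsProbabilityMeasure P] {ε : ℝ}
  {B : ℝ → Ω → ℝ} {P₁ : CompactDistribution (amplitudes M)}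

/-- Up to the constant `κ`, flux and limit differ by `s²` times a quantity that is small uniformly
in `s`, which is exactly the error that the first-order distribution controls. -/
theorem tendsto_pairing_supercellFlux (hP : HasFirstOrder P B P₁) (hε : 0 < ε)
    (hBbdd : ∀ η > 0, ∀ᵐ y ∂P, |B η y| ≤ M - ε) {w : ℕ → ℝ → Space d → ℝ}
    (hw : ∀ N, Odd N → ∀ s ∈ Icc (-M) M,
      IsPeriodicCorrector N (defectField A C s) i (w N s)) (j : Fin d) :
    Tendsto (fun N => P₁.pairing fun s => supercellFlux A C N s (w N s) i j)
      (atTop ⊓ 𝓟 {N | Odd N}) (𝓝 (P₁.pairing (h.limitFlux i j))) := by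
  rw [Metric.tendsto_nhds]
  intro e he
  set g := cellField h.bounded.transpose j with hg
  set b := h.defectOp (cellField h.bounded i) with hb
  set m := P₁.pairing fun s => s ^ 2
  -- Makes the final error at most `e / 2`; the added ones keep the denominator positive.
  set δ : ℝ := e / (2 * ((‖h.defectOp‖ * ‖g‖ + 1) * (|m| + 1)))
  have hδ : 0 < δ := by positivity
  obtain ⟨N₀, hN₀⟩ := h.solveOn_periodicGradients_near_uniform (cellField h.bounded i) hδ
  rw [eventually_inf_principal]
  filter_upwards [eventually_ge_atTop N₀] with N hNN hN
  have : NeZero N := ⟨by rintro rfl; simp at hN⟩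
  obtain ⟨κ, hκ⟩ := h.exists_supercellFlux_eq hN i j
  have key := hP.abs_pairing_sub_le h.M_pos hε hBbdd
    (h.contDiffOn_supercellFlux hN (hw N hN) j) (h.contDiffOn_limitFlux i j) (c := κ)
    (δ := ‖h.defectOp‖ * δ * ‖g‖) fun s hs => ?_
  · rw [Real.dist_eq]
    refine key.trans_lt ?_
    calc ‖h.defectOp‖ * δ * ‖g‖ * m ≤ δ * ((‖h.defectOp‖ * ‖g‖ + 1) * (|m| + 1)) := by
          have h1 : ‖h.defectOp‖ * ‖g‖ * m ≤ (‖h.defectOp‖ * ‖g‖ + 1) * (|m| + 1) := by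
            refine (mul_le_mul_of_nonneg_left (le_abs_self m) (by positivity)).trans ?_
            gcongr <;> linarith
          calc ‖h.defectOp‖ * δ * ‖g‖ * m = δ * (‖h.defectOp‖ * ‖g‖ * m) := by ring
            _ ≤ _ := by gcongr
      _ = e / 2 := by
          simp only [δ]
          field_simp
      _ < e := half_lt_self he
  · have hs' := Ioo_subset_Icc_self hs
    rw [hκ s hs' _ (hw N hN s hs'), limitFlux, ← hg, ← hb]
    have e1 : κ + s * inner ℝ b g + s ^ 2 * inner ℝ (h.defectOp
        (solveOn (periodicGradients d N) (h.opAt s) b)) g - (s * inner ℝ b g +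
        s ^ 2 * inner ℝ (h.defectOp (solveOn (squareGradients d) (h.opAt s) b)) g) - κ =
        s ^ 2 * inner ℝ (h.defectOp (solveOn (periodicGradients d N) (h.opAt s) b -
          solveOn (squareGradients d) (h.opAt s) b)) g := by
      rw [map_sub, inner_sub_left]
      ring
    rw [e1, abs_mul, abs_of_nonneg (sq_nonneg s), mul_comm]
    refine mul_le_mul_of_nonneg_right ?_ (sq_nonneg s)
    refine (abs_real_inner_le_norm _ _).trans ?_
    gcongr
    refine (h.defectOp.le_opNorm _).trans ?_
    gcongr
    exact hN₀ N hNN s hs'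

theorem contDiffOn_cellForm_defectCorrector {w₀ v : Space d → ℝ} {q : ℝ → Space d → ℝ}
    (hw₀ : MemH1Loc w₀) (hv : MemH1Loc v)
    (hq : ∀ s ∈ Icc (-M) M, IsDefectCorrector A C s i w₀ (q s)) (j : Fin d) :
    ContDiffOn ℝ ∞ (fun s => cellForm C (weakGradient (q s)) v j) (Ioo (-M) M) := by
  refine ContDiffOn.congr ?_ fun s hs =>
    h.cellForm_defectCorrector hw₀ hv (Ioo_subset_Icc_self hs) (hq s (Ioo_subset_Icc_self hs))
  exact contDiffOn_id.mul ((h.contDiffOn_inner_solveOn _ _ _).mono Ioo_subset_Icc_self)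

/-- The two functions agree on `]-M, M[` only; the comparison of pairings with zero constant and
zero error shows that this suffices. -/
theorem pairing_limitFlux (hP : HasFirstOrder P B P₁) (hε : 0 < ε)
    (hBbdd : ∀ η > 0, ∀ᵐ y ∂P, |B η y| ≤ M - ε) {w₀ wt : Space d → ℝ} {q : ℝ → Space d → ℝ}
    (hw₀ : IsPeriodicCorrector 1 A i w₀)
    (hwt : IsPeriodicCorrector 1 (fun x => (A x).transpose) j wt)
    (hq : ∀ s ∈ Icc (-M) M, IsDefectCorrector A C s i w₀ (q s)) :
    P₁.pairing (h.limitFlux i j) =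
      P₁.pairing (fun s => s * cellForm C (fun x => weakGradient w₀ x + unitVec i) wt j) +
      P₁.pairing (fun s => s * cellForm C (weakGradient (q s)) wt j) := by
  have h1 : ContDiffOn ℝ ∞ (fun s => s * cellForm C (fun x => weakGradient w₀ x + unitVec i) wt j)
      (Ioo (-M) M) := contDiffOn_id.mul contDiffOn_const
  have h2 : ContDiffOn ℝ ∞ (fun s => s * cellForm C (weakGradient (q s)) wt j) (Ioo (-M) M) :=
    contDiffOn_id.mul (h.contDiffOn_cellForm_defectCorrector hw₀.1 hwt.1 hq j)
  rw [← hP.pairing_add h1 h2]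
  have key := hP.abs_pairing_sub_le h.M_pos hε hBbdd (h.contDiffOn_limitFlux i j) (h1.add h2)
    (c := 0) (δ := 0) fun s hs => ?_
  · rw [zero_mul] at key
    exact sub_eq_zero.1 (abs_nonpos_iff.1 key)
  · rw [zero_mul, abs_nonpos_iff, sub_zero, sub_eq_zero, limitFlux,
      h.cellForm_eq hwt.1 (gradField_add_unitField_apply hw₀.1),
      h.cellForm_defectCorrector hw₀.1 hwt.1 (Ioo_subset_Icc_self hs)
        (hq s (Ioo_subset_Icc_self hs)), source, h.gradField_add_unitField_eq hw₀,
      h.gradField_add_unitField_eq_transpose hwt]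
    ring

end IsDefectFamily

theorem inner_act_unitVec (a : Matrix (Fin d) (Fin d) ℝ) (i j : Fin d) :
    inner ℝ (act a (unitVec i)) (unitVec j) = a j i := by
  rw [real_inner_comm, EuclideanSpace.inner_single_left, act_apply]
  simp

end Limit

/-! ### The theorem -/

theorem proposition7
    {Ω : Type*} [MeasurableSpace Ω] (P : Measure Ω) [IsProbabilityMeasure P]
    (d : ℕ) (A C : Space d → Matrix (Fin d) (Fin d) ℝ) (α β M ε : ℝ)
    (hα : 0 < α) (hαβ : α ≤ β) (hM : 0 < M) (hε : 0 < ε)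
    -- the periodic tensor fields
    (hAmeas : ∀ i j, AEMeasurable fun x => A x i j)
    (hCmeas : ∀ i j, AEMeasurable fun x => C x i j)
    (hAper : IsPeriodicField 1 A) (hCper : IsPeriodicField 1 C)
    (hcoer : ∀ ξ : Space d, ∀ᵐ x : Space d, ∀ s ∈ Icc (-M) M,
      α * ‖ξ‖ ^ 2 ≤ inner ℝ (act (A x + s • C x) ξ) ξ)
    (hbdd : ∀ ξ : Space d, ∀ᵐ x : Space d, ∀ s ∈ Icc (-M) M,
      ‖act (A x + s • C x) ξ‖ ≤ β * ‖ξ‖)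
    -- the random variables and the expansion of their laws
    (B : ℝ → Ω → ℝ) (hBmeas : ∀ η > 0, AEMeasurable (B η) P)
    (hBbdd : ∀ η > 0, ∀ᵐ y ∂P, |B η y| ≤ M - ε)
    (hBzero : Tendsto (fun η => eLpNorm (B η) 2 P) (𝓝[>] 0) (𝓝 0))
    (P₁ P₂ : CompactDistribution (amplitudes M))
    (hexp : ∀ φ : ℝ → ℝ, ContDiffOn ℝ ∞ φ (Ioo (-M) M) →
      (fun η => (∫ y, φ (B η y) ∂P) - (φ 0 + η * P₁.pairing φ + η ^ 2 * P₂.pairing φ))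
        =o[𝓝[>] (0 : ℝ)] fun η => η ^ 2) :
    -- all the correctors exist, and their gradients are unique
    (∀ i, ∃ w, IsPeriodicCorrector 1 A i w ∧
      ∀ w', IsPeriodicCorrector 1 A i w' → weakGradient w' =ᵐ[volume] weakGradient w) ∧
    (∀ i, ∃ w, IsPeriodicCorrector 1 (fun x => (A x).transpose) i w ∧
      ∀ w', IsPeriodicCorrector 1 (fun x => (A x).transpose) i w' →
        weakGradient w' =ᵐ[volume] weakGradient w) ∧
    (∀ N, Odd N → ∀ s ∈ Icc (-M) M, ∀ i, ∃ w, IsPeriodicCorrector N (defectField A C s) i w ∧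
      ∀ w', IsPeriodicCorrector N (defectField A C s) i w' →
        weakGradient w' =ᵐ[volume] weakGradient w) ∧
    (∀ i w₀, IsPeriodicCorrector 1 A i w₀ → ∀ s ∈ Icc (-M) M,
      ∃ q, IsDefectCorrector A C s i w₀ q ∧
        ∀ q', IsDefectCorrector A C s i w₀ q' → weakGradient q' =ᵐ[volume] weakGradient q) ∧
    -- convergence to a limit that does not depend on the choice of the correctors
    ∃ Abar : Matrix (Fin d) (Fin d) ℝ,
      (∀ w : ℕ → ℝ → Fin d → Space d → ℝ,
        (∀ N, Odd N → ∀ s ∈ Icc (-M) M, ∀ i,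
          IsPeriodicCorrector N (defectField A C s) i (w N s i)) →
        (∀ N, Odd N → ∀ i j,
          ContDiffOn ℝ ∞ (fun s => supercellFlux A C N s (w N s i) i j) (Ioo (-M) M)) ∧
        Tendsto (fun N => firstOrderTensor P₁ A C N (w N)) (atTop ⊓ 𝓟 {N | Odd N}) (𝓝 Abar)) ∧
      ∀ (w₀ wt : Fin d → Space d → ℝ) (q : ℝ → Fin d → Space d → ℝ),
        (∀ i, IsPeriodicCorrector 1 A i (w₀ i)) →
        (∀ j, IsPeriodicCorrector 1 (fun x => (A x).transpose) j (wt j)) →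
        (∀ s ∈ Icc (-M) M, ∀ i, IsDefectCorrector A C s i (w₀ i) (q s i)) →
        ∀ i j,
          ContDiffOn ℝ ∞ (fun s => cellForm C (weakGradient (q s i)) (wt j) j) (Ioo (-M) M) ∧
          inner ℝ (act Abar (unitVec i)) (unitVec j) =
            P₁.pairing (fun s =>
              s * cellForm C (fun x => weakGradient (w₀ i) x + unitVec i) (wt j) j) +
            P₁.pairing (fun s => s * cellForm C (weakGradient (q s i)) (wt j) j) := by
  have h := IsDefectFamily.of_bounds hα hαβ hM hAmeas hCmeas hAper hcoer hbdd
  have hP := hasFirstOrder_of_expansion hε hBmeas hBbdd hexp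
  -- The limit tensor is built from solutions of the coercive problems, without choosing correctors,
  -- so it is independent of them. Its entry in row `j` and column `i` is the `j`-th component of
  -- the image of `e_i`.
  refine ⟨fun i => exists_isPeriodicCorrector h.bounded hα (h.isCoerciveOn_bounded _) i,
    fun i => exists_isPeriodicCorrector h.bounded.transpose hα (h.isCoerciveOn_transpose _) i,
    fun N hN s hs i => ?_, fun i w₀ hw₀ s hs => h.exists_isDefectCorrector hw₀.1 i hs,
    Matrix.of fun j i => P₁.pairing (h.limitFlux i j), fun w hw => ⟨fun N hN i j => ?_, ?_⟩,
    fun w₀ wt q hw₀ hwt hq i j => ⟨?_, ?_⟩⟩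
  · have : NeZero N := ⟨by rintro rfl; simp at hN⟩
    refine exists_isPeriodicCorrector (h.bounded_defectField s) hα ?_ i
    rw [h.op_defectField]
    exact h.isCoerciveOn_opAt hs _
  · exact h.contDiffOn_supercellFlux hN (fun s hs => hw N hN s hs i) j
  · refine tendsto_pi_nhds.2 fun j => tendsto_pi_nhds.2 fun i => ?_
    exact h.tendsto_pairing_supercellFlux hP hε hBbdd (fun N hN s hs => hw N hN s hs i) j
  · exact h.contDiffOn_cellForm_defectCorrector (hw₀ i).1 (hwt j).1 (fun s hs => hq s hs i) j
  · rw [inner_act_unitVec]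
    exact h.pairing_limitFlux hP hε hBbdd (hw₀ i) (hwt j) fun s hs => hq s hs i
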